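/- Let $D\subset\mathbb R^n$ be a bounded open set and let $m\in L^\infty(D)$ be complex valued. Let $H^2_0(D)$ be the completion of $C_0^\infty(D)$ in the norm $(\|u\|_{L^2}^2+\|\Delta u\|_{L^2}^2)^{1/2}$, let $\Delta_{00}$ be the Laplacian with domain $H^2_0(D)$, and let $\Delta$ be the distributional Laplacian with domain $\{v\in L^2(D):\Delta v\in L^2(D)\}$. Consider the unbounded operator $$B=B_m=\begin{pmatrix}\Delta_{00}&m\\0&\Delta\end{pmatrix}\quad\text{on }L^2(D)\oplus L^2(D),\qquad \operatorname{dom}B=H^2_0(D)\oplus\{v\in L^2(D):\Delta v\in L^2(D)\}.$$ Suppose that there are real numbers $m^*\ge m_*>0$ and a unit complex number $e^{i\theta}$ such that (1) $\operatorname{Re}(e^{i\theta}m(x))>m_*$ for a.e. $x\in D$ in some neighborhood of $\partial D$, and (2) $|m(x)|<m^*$ for a.e. $x\in D$. Then the following hold. (a) The spectrum of $B$ is a (possibly empty) discrete set without accumulation points in $\mathbb C$, it consists of eigenvalues, and the generalized eigenspaces $\bigcup_k\ker(B-\lambda I)^k$ are finite dimensional. (b) Eigenspaces corresponding to different eigenvalues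 are linearly independent. (c) The eigenvalues and generalized eigenspaces depend continuously on $m$ in the $L^\infty(D)$ topology, in the following sense. Let $\gamma$ be a bounded rectifiable curve that avoids the spectrum of $B_m$. Then $\gamma$ avoids the spectrum of $B_p$ for all $p$ in an $L^\infty(D)$-neighborhood of $m$, and $$P_\gamma(p)=\frac1{2\pi i}\int_\gamma (B_p-\lambda I)^{-1}\,d\lambda ,$$ as a bounded operator $L^2(D)\oplus L^2(D)\to H^2_0(D)\oplus L^2(D)$, is continuous in operator norm at $p=m$. If $\gamma$ is a circle, oriented clockwise, then for all $p$ in some neighborhood of $m$ the operator $P_\gamma(p)$ is a projection onto the sum of the generalized eigenspaces of $B_p$ for the eigenvalues inside $\gamma$, and the dimension of this sum (the total algebraic multiplicity of the eigenvalues inside $\gamma$) is finite and equal to its value for $p=m$. -/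

import Mathlib

open MeasureTheory TopologicalSpace Filter Topology
open scoped ENNReal ContDiff InnerProductSpace Laplacian Distributions

noncomputable section

/-! ### Spectral theory of unbounded operators -/

namespace UnboundedOperator

variable {X : Type*} [NormedAddCommGroup X] [NormedSpace ℂ X]

/-- `R` is a bounded two-sided inverse of `A - z I : dom A → X`. -/
def IsResolventAt (A : X →ₗ.[ℂ] X) (z : ℂ) (R : X →L[ℂ] X) : Prop :=
  (∀ y : X, ∃ h : R y ∈ A.domain, A ⟨R y, h⟩ - z • R y = y) ∧
    ∀ x : A.domain, R (A x - z • (x : X)) = x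

/-- The spectrum of `A`: all `z` for which `A - z I : dom A → X` has no bounded inverse. -/
def spectrum (A : X →ₗ.[ℂ] X) : Set ℂ := {z | ¬ ∃ R : X →L[ℂ] X, IsResolventAt A z R}

/-- The bounded inverse of `A - z I` is unique. -/
theorem IsResolventAt.unique {A : X →ₗ.[ℂ] X} {z : ℂ} {R S : X →L[ℂ] X}
    (hR : IsResolventAt A z R) (hS : IsResolventAt A z S) : R = S := by
  ext y
  obtain ⟨h, hy⟩ := hR.1 y
  have := hS.2 ⟨R y, h⟩
  rw [hy] at this
  exact this.symm

open Classical in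
/-- The resolvent `(A - z I)⁻¹`, with value `0` if `z` is in the spectrum. -/
def resolvent (A : X →ₗ.[ℂ] X) (z : ℂ) : X →L[ℂ] X :=
  if h : ∃ R : X →L[ℂ] X, IsResolventAt A z R then h.choose else 0

/-- The kernel of `(A - z I) ^ k`: the vectors `x` such that `x, (A - z) x, …, (A - z) ^ (k - 1) x`
all lie in the domain of `A` and `(A - z) ^ k x = 0`. -/
def powKer (A : X →ₗ.[ℂ] X) (z : ℂ) : ℕ → Submodule ℂ X
  | 0 => ⊥
  | k + 1 => ((powKer A z k).comap (A.toFun - z • A.domain.subtype)).map A.domain.subtype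

theorem mem_powKer_succ {A : X →ₗ.[ℂ] X} {z : ℂ} {k : ℕ} {x : X} :
    x ∈ powKer A z (k + 1) ↔ ∃ h : x ∈ A.domain, A ⟨x, h⟩ - z • x ∈ powKer A z k := by
  simp [powKer]

/-- The eigenspace `{x ∈ dom A | A x = z x}`. -/
def eigenspace (A : X →ₗ.[ℂ] X) (z : ℂ) : Submodule ℂ X := powKer A z 1

theorem mem_eigenspace {A : X →ₗ.[ℂ] X} {z : ℂ} {x : X} :
    x ∈ eigenspace A z ↔ ∃ h : x ∈ A.domain, A ⟨x, h⟩ = z • x := by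
  simp [eigenspace, powKer, sub_eq_zero]

/-- The generalized eigenspace, the union of the increasing sequence `ker (A - z I) ^ k`. -/
def genEigenspace (A : X →ₗ.[ℂ] X) (z : ℂ) : Submodule ℂ X := ⨆ k : ℕ, powKer A z k

/-- `(2πi)⁻¹ ∫_γ (A - λ I)⁻¹ dλ` along the curve `γ : [a, b] → ℂ`. -/
def spectralProjection (A : X →ₗ.[ℂ] X) (γ : ℝ → ℂ) (a b : ℝ) : X →L[ℂ] X :=
  (2 * (Real.pi : ℂ) * Complex.I)⁻¹ • ∫ t in a..b, deriv γ t • resolvent A (γ t)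

/-- The sum of the generalized eigenspaces of the eigenvalues in the set `S`. -/
def spectralSubspace (A : X →ₗ.[ℂ] X) (S : Set ℂ) : Submodule ℂ X := ⨆ z ∈ S, genEigenspace A z

end UnboundedOperator

/-! ### The interior transmission operator -/

namespace Transmission

variable {n : ℕ}

/-- Lebesgue measure on `D`. -/
abbrev volOn (D : Opens (EuclideanSpace ℝ (Fin n))) : Measure (EuclideanSpace ℝ (Fin n)) :=
  volume.restrict (D : Set (EuclideanSpace ℝ (Fin n)))

/-- The complex Hilbert space `L²(D)`. -/
abbrev L2 (D : Opens (EuclideanSpace ℝ (Fin n))) : Type :=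
  Lp ℂ 2 (volOn D)

/-- The complex Banach space `L^∞(D)`. -/
abbrev LInf (D : Opens (EuclideanSpace ℝ (Fin n))) : Type :=
  Lp ℂ ∞ (volOn D)

/-- The Hilbert space `L²(D) ⊕ L²(D)`. -/
abbrev L2Sum (D : Opens (EuclideanSpace ℝ (Fin n))) : Type := WithLp 2 (L2 D × L2 D)

variable {D : Opens (EuclideanSpace ℝ (Fin n))}

section TestFunctions

theorem contDiff_laplacian {f : EuclideanSpace ℝ (Fin n) → ℂ} (hf : ContDiff ℝ ∞ f) :
    ContDiff ℝ ∞ (Δ f) := by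
  rw [InnerProductSpace.laplacian_eq_iteratedFDeriv_stdOrthonormalBasis]
  refine ContDiff.sum fun i _ => ?_
  simp only [iteratedFDeriv_two_apply]
  have h1 : ContDiff ℝ ∞ (fderiv ℝ f) := hf.fderiv_right (by simp)
  have h2 : ContDiff ℝ ∞ (fderiv ℝ (fderiv ℝ f)) := h1.fderiv_right (by simp)
  exact (h2.clm_apply contDiff_const).clm_apply contDiff_const

theorem hasCompactSupport_laplacian {f : EuclideanSpace ℝ (Fin n) → ℂ}
    (hf : HasCompactSupport f) : HasCompactSupport (Δ f) := by
  refine HasCompactSupport.intro hf fun x hx => ?_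
  have h0 : f =ᶠ[𝓝 x] fun _ => (0 : ℂ) := notMem_tsupport_iff_eventuallyEq.mp hx
  rw [InnerProductSpace.laplacian_congr_nhds h0 |>.eq_of_nhds]
  simp

theorem memLp_test (φ : 𝓓(D, ℂ)) :
    MemLp (φ : EuclideanSpace ℝ (Fin n) → ℂ) 2 (volOn D) :=
  (φ.continuous.memLp_of_hasCompactSupport φ.hasCompactSupport).restrict _

theorem memLp_laplacian_test (φ : 𝓓(D, ℂ)) :
    MemLp (Δ (φ : EuclideanSpace ℝ (Fin n) → ℂ)) 2 (volOn D) :=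
  ((contDiff_laplacian φ.contDiff).continuous.memLp_of_hasCompactSupport
    (hasCompactSupport_laplacian φ.hasCompactSupport)).restrict _

end TestFunctions

/-- `Δ v = w` in `D` in the sense of distributions. -/
def IsWeakLaplacian (v w : L2 D) : Prop :=
  ∀ φ : 𝓓(D, ℂ), ∫ x, v x * Δ (⇑φ) x ∂(volOn D) = ∫ x, w x * φ x ∂(volOn D)

theorem integral_add_mul (f g : L2 D) {h : EuclideanSpace ℝ (Fin n) → ℂ}
    (hh : MemLp h 2 (volOn D)) :
    ∫ z, (f + g) z * h z ∂(volOn D) =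
      (∫ z, f z * h z ∂(volOn D)) + ∫ z, g z * h z ∂(volOn D) := by
  have h1 : Integrable (fun z => f z * h z) (volOn D) := (Lp.memLp f).integrable_mul hh
  have h2 : Integrable (fun z => g z * h z) (volOn D) := (Lp.memLp g).integrable_mul hh
  rw [← integral_add h1 h2]
  refine integral_congr_ae ?_
  filter_upwards [Lp.coeFn_add f g] with z hz
  rw [hz, Pi.add_apply, add_mul]

theorem integral_smul_mul (c : ℂ) (f : L2 D) (h : EuclideanSpace ℝ (Fin n) → ℂ) :
    ∫ z, (c • f) z * h z ∂(volOn D) = c * ∫ z, f z * h z ∂(volOn D) := by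
  rw [← integral_const_mul]
  refine integral_congr_ae ?_
  filter_upwards [Lp.coeFn_smul c f] with z hz
  simp [hz, mul_assoc]

variable (D) in
/-- The graph of the distributional Laplacian in `L²(D)`. -/
def weakLaplacianGraph : Submodule ℂ (L2 D × L2 D) where
  carrier := {x | IsWeakLaplacian x.1 x.2}
  zero_mem' φ := by
    have h (g : EuclideanSpace ℝ (Fin n) → ℂ) := integral_smul_mul (D := D) 0 0 g
    simp only [smul_zero, zero_mul] at h
    exact (h _).trans (h _).symm
  add_mem' {x y} hx hy φ := by
    change ∫ z, (x.1 + y.1) z * _ ∂_ = ∫ z, (x.2 + y.2) z * _ ∂_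
    rw [integral_add_mul _ _ (memLp_laplacian_test φ), integral_add_mul _ _ (memLp_test φ),
      hx φ, hy φ]
  smul_mem' c x hx φ := by
    change ∫ z, (c • x.1) z * _ ∂_ = ∫ z, (c • x.2) z * _ ∂_
    rw [integral_smul_mul, integral_smul_mul, hx φ]

/-- The distributional Laplacian is unique. -/
theorem weakLaplacianGraph_single (x : L2 D × L2 D) (hx : x ∈ weakLaplacianGraph D)
    (hx0 : x.1 = 0) : x.2 = 0 := by
  have hw : ∀ φ : 𝓓(D, ℂ), ∫ z, x.2 z * φ z ∂(volOn D) = 0 := by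
    intro φ
    rw [← hx φ, hx0]
    have h := integral_smul_mul (D := D) 0 0 (Δ (⇑φ))
    simpa only [smul_zero, zero_mul] using h
  have hloc : LocallyIntegrableOn (x.2 : EuclideanSpace ℝ (Fin n) → ℂ) D volume :=
    locallyIntegrableOn_of_locallyIntegrable_restrict
      ((Lp.memLp x.2).locallyIntegrable (by norm_num))
  have h0 := D.isOpen.ae_eq_zero_of_integral_contDiff_smul_eq_zero hloc (by
    intro g hg hgc hgs
    let φ : 𝓓(D, ℂ) := ⟨fun z => (g z : ℂ), Complex.ofRealCLM.contDiff.comp hg,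
      hgc.comp_left (g := fun r : ℝ => (r : ℂ)) (by simp),
      (tsupport_comp_subset (g := fun r : ℝ => (r : ℂ)) (by simp) g).trans hgs⟩
    rw [← setIntegral_eq_integral_of_forall_compl_eq_zero (s := (D : Set _)), ← hw φ]
    · refine integral_congr_ae (.of_forall fun z => ?_)
      change g z • x.2 z = x.2 z * (g z : ℂ)
      rw [Complex.real_smul, mul_comm]
    · intro z hz
      have : g z = 0 := by
        by_contra h
        exact hz (hgs (subset_tsupport _ h))
      simp [this])
  apply Lp.ext
  filter_upwards [(ae_restrict_iff' D.isOpen.measurableSet).2 h0,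
    Lp.coeFn_zero ℂ 2 (volOn D)] with z h1 h2
  rw [h1, h2]; rfl

variable (D) in
/-- The Laplacian without boundary conditions, with domain `{v ∈ L²(D) : Δ v ∈ L²(D)}`. -/
def laplacianMax : L2 D →ₗ.[ℂ] L2 D := (weakLaplacianGraph D).toLinearPMap

theorem mem_graph_laplacianMax {v w : L2 D} :
    (v, w) ∈ (laplacianMax D).graph ↔ IsWeakLaplacian v w := by
  rw [laplacianMax, Submodule.toLinearPMap_graph_eq _ weakLaplacianGraph_single]
  rfl

variable (D) in
/-- The pairs `(φ, Δ φ)` with `φ ∈ C₀^∞(D)`. -/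
def testGraph : Submodule ℂ (L2Sum D) where
  carrier := {x | ∃ φ : 𝓓(D, ℂ), x.fst =ᵐ[volOn D] φ ∧ x.snd =ᵐ[volOn D] Δ (⇑φ)}
  zero_mem' := by
    have e : (⇑(0 : 𝓓(D, ℂ)) : EuclideanSpace ℝ (Fin n) → ℂ) = fun _ => 0 := rfl
    refine ⟨0, ?_, ?_⟩
    · rw [e]
      exact Lp.coeFn_zero ℂ 2 (volOn D)
    · filter_upwards [Lp.coeFn_zero ℂ 2 (volOn D)] with z hz
      rw [e]
      simpa using hz
  add_mem' := by
    rintro x y ⟨φ, h1, h2⟩ ⟨ψ, h3, h4⟩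
    refine ⟨φ + ψ, ?_, ?_⟩
    · filter_upwards [h1, h3, Lp.coeFn_add x.fst y.fst] with z a b c
      rw [WithLp.add_fst, c]
      simp [a, b]
    · filter_upwards [h2, h4, Lp.coeFn_add x.snd y.snd] with z a b c
      have e : (⇑(φ + ψ) : EuclideanSpace ℝ (Fin n) → ℂ) = ⇑φ + ⇑ψ := rfl
      rw [WithLp.add_snd, c, e, ContDiffAt.laplacian_add]
      · simp [a, b]
      · exact (contDiff_infty.1 φ.contDiff 2).contDiffAt
      · exact (contDiff_infty.1 ψ.contDiff 2).contDiffAt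
  smul_mem' := by
    rintro c x ⟨φ, h1, h2⟩
    refine ⟨c • φ, ?_, ?_⟩
    · filter_upwards [h1, Lp.coeFn_smul c x.fst] with z a b
      rw [WithLp.smul_fst, b]
      simp [a]
    · filter_upwards [h2, Lp.coeFn_smul c x.snd] with z a b
      have e : (⇑(c • φ) : EuclideanSpace ℝ (Fin n) → ℂ) = c • ⇑φ := rfl
      have hφ : ContDiff ℝ 2 (⇑φ) := contDiff_infty.1 φ.contDiff 2
      have h : Δ (c • ⇑φ) z = c • Δ (⇑φ) z :=
        hφ.contDiffAt.laplacian_CLM_comp_left (x := z)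
          (l := (c • ContinuousLinearMap.id ℂ ℂ).restrictScalars ℝ)
      rw [WithLp.smul_snd, b, e, h]
      simp [a]

variable (D) in
/-- The Hilbert space `H²₀(D)`, the completion of `C₀^∞(D)` in the norm
`(‖u‖² + ‖Δ u‖²)^{1/2}`, realized isometrically as the closure in `L²(D) ⊕ L²(D)` of the set of
pairs `(φ, Δ φ)`. Its element `(u, w)` stands for the function `u`, and then `w = Δ u`. -/
def H20 : Submodule ℂ (L2Sum D) := (testGraph D).topologicalClosure

theorem fderiv_fderiv_smooth {f : EuclideanSpace ℝ (Fin n) → ℂ} (hf : ContDiff ℝ ∞ f)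
    (v : EuclideanSpace ℝ (Fin n)) : ContDiff ℝ ∞ (fun x => fderiv ℝ f x v) :=
  (hf.fderiv_right (m := ∞) (by simp)).clm_apply contDiff_const

theorem laplacian_eq_sum_fderiv {f : EuclideanSpace ℝ (Fin n) → ℂ} (hf : ContDiff ℝ ∞ f)
    (x : EuclideanSpace ℝ (Fin n)) :
    Δ f x = ∑ i, fderiv ℝ (fun y => fderiv ℝ f y (stdOrthonormalBasis ℝ _ i)) x
      (stdOrthonormalBasis ℝ (EuclideanSpace ℝ (Fin n)) i) := by
  rw [InnerProductSpace.laplacian_eq_iteratedFDeriv_stdOrthonormalBasis]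
  refine Finset.sum_congr rfl fun i _ => ?_
  have h1 : ContDiff ℝ ∞ (fderiv ℝ f) := hf.fderiv_right (by simp)
  rw [iteratedFDeriv_two_apply, fderiv_clm_apply (h1.differentiable (by simp) x) (by fun_prop)]
  simp

/-- Green's formula for test functions. -/
theorem integral_mul_laplacian {f g : EuclideanSpace ℝ (Fin n) → ℂ} (hf : ContDiff ℝ ∞ f)
    (hg : ContDiff ℝ ∞ g)
    (hfc : HasCompactSupport f) :
    ∫ x, f x * Δ g x = ∫ x, Δ f x * g x := by
  have int {a b : EuclideanSpace ℝ (Fin n) → ℂ} (ha : ContDiff ℝ ∞ a) (hb : ContDiff ℝ ∞ b)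
      (hac : HasCompactSupport a) : Integrable (fun x => a x * b x) :=
    (ha.continuous.mul hb.continuous).integrable_of_hasCompactSupport hac.mul_right
  have ibp {a b : EuclideanSpace ℝ (Fin n) → ℂ} (ha : ContDiff ℝ ∞ a) (hb : ContDiff ℝ ∞ b)
      (hac : HasCompactSupport a) (v : EuclideanSpace ℝ (Fin n)) :
      ∫ x, a x * fderiv ℝ b x v = - ∫ x, fderiv ℝ a x v * b x :=
    integral_mul_fderiv_eq_neg_fderiv_mul_of_integrable
      (int (fderiv_fderiv_smooth ha v) hb (hac.fderiv_apply (𝕜 := ℝ) v))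
      (int ha (fderiv_fderiv_smooth hb v) hac) (int ha hb hac)
      (fun x _ => ha.differentiable (by simp) x) (fun x _ => hb.differentiable (by simp) x)
  simp only [laplacian_eq_sum_fderiv hf, laplacian_eq_sum_fderiv hg, Finset.mul_sum,
    Finset.sum_mul]
  have sf (v : EuclideanSpace ℝ (Fin n)) := fderiv_fderiv_smooth hf v
  have sg (v : EuclideanSpace ℝ (Fin n)) := fderiv_fderiv_smooth hg v
  have cf (v : EuclideanSpace ℝ (Fin n)) := hfc.fderiv_apply (𝕜 := ℝ) v
  rw [integral_finsetSum _ fun i _ => int hf (fderiv_fderiv_smooth (sg _) _) hfc,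
    integral_finsetSum _ fun i _ => int (fderiv_fderiv_smooth (sf _) _) hg
      ((cf _).fderiv_apply (𝕜 := ℝ) _)]
  refine Finset.sum_congr rfl fun i _ => ?_
  rw [ibp hf (sg _) hfc, ibp (sf _) hg (cf _), neg_neg]


theorem isClosed_isWeakLaplacian : IsClosed {x : L2Sum D | IsWeakLaplacian x.fst x.snd} := by
  have cont {h : EuclideanSpace ℝ (Fin n) → ℂ} (hh : MemLp h 2 (volOn D)) :
      Continuous fun f : L2 D => ∫ x, f x * h x ∂(volOn D) := by
    have e : (fun f : L2 D => ∫ x, f x * h x ∂(volOn D)) = fun f =>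
        (ContinuousLinearMap.mul ℂ ℂ).lpPairing (volOn D) 2 2 f hh.toLp := by
      ext f
      rw [ContinuousLinearMap.lpPairing_eq_integral]
      refine integral_congr_ae ?_
      filter_upwards [hh.coeFn_toLp] with x hx
      simp [hx]
    rw [e]
    fun_prop
  simp only [IsWeakLaplacian, Set.ofPred_forall]
  exact isClosed_iInter fun φ => isClosed_eq
    ((cont (memLp_laplacian_test φ)).comp (WithLp.fstL 2 ℂ (L2 D) (L2 D)).continuous)
    ((cont (memLp_test φ)).comp (WithLp.sndL 2 ℂ (L2 D) (L2 D)).continuous)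

/-- In an element `(u, w)` of `H²₀(D)`, the function `w` is the distributional Laplacian of `u`. -/
theorem isWeakLaplacian_of_mem_H20 {x : L2Sum D} (hx : x ∈ H20 D) :
    IsWeakLaplacian x.fst x.snd := by
  refine closure_minimal (s := (testGraph D : Set (L2Sum D))) ?_ isClosed_isWeakLaplacian hx
  rintro x ⟨ψ, h1, h2⟩ φ
  have ext0 {a b : EuclideanSpace ℝ (Fin n) → ℂ} (hb : tsupport b ⊆ D) :
      ∫ x, a x * b x ∂(volOn D) = ∫ x, a x * b x :=
    setIntegral_eq_integral_of_forall_compl_eq_zero fun z hz => by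
      rw [image_eq_zero_of_notMem_tsupport fun h => hz (hb h), mul_zero]
  have ext1 {a b : EuclideanSpace ℝ (Fin n) → ℂ} (ha : tsupport a ⊆ D) :
      ∫ x, a x * b x ∂(volOn D) = ∫ x, a x * b x := by
    simpa only [mul_comm] using ext0 (a := b) ha
  calc ∫ z, x.fst z * Δ (⇑φ) z ∂(volOn D) = ∫ z, ψ z * Δ (⇑φ) z ∂(volOn D) :=
        integral_congr_ae (by filter_upwards [h1] with z hz; rw [hz])
    _ = ∫ z, ψ z * Δ (⇑φ) z := ext1 ψ.tsupport_subset
    _ = ∫ z, Δ (⇑ψ) z * φ z := integral_mul_laplacian ψ.contDiff φ.contDiff ψ.hasCompactSupport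
    _ = ∫ z, Δ (⇑ψ) z * φ z ∂(volOn D) := (ext0 φ.tsupport_subset).symm
    _ = ∫ z, x.snd z * φ z ∂(volOn D) :=
        integral_congr_ae (by filter_upwards [h2] with z hz; rw [hz])

variable (D) in
/-- The Laplacian `Δ₀₀` with domain `H²₀(D)`. -/
def laplacian00 : L2 D →ₗ.[ℂ] L2 D :=
  ((H20 D).map (WithLp.linearEquiv 2 ℂ (L2 D × L2 D)).toLinearMap).toLinearPMap

theorem mem_graph_laplacian00 {u w : L2 D} :
    (u, w) ∈ (laplacian00 D).graph ↔ WithLp.toLp 2 (u, w) ∈ H20 D := by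
  rw [laplacian00, Submodule.toLinearPMap_graph_eq]
  · constructor
    · rintro ⟨x, hx, h⟩
      have : x = WithLp.toLp 2 (u, w) := by rw [← h]; rfl
      exact this ▸ hx
    · exact fun h => ⟨_, h, rfl⟩
  · rintro _ ⟨x, hx, rfl⟩ h0
    exact weakLaplacianGraph_single (x.fst, x.snd) (isWeakLaplacian_of_mem_H20 hx) h0

/-- The unbounded operator `B = [[Δ₀₀, m], [0, Δ]]` on `L²(D) ⊕ L²(D)` with domain
`H²₀(D) ⊕ {v ∈ L²(D) : Δ v ∈ L²(D)}`; here `m • v` is the pointwise product. -/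
def transmissionOp (m : LInf D) : L2Sum D →ₗ.[ℂ] L2Sum D where
  domain :=
    ((laplacian00 D).domain.prod (laplacianMax D).domain).comap
      (WithLp.linearEquiv 2 ℂ (L2 D × L2 D)).toLinearMap
  toFun :=
    { toFun := fun x => WithLp.toLp 2
        (laplacian00 D ⟨x.1.fst, x.2.1⟩ + (m • x.1.snd : L2 D), laplacianMax D ⟨x.1.snd, x.2.2⟩)
      map_add' := by
        intro x y
        have h1 : laplacian00 D ⟨(x + y).1.fst, (x + y).2.1⟩ =
            laplacian00 D ⟨x.1.fst, x.2.1⟩ + laplacian00 D ⟨y.1.fst, y.2.1⟩ :=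
          (laplacian00 D).map_add ⟨x.1.fst, x.2.1⟩ ⟨y.1.fst, y.2.1⟩
        have h2 : laplacianMax D ⟨(x + y).1.snd, (x + y).2.2⟩ =
            laplacianMax D ⟨x.1.snd, x.2.2⟩ + laplacianMax D ⟨y.1.snd, y.2.2⟩ :=
          (laplacianMax D).map_add ⟨x.1.snd, x.2.2⟩ ⟨y.1.snd, y.2.2⟩
        have h3 : (m • (x + y).1.snd : L2 D) = (m • x.1.snd : L2 D) + (m • y.1.snd : L2 D) :=
          Lp.add_smul m x.1.snd y.1.snd
        rw [h1, h2, h3, add_add_add_comm]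
        rfl
      map_smul' := by
        intro c x
        have h1 : laplacian00 D ⟨(c • x).1.fst, (c • x).2.1⟩ =
            c • laplacian00 D ⟨x.1.fst, x.2.1⟩ := (laplacian00 D).map_smul c ⟨x.1.fst, x.2.1⟩
        have h2 : laplacianMax D ⟨(c • x).1.snd, (c • x).2.2⟩ =
            c • laplacianMax D ⟨x.1.snd, x.2.2⟩ := (laplacianMax D).map_smul c ⟨x.1.snd, x.2.2⟩
        have h3 : (m • (c • x).1.snd : L2 D) = c • (m • x.1.snd : L2 D) :=
          (Lp.smul_comm c m x.1.snd).symm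
        rw [h1, h2, h3, ← smul_add]
        rfl }

/-- `B (u, v) = (f, g)` means `u ∈ H²₀(D)`, `Δ u + m v = f` and `Δ v = g`. -/
theorem mem_graph_transmissionOp {m : LInf D} {u v f g : L2 D} :
    (WithLp.toLp 2 (u, v), WithLp.toLp 2 (f, g)) ∈ (transmissionOp m).graph ↔
      WithLp.toLp 2 (u, f - (m • v : L2 D)) ∈ H20 D ∧ IsWeakLaplacian v g := by
  rw [← mem_graph_laplacian00, ← mem_graph_laplacianMax]
  simp only [LinearPMap.mem_graph_iff]
  constructor
  · rintro ⟨x, hx, h⟩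
    have h1 : laplacian00 D ⟨x.1.fst, x.2.1⟩ + (m • x.1.snd : L2 D) = f :=
      congrArg WithLp.fst h
    have h2 : laplacianMax D ⟨x.1.snd, x.2.2⟩ = g := congrArg WithLp.snd h
    have e1 : x.1.fst = u := congrArg WithLp.fst hx
    have e2 : x.1.snd = v := congrArg WithLp.snd hx
    exact ⟨⟨⟨x.1.fst, x.2.1⟩, e1, by rw [← h1, e2, add_sub_cancel_right]⟩, ⟨x.1.snd, x.2.2⟩, e2, h2⟩
  · rintro ⟨⟨y, rfl, hy⟩, z, rfl, hz⟩
    refine ⟨⟨WithLp.toLp 2 (y.1, z.1), y.2, z.2⟩, rfl, ?_⟩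
    change WithLp.toLp 2 (laplacian00 D y + (m • (z : L2 D) : L2 D), laplacianMax D z) = _
    rw [hy, hz, sub_add_cancel]

variable (D) in
/-- The Hilbert space `H²₀(D) ⊕ L²(D)`. -/
abbrev H20Sum : Type := WithLp 2 (H20 D × L2 D)

variable (D) in
/-- The inclusion `H²₀(D) ⊕ L²(D) → L²(D) ⊕ L²(D)`, `(u, v) ↦ (u, v)`. -/
def incl : H20Sum D →L[ℂ] L2Sum D :=
  (WithLp.prodContinuousLinearEquiv 2 ℂ (L2 D) (L2 D)).symm.toContinuousLinearMap ∘L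
    (((WithLp.fstL 2 ℂ (L2 D) (L2 D)) ∘L (H20 D).subtypeL).prodMap
      (ContinuousLinearMap.id ℂ (L2 D))) ∘L
    (WithLp.prodContinuousLinearEquiv 2 ℂ (H20 D) (L2 D)).toContinuousLinearMap

theorem incl_apply (x : H20Sum D) : incl D x = WithLp.toLp 2 ((x.fst : L2Sum D).fst, x.snd) := rfl

end Transmission
end

/-! Everything follows from one real point `l` at which `R = (B - l)⁻¹` exists and has compact
square; the rest is Riesz theory and bounded perturbation theory.

A priori estimate. Let `Δ₀₀ u + m v - l u = f` and `Δ v - l v = g` with `l` large. Since `Δ₀₀` and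
the distributional Laplacian are adjoint to each other, pairing the first equation with `v` removes
all derivatives and leaves `⟪m v, v⟫ = ⟪f, v⟫ - ⟪u, g⟫`. Near the boundary the sign condition turns
the left side into a bound for `‖v‖²`. In the interior `m` has no sign, but there the equation `(Δ -
l) v = g` alone forces `v` to be of size `l^{-1/2} (‖v‖ + ‖g‖)` (`exists_norm_mulOp_testLInf_le`),
which is absorbed. This bounds `v`, and `-Δ₀₀ ≥ 0` then bounds `u` (`exists_norm_le_of_mem_graph`).
After swapping components the adjoint problem is the one for the conjugate of `m`, with `-θ` for
`θ`; the same estimate makes the range dense, so `l` is in the resolvent set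
(`exists_isResolventAt`).

Compactness. No boundary condition is imposed on `v`, so `R` itself need not be compact. Its first
row maps into `H²₀(D)` and is compact by Rellich's theorem (`isCompactOperator_inclH20`); its lower
right entry is compact by duality with the conjugate problem. The lower left entry is merely
bounded, but it never meets itself in `R²` (`isCompactOperator_resolvent_sq`).

Spectral theory. `(B - z) R = 1 - (z - l) R`, and `(1 - w R) (1 + w R) = 1 - w² R²` passes the
Fitting decomposition from compact perturbations of the identity to `1 - w R`
(`HasFittingPow.of_mul`). Hence the spectrum is discrete and the generalized eigenspaces are finite
dimensional, with invariant closed complements (`exists_isSpectralComplement`). The circle integral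
of the resolvent vanishes on the complement by Cauchy's theorem and is computed on generalized
eigenvectors by residues; `(B - z)⁻¹` has residue minus the projection, whence the clockwise
orientation. Replacing `m` by `p` adds a bounded operator of norm at most `‖p - m‖`, so the
projections move continuously, and projections at distance less than one have the same rank. -/

noncomputable section

/-! ### Fitting decompositions -/

namespace Module.End

variable {V : Type*} [AddCommGroup V] [Module ℂ V]

/-- Complementarity enters as two facts: `A² x = 0` forces `A x = 0`, and each vector is `a + A y`
with `A a = 0`. Commutation allows them to be used for one factor after the other. This lets
spectral subspaces be built one eigenvalue at a time. -/
theorem isCompl_ker_range_mul {A B : Module.End ℂ V} (h : Commute A B)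
    (hA : IsCompl (LinearMap.ker A) (LinearMap.range A))
    (hB : IsCompl (LinearMap.ker B) (LinearMap.range B)) :
    IsCompl (LinearMap.ker (A * B)) (LinearMap.range (A * B)) ∧
      LinearMap.ker (A * B) = LinearMap.ker A ⊔ LinearMap.ker B := by
  have hc : ∀ x, A (B x) = B (A x) := fun x => LinearMap.congr_fun h.eq x
  have dA : ∀ x, A (A x) = 0 → A x = 0 := fun x hx =>
    (Submodule.disjoint_def.1 hA.disjoint) _ hx ⟨x, rfl⟩
  have dB : ∀ x, B (B x) = 0 → B x = 0 := fun x hx =>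
    (Submodule.disjoint_def.1 hB.disjoint) _ hx ⟨x, rfl⟩
  have sA : ∀ x, ∃ a y, A a = 0 ∧ x = a + A y := fun x => by
    obtain ⟨a, ha, _, ⟨y, rfl⟩, e⟩ := Submodule.mem_sup.1
      (hA.codisjoint.eq_top ▸ Submodule.mem_top (x := x))
    exact ⟨a, y, ha, e.symm⟩
  have sB : ∀ x, ∃ a y, B a = 0 ∧ x = a + B y := fun x => by
    obtain ⟨a, ha, _, ⟨y, rfl⟩, e⟩ := Submodule.mem_sup.1
      (hB.codisjoint.eq_top ▸ Submodule.mem_top (x := x))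
    exact ⟨a, y, ha, e.symm⟩
  have hk : LinearMap.ker (A * B) = LinearMap.ker A ⊔ LinearMap.ker B := by
    apply le_antisymm
    · intro x hx
      obtain ⟨a, y, ha, rfl⟩ := sA x
      refine Submodule.add_mem_sup ha ?_
      rw [LinearMap.mem_ker] at hx ⊢
      change A (B (a + A y)) = 0 at hx
      rw [map_add, map_add, hc a, ha, map_zero, zero_add, ← hc] at hx
      rw [← hc]
      exact dA _ hx
    · refine sup_le (fun x hx => ?_) fun x hx => ?_
      · change A (B x) = 0
        rw [hc, LinearMap.mem_ker.1 hx, map_zero]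
      · change A (B x) = 0
        rw [LinearMap.mem_ker.1 hx, map_zero]
  refine ⟨⟨Submodule.disjoint_def.2 ?_, codisjoint_iff.2 (eq_top_iff.2 fun x _ => ?_)⟩, hk⟩
  · rintro _ hy ⟨x, rfl⟩
    change A (B (A (B x))) = 0 at hy
    change A (B x) = 0
    rw [← hc] at hy
    have h1 := dA _ hy
    rw [hc (B x), hc x] at h1
    rw [hc]
    exact dB _ h1
  · rw [hk]
    obtain ⟨a, y, ha, rfl⟩ := sA x
    obtain ⟨b, w, hb, rfl⟩ := sB y
    rw [map_add, ← add_assoc]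
    refine Submodule.add_mem_sup (Submodule.add_mem_sup ha ?_) ⟨w, rfl⟩
    rw [LinearMap.mem_ker, ← hc, hb, map_zero]

theorem ker_pow_eq_of_eq_succ {T : Module.End ℂ V} {k : ℕ}
    (h : LinearMap.ker (T ^ (k + 1)) = LinearMap.ker (T ^ k)) (j : ℕ) :
    LinearMap.ker (T ^ (k + j)) = LinearMap.ker (T ^ k) := by
  induction j with
  | zero => rfl
  | succ j ih =>
    refine le_antisymm (fun x hx => ?_) fun x hx => ?_
    · rw [LinearMap.mem_ker, ← add_assoc, pow_succ] at hx
      have h1 : T x ∈ LinearMap.ker (T ^ (k + j)) := hx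
      rw [ih, LinearMap.mem_ker] at h1
      rw [← h, LinearMap.mem_ker, pow_succ]
      exact h1
    · rw [LinearMap.mem_ker, add_comm, pow_add, Module.End.mul_apply, LinearMap.mem_ker.1 hx,
        map_zero]

theorem disjoint_ker_range_pow {T : Module.End ℂ V} {k : ℕ}
    (h : LinearMap.ker (T ^ (k + 1)) = LinearMap.ker (T ^ k)) :
    Disjoint (LinearMap.ker (T ^ k)) (LinearMap.range (T ^ k)) := by
  rw [Submodule.disjoint_def]
  rintro _ hx ⟨y, rfl⟩
  have : y ∈ LinearMap.ker (T ^ (k + k)) := by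
    rw [LinearMap.mem_ker, pow_add]; exact hx
  rwa [ker_pow_eq_of_eq_succ h] at this

theorem ker_pow_mono (T : Module.End ℂ V) : Monotone fun k => LinearMap.ker (T ^ k) := by
  intro i j hij x hx
  obtain ⟨d, rfl⟩ := Nat.exists_eq_add_of_le hij
  rw [LinearMap.mem_ker, add_comm, pow_add, Module.End.mul_apply, LinearMap.mem_ker.1 hx, map_zero]

theorem range_pow_anti (T : Module.End ℂ V) {i j : ℕ} (hij : i ≤ j) :
    LinearMap.range (T ^ j) ≤ LinearMap.range (T ^ i) := by
  obtain ⟨d, rfl⟩ := Nat.exists_eq_add_of_le hij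
  rintro _ ⟨x, rfl⟩
  exact ⟨(T ^ d) x, by rw [pow_add]; rfl⟩

/-- A power of `T` splits the space into kernel and range, the kernel being finite dimensional. -/
def HasFittingPow (T : Module.End ℂ V) : Prop :=
  ∃ k : ℕ, 0 < k ∧ FiniteDimensional ℂ (LinearMap.ker (T ^ k)) ∧
    LinearMap.ker (T ^ (k + 1)) = LinearMap.ker (T ^ k) ∧
    IsCompl (LinearMap.ker (T ^ k)) (LinearMap.range (T ^ k))

/-- If a product of commuting operators has a Fitting decomposition, then so have the factors. -/
theorem HasFittingPow.of_mul {A B : Module.End ℂ V} (h : Commute A B)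
    (hS : HasFittingPow (A * B)) : HasFittingPow A := by
  obtain ⟨k, hk, hfd, hst, hcompl⟩ := hS
  set S := A * B with hSdef
  have hAS : Commute A S := (Commute.refl A).mul_right h
  -- The kernels of all powers of `A` lie in the single finite dimensional space `ker (S ^ k)`,
  -- because `ker (A ^ j) ≤ ker (S ^ (k + j))` and the latter kernels are stationary. The finite
  -- dimensional Fitting lemma for the restriction of `A` to that space therefore supplies the
  -- exponent `j`.
  have hkerle : ∀ j, LinearMap.ker (A ^ j) ≤ LinearMap.ker (S ^ k) := by
    intro j x hx
    have h1 : x ∈ LinearMap.ker (S ^ (k + j)) := by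
      rw [LinearMap.mem_ker, pow_add, h.mul_pow j, (h.pow_pow j j).eq, Module.End.mul_apply,
        Module.End.mul_apply, LinearMap.mem_ker.1 hx, map_zero, map_zero]
    rwa [ker_pow_eq_of_eq_succ hst] at h1
  have hmaps : Set.MapsTo A (LinearMap.ker (S ^ k)) (LinearMap.ker (S ^ k)) := by
    intro x hx
    have e := LinearMap.congr_fun (hAS.pow_right k).eq x
    change A ((S ^ k) x) = (S ^ k) (A x) at e
    change (S ^ k) (A x) = 0
    rw [← e, LinearMap.mem_ker.1 hx, map_zero]
  set A' : Module.End ℂ (LinearMap.ker (S ^ k)) := A.restrict hmaps with hA'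
  have hpow : ∀ j (x : LinearMap.ker (S ^ k)), (((A' ^ j) x : LinearMap.ker (S ^ k)) : V) =
      (A ^ j) x := by
    intro j
    induction j with
    | zero => intro x; rfl
    | succ j ih =>
      intro x
      rw [pow_succ, pow_succ, Module.End.mul_apply, Module.End.mul_apply, ih]
      rfl
  obtain ⟨j, hj, hj1⟩ := (A'.eventually_isCompl_ker_pow_range_pow.and
    (eventually_ge_atTop 1)).exists
  have hstA : LinearMap.ker (A ^ (j + 1)) = LinearMap.ker (A ^ j) := by
    refine le_antisymm (fun x hx => ?_) (ker_pow_mono A (Nat.le_succ j))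
    let x' : LinearMap.ker (S ^ k) := ⟨x, hkerle _ hx⟩
    have h0 : (A' ^ j) x' ∈ LinearMap.ker (A' ^ j) := by
      rw [LinearMap.mem_ker]
      apply Subtype.ext
      have hx2 := ker_pow_mono A (show j + 1 ≤ j + j by omega) hx
      rw [hpow, hpow]
      change (A ^ (j + j)) x = 0 at hx2
      rw [pow_add] at hx2
      exact hx2
    have h1 : (A' ^ j) x' = 0 := (Submodule.disjoint_def.1 hj.disjoint) _ h0 ⟨x', rfl⟩
    have h2 := hpow j x'
    rw [h1] at h2
    exact h2.symm
  refine ⟨j, hj1, Submodule.finiteDimensional_of_le (hkerle j), hstA,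
    disjoint_ker_range_pow hstA, codisjoint_iff.2 (eq_top_iff.2 fun x _ => ?_)⟩
  -- The component in `ker (S ^ k)` is split once more by the Fitting lemma for `A'`; the component
  -- in `range (S ^ k)` lies in the range of every power of `S`, hence in `range (A ^ j)`.
  obtain ⟨a, ha, y, hy, rfl⟩ := Submodule.mem_sup.1
    (hcompl.codisjoint.eq_top ▸ Submodule.mem_top (x := x))
  refine Submodule.add_mem _ ?_ ?_
  · obtain ⟨b, hb, _, ⟨c, rfl⟩, e⟩ := Submodule.mem_sup.1
      (hj.codisjoint.eq_top ▸ Submodule.mem_top (x := (⟨a, ha⟩ : LinearMap.ker (S ^ k))))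
    have e' := congrArg Subtype.val e
    change (b : V) + ((A' ^ j) c : LinearMap.ker (S ^ k)) = a at e'
    rw [hpow] at e'
    rw [← e']
    refine Submodule.add_mem_sup ?_ ⟨_, rfl⟩
    rw [LinearMap.mem_ker, ← hpow, LinearMap.mem_ker.1 hb]
    rfl
  · refine Submodule.mem_sup_right ?_
    have hrange : ∀ i, LinearMap.range (S ^ k) ≤ LinearMap.range (S ^ (k * (i + 1))) := by
      intro i
      induction i with
      | zero => simp
      | succ i ih =>
        rintro _ ⟨x, rfl⟩
        obtain ⟨p, hp, _, ⟨q, rfl⟩, e⟩ := Submodule.mem_sup.1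
          (hcompl.codisjoint.eq_top ▸ Submodule.mem_top (x := x))
        obtain ⟨w, hw⟩ := ih ⟨q, rfl⟩
        refine ⟨w, ?_⟩
        rw [← e, map_add, LinearMap.mem_ker.1 hp, zero_add, ← hw, ← Module.End.mul_apply, ← pow_add]
        congr 2
        ring
    obtain ⟨w, rfl⟩ := range_pow_anti S (show j ≤ k * (j + 1) by nlinarith) (hrange j hy)
    exact ⟨(B ^ j) w, by rw [h.mul_pow]; rfl⟩

end Module.End

/-! ### Riesz theory of compact operators -/

namespace IsCompactOperator

variable {X : Type*} [NormedAddCommGroup X] [NormedSpace ℂ X]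

/-- `(μ - K) ^ k` is a compact perturbation of `μ ^ k`. -/
theorem exists_sub_pow {K : X →L[ℂ] X} (hK : IsCompactOperator K) (μ : ℂ) (k : ℕ) :
    ∃ K' : X →L[ℂ] X, IsCompactOperator K' ∧ (μ • 1 - K) ^ k = μ ^ k • 1 - K' := by
  induction k with
  | zero => exact ⟨0, isCompactOperator_zero, by simp⟩
  | succ k ih =>
    obtain ⟨K', hK', e⟩ := ih
    refine ⟨μ • K' + (μ ^ k • K - K' * K), ?_, ?_⟩
    · exact (hK'.smul μ).add ((hK.smul (μ ^ k)).sub (hK'.comp_clm K))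
    · rw [pow_succ, e]
      ext x
      simp [pow_succ, mul_smul, smul_sub]
      abel

/-- On the kernel the identity equals `μ⁻¹ • K` and is therefore compact, which happens only in
finite dimension. -/
theorem finiteDimensional_ker_sub {K : X →L[ℂ] X} (hK : IsCompactOperator K) {μ : ℂ}
    (hμ : μ ≠ 0) : FiniteDimensional ℂ (LinearMap.ker ((μ • 1 - K : X →L[ℂ] X) : X →ₗ[ℂ] X)) := by
  set N := LinearMap.ker ((μ • 1 - K : X →L[ℂ] X) : X →ₗ[ℂ] X)
  have hKN : ∀ x ∈ N, K x = μ • x := fun x hx => by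
    have : μ • x - K x = 0 := hx
    exact (sub_eq_zero.1 this).symm
  have hNc : IsClosed (N : Set X) := (μ • 1 - K).isClosed_ker
  have h1 : IsCompactOperator ((K : X →ₗ[ℂ] X).restrict
      (p := N) (q := N) fun x hx => by
        change K x ∈ N
        rw [hKN x hx]; exact N.smul_mem _ hx) := IsCompactOperator.restrict hK _ hNc
  refine FiniteDimensional.of_isCompactOperator_id (𝕜 := ℂ) ?_
  have h2 := h1.smul μ⁻¹
  refine (congrArg IsCompactOperator (funext fun x => ?_)).mpr h2
  apply Subtype.ext
  change (x : X) = μ⁻¹ • K x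
  rw [hKN x x.2, smul_smul, inv_mul_cancel₀ hμ, one_smul]

/-- If the kernels increased strictly, Riesz's lemma would give bounded vectors, each in one kernel
and at distance at least one from the preceding kernel. Their images under `K` would be
`‖μ‖`-separated, contradicting compactness. -/
theorem exists_ker_pow_succ_eq {K : X →L[ℂ] X} (hK : IsCompactOperator K) {μ : ℂ}
    (hμ : μ ≠ 0) : ∃ k, 0 < k ∧
      LinearMap.ker (((μ • 1 - K : X →L[ℂ] X) : Module.End ℂ X) ^ (k + 1)) =
      LinearMap.ker (((μ • 1 - K : X →L[ℂ] X) : Module.End ℂ X) ^ k) := by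
  set T : X →L[ℂ] X := μ • 1 - K with hT
  have hpow : ∀ k, ((T : Module.End ℂ X) ^ k) = ((T ^ k : X →L[ℂ] X) : Module.End ℂ X) := by
    intro k; ext x; simp
  by_contra! hne
  have hex : ∀ k : ℕ, ∃ x : X, x ∈ LinearMap.ker ((T : Module.End ℂ X) ^ (k + 2)) ∧
      ‖x‖ ≤ 3 ∧ ∀ y ∈ LinearMap.ker ((T : Module.End ℂ X) ^ (k + 1)), 1 ≤ ‖x - y‖ := by
    intro k
    set N := LinearMap.ker ((T : Module.End ℂ X) ^ (k + 2))
    set F := (LinearMap.ker ((T : Module.End ℂ X) ^ (k + 1))).comap N.subtype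
    have hF : IsClosed (F : Set N) := by
      have : IsClosed ((LinearMap.ker ((T : Module.End ℂ X) ^ (k + 1)) : Submodule ℂ X) :
          Set X) := by
        rw [hpow]; exact (T ^ (k + 1)).isClosed_ker
      exact this.preimage continuous_subtype_val
    have hFx : ∃ x : N, x ∉ F := by
      by_contra! hall
      exact hne (k + 1) (Nat.succ_pos k) (le_antisymm (fun x hx => hall ⟨x, hx⟩)
        (Module.End.ker_pow_mono _ (Nat.le_succ _)))
    -- Any bound above `‖c‖ = 2` serves as the radius; only boundedness of the sequence matters. The
    -- exponents start at `k + 1` because strict growth is assumed for positive exponents only.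
    obtain ⟨x, hx, hxy⟩ := riesz_lemma_of_norm_lt (c := (2 : ℂ)) (R := 3) (by simp)
      (by norm_num) hF hFx
    exact ⟨x, x.2, hx, fun y hy => hxy ⟨y, Module.End.ker_pow_mono _ (Nat.le_succ _) hy⟩ hy⟩
  choose f hfk hfn hfd using hex
  have hsep : ∀ i j, i < j → ‖μ‖ ≤ ‖K (f j) - K (f i)‖ := by
    intro i j hij
    have hTmem : ∀ (a b : ℕ) (x : X), b ≤ a + 1 → x ∈ LinearMap.ker ((T : Module.End ℂ X) ^ b) →
        T x ∈ LinearMap.ker ((T : Module.End ℂ X) ^ a) := by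
      intro a b x hab hx
      have := Module.End.ker_pow_mono _ hab hx
      rw [LinearMap.mem_ker, pow_succ] at this
      exact this
    -- `u` is chosen so that `K (f j) - K (f i) = μ • (f j - u)`. It lies in the kernel preceding
    -- that of `f j`, because `T` lowers the exponent by one.
    set u : X := μ⁻¹ • (T (f j) - T (f i) + μ • f i) with hu
    have hmem : u ∈ LinearMap.ker ((T : Module.End ℂ X) ^ (j + 1)) := by
      refine Submodule.smul_mem _ _ (Submodule.add_mem _ (Submodule.sub_mem _ ?_ ?_)
        (Submodule.smul_mem _ _ ?_))
      · exact hTmem _ _ _ le_rfl (hfk j)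
      · exact hTmem _ _ _ (by omega) (hfk i)
      · exact Module.End.ker_pow_mono _ (by omega) (hfk i)
    have e : μ • (f j - u) = K (f j) - K (f i) := by
      rw [smul_sub, hu, smul_smul, mul_inv_cancel₀ hμ, one_smul]
      simp [hT]
      abel
    rw [← e, norm_smul]
    exact le_mul_of_one_le_right (norm_nonneg _) (hfd j u hmem)
  obtain ⟨C, hC, hKC⟩ := hK.image_closedBall_subset_compact 3
  obtain ⟨y, -, φ, hφ, hlim⟩ := hC.tendsto_subseq
    (fun k => hKC ⟨f k, by simpa using hfn k, rfl⟩)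
  obtain ⟨N, hN⟩ := Metric.cauchySeq_iff'.1 hlim.cauchySeq ‖μ‖ (by positivity)
  have h1 := hN (N + 1) (by omega)
  rw [dist_eq_norm] at h1
  exact absurd h1 (not_lt.2 (hsep _ _ (hφ (Nat.lt_succ_self N))))

/-- The operator induced by a compact operator on a quotient space is compact. -/
theorem of_comp_mkQ {Y : Type*} [NormedAddCommGroup Y] [NormedSpace ℂ Y] (N : Submodule ℂ X)
    {L : X ⧸ N → Y} (h : IsCompactOperator (L ∘ N.mkQ)) : IsCompactOperator L := by
  obtain ⟨C, hC, hmem⟩ := h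
  refine ⟨C, hC, ?_⟩
  have h1 := N.isOpenMap_mkQ.image_mem_nhds hmem
  rw [map_zero] at h1
  refine mem_of_superset h1 ?_
  rintro _ ⟨x, hx, rfl⟩
  exact hx

variable [CompleteSpace X]

/-- Once the kernels are stationary at `N = ker (T ^ k)`, the compact operator induced by `K` on `X
⧸ N` does not have the eigenvalue `μ`. By the Fredholm alternative `T` is then onto modulo `N`,
hence so is `T ^ k`, which says `N + range (T ^ k) = X`. -/
theorem hasFittingPow {K : X →L[ℂ] X} (hK : IsCompactOperator K) {μ : ℂ} (hμ : μ ≠ 0) :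
    Module.End.HasFittingPow ((μ • 1 - K : X →L[ℂ] X) : Module.End ℂ X) := by
  obtain ⟨k, hk0, hk⟩ := exists_ker_pow_succ_eq hK hμ
  set T : X →L[ℂ] X := μ • 1 - K with hT
  have hpow : ∀ k, ((T : Module.End ℂ X) ^ k) = ((T ^ k : X →L[ℂ] X) : Module.End ℂ X) := by
    intro k; ext x; simp
  refine ⟨k, hk0, ?_, hk, Module.End.disjoint_ker_range_pow hk, ?_⟩
  · obtain ⟨K', hK', e⟩ := exists_sub_pow hK μ k
    rw [hpow, hT, e]
    exact finiteDimensional_ker_sub hK' (pow_ne_zero _ hμ)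
  set N := LinearMap.ker ((T : Module.End ℂ X) ^ k) with hN
  have hNc : IsClosed (N : Set X) := by
    rw [hN, hpow]; exact (T ^ k).isClosed_ker
  have hcomm : ∀ x, (T ^ k) (K x) = K ((T ^ k) x) := by
    intro x
    have : Commute (T ^ k) K :=
      (((Commute.one_left K).smul_left μ).sub_left (Commute.refl K)).pow_left k
    exact congrArg (fun f : X →L[ℂ] X => f x) this.eq
  have hKN : N ≤ N.comap (K : X →ₗ[ℂ] X) := by
    intro x hx
    rw [hN, hpow] at hx ⊢
    change (T ^ k) (K x) = 0
    rw [hcomm, show (T ^ k) x = 0 from hx, map_zero]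
  have : IsClosed (N : Set X) := hNc
  let K' : (X ⧸ N) →L[ℂ] (X ⧸ N) := ⟨N.mapQ N (K : X →ₗ[ℂ] X) hKN, by
    refine N.isOpenQuotientMap_mkQ.isQuotientMap.continuous_iff.2 ?_
    exact (N.isOpenQuotientMap_mkQ.continuous).comp K.continuous⟩
  have hK' : IsCompactOperator K' := by
    refine of_comp_mkQ N ?_
    exact hK.continuous_comp (g := N.mkQ) N.isOpenQuotientMap_mkQ.continuous
  have hK'mk : ∀ x, K' (N.mkQ x) = N.mkQ (K x) := fun x => rfl
  have hres : μ ∈ resolventSet ℂ K' := by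
    refine (hK'.hasEigenvalue_or_mem_resolventSet hμ).resolve_left fun hev => ?_
    obtain ⟨y, hy⟩ := hev.exists_hasEigenvector
    obtain ⟨x, rfl⟩ := N.mkQ_surjective y
    have h1 : N.mkQ (K x) = μ • N.mkQ x := hy.apply_eq_smul
    have h2 : T x ∈ N := by
      rw [← Submodule.Quotient.mk_eq_zero, ← Submodule.mkQ_apply]
      simp only [hT, sub_apply, smul_apply,
        one_apply_eq_self, map_sub, map_smul, h1, sub_self]
    have h3 : x ∈ N := by
      rw [← hk, LinearMap.mem_ker, pow_succ]
      exact h2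
    exact hy.2 (by rw [Submodule.mkQ_apply, Submodule.Quotient.mk_eq_zero]; exact h3)
  have hsurj : ∀ x, ∃ y, x - T y ∈ N := by
    intro x
    rw [spectrum.mem_resolventSet_iff, ContinuousLinearMap.isUnit_iff_bijective] at hres
    obtain ⟨y, hy⟩ := hres.2 (N.mkQ x)
    obtain ⟨y, rfl⟩ := N.mkQ_surjective y
    refine ⟨y, ?_⟩
    rw [← Submodule.Quotient.mk_eq_zero, ← Submodule.mkQ_apply, map_sub, ← hy, sub_eq_zero]
    simp [hT, Algebra.algebraMap_eq_smul_one]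
    rfl
  have hsurj' : ∀ j x, ∃ y, x - ((T : Module.End ℂ X) ^ j) y ∈ N := by
    intro j
    induction j with
    | zero => exact fun x => ⟨x, by simp⟩
    | succ j ih =>
      intro x
      obtain ⟨y, hy⟩ := hsurj x
      obtain ⟨w, hw⟩ := ih y
      refine ⟨w, ?_⟩
      have h1 : T (y - ((T : Module.End ℂ X) ^ j) w) ∈ N := by
        rw [hN, hpow] at hw ⊢
        change (T ^ k) (T _) = 0
        rw [← mul_apply_eq_comp, ← pow_succ, pow_succ', mul_apply_eq_comp,
          show (T ^ k) _ = 0 from hw, map_zero]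
      have h2 := N.add_mem hy h1
      rw [map_sub, sub_add_sub_cancel] at h2
      rw [pow_succ']
      exact h2
  refine codisjoint_iff.2 (eq_top_iff.2 fun x _ => ?_)
  obtain ⟨y, hy⟩ := hsurj' k x
  exact Submodule.mem_sup.2 ⟨_, hy, _, ⟨y, rfl⟩, sub_add_cancel _ _⟩

/-- Fitting decomposition for an operator with compact square. -/
theorem hasFittingPow_of_sq {R : X →L[ℂ] X} (hR : IsCompactOperator (R * R)) {w : ℂ} :
    Module.End.HasFittingPow ((1 - w • R : X →L[ℂ] X) : Module.End ℂ X) := by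
  have h1 : IsCompactOperator (w ^ 2 • (R * R)) := hR.smul (w ^ 2)
  have h2 := hasFittingPow h1 one_ne_zero
  -- `(1 - w R) (1 + w R) = 1 - w² R²`, and the right side is a compact perturbation of the
  -- identity.
  refine Module.End.HasFittingPow.of_mul (B := ((1 + w • R : X →L[ℂ] X) : Module.End ℂ X)) ?_ ?_
  · ext x
    simp
    module
  · convert h2 using 1
    ext x
    simp
    module

end IsCompactOperator

/-! ### Operators with a resolvent whose square is compact -/

namespace UnboundedOperator

variable {X : Type*} [NormedAddCommGroup X] [NormedSpace ℂ X]
variable {A : X →ₗ.[ℂ] X} {z₀ : ℂ} {R₀ : X →L[ℂ] X}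

/-- With `R₀ = (A - z₀)⁻¹`, this is `(A - z) (A - z₀)⁻¹ = 1 - (z - z₀) R₀`. -/
def pencil (z₀ : ℂ) (R₀ : X →L[ℂ] X) (z : ℂ) : X →L[ℂ] X := 1 - (z - z₀) • R₀

theorem pencil_apply (z₀ : ℂ) (R₀ : X →L[ℂ] X) (z : ℂ) (x : X) :
    pencil z₀ R₀ z x = x - (z - z₀) • R₀ x := by simp [pencil]

theorem continuous_pencil (z₀ : ℂ) (R₀ : X →L[ℂ] X) : Continuous (pencil z₀ R₀) := by
  unfold pencil; fun_prop

theorem differentiable_pencil (z₀ : ℂ) (R₀ : X →L[ℂ] X) :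
    Differentiable ℂ (pencil z₀ R₀) := by
  unfold pencil; fun_prop

theorem commute_pencil (z₀ : ℂ) (R₀ : X →L[ℂ] X) (z : ℂ) : Commute R₀ (pencil z₀ R₀ z) :=
  (Commute.one_right R₀).sub_right ((Commute.refl R₀).smul_right _)

theorem commute_pencil_pencil (z₀ : ℂ) (R₀ : X →L[ℂ] X) (z w : ℂ) :
    Commute (pencil z₀ R₀ z) (pencil z₀ R₀ w) :=
  (Commute.one_left _).sub_left ((commute_pencil z₀ R₀ w).smul_left _)

namespace IsResolventAt

theorem mem_domain (h₀ : IsResolventAt A z₀ R₀) (y : X) : R₀ y ∈ A.domain := (h₀.1 y).1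

theorem apply_eq (h₀ : IsResolventAt A z₀ R₀) (y : X) (h : R₀ y ∈ A.domain) :
    A ⟨R₀ y, h⟩ = y + z₀ • R₀ y := by
  obtain ⟨_, hy⟩ := h₀.1 y
  exact sub_eq_iff_eq_add.1 hy

theorem injective (h₀ : IsResolventAt A z₀ R₀) {x : X} (hx : R₀ x = 0) : x = 0 := by
  obtain ⟨h, hy⟩ := h₀.1 x
  rw [← hy]
  have e : (⟨R₀ x, h⟩ : A.domain) = 0 := Subtype.ext hx
  rw [e, LinearPMap.map_zero, hx, smul_zero, sub_zero]

theorem exists_eq (h₀ : IsResolventAt A z₀ R₀) {x : X} (hx : x ∈ A.domain) : ∃ q, x = R₀ q :=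
  ⟨_, (h₀.2 ⟨x, hx⟩).symm⟩

/-- `(A - z) R₀ q = (1 - (z - z₀) R₀) q`. -/
theorem sub_apply_eq (h₀ : IsResolventAt A z₀ R₀) (z : ℂ) (q : X) (h : R₀ q ∈ A.domain) :
    A ⟨R₀ q, h⟩ - z • R₀ q = pencil z₀ R₀ z q := by
  rw [h₀.apply_eq, pencil_apply, sub_smul]; abel

theorem mul_inverse (h₀ : IsResolventAt A z₀ R₀) {z : ℂ} {G : X →L[ℂ] X}
    (h1 : pencil z₀ R₀ z * G = 1) (h2 : G * pencil z₀ R₀ z = 1) :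
    IsResolventAt A z (R₀ * G) := by
  refine ⟨fun y => ⟨h₀.mem_domain (G y), ?_⟩, fun x => ?_⟩
  · exact (h₀.sub_apply_eq z (G y) (h₀.mem_domain _)).trans
      (congrArg (fun f : X →L[ℂ] X => f y) h1)
  · obtain ⟨q, hq⟩ := h₀.exists_eq x.2
    have e : x = ⟨R₀ q, hq ▸ x.2⟩ := Subtype.ext hq
    rw [e, h₀.sub_apply_eq]
    change R₀ ((G * pencil z₀ R₀ z) q) = R₀ q
    rw [h2]; rfl

theorem mul_pencil (h₀ : IsResolventAt A z₀ R₀) {z : ℂ} {R : X →L[ℂ] X}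
    (h : IsResolventAt A z R) : R * pencil z₀ R₀ z = R₀ := by
  ext y
  have h1 := h.2 ⟨R₀ y, h₀.mem_domain y⟩
  rw [h₀.sub_apply_eq] at h1
  exact h1

/-- The inverse of `(A - z) (A - z₀)⁻¹` is the pencil with the two points exchanged, `(A - z₀) (A -
z)⁻¹`. -/
theorem isUnit_pencil (h₀ : IsResolventAt A z₀ R₀) {z : ℂ} {R : X →L[ℂ] X}
    (h : IsResolventAt A z R) : IsUnit (pencil z₀ R₀ z) := by
  have h1 := h₀.mul_pencil h
  have h2 := h.mul_pencil h₀
  refine ⟨⟨pencil z₀ R₀ z, pencil z R z₀, ?_, ?_⟩, rfl⟩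
  · have : pencil z₀ R₀ z * pencil z R z₀ = pencil z R z₀ - (z - z₀) • (R₀ * pencil z R z₀) := by
      rw [pencil, sub_mul, one_mul, smul_mul_assoc]
    rw [this, h2, pencil, ← neg_sub z z₀, neg_smul]
    abel
  · have : pencil z R z₀ * pencil z₀ R₀ z = pencil z₀ R₀ z - (z₀ - z) • (R * pencil z₀ R₀ z) := by
      rw [pencil, sub_mul, one_mul, smul_mul_assoc]
    rw [this, h1, pencil, ← neg_sub z z₀, neg_smul]
    abel

end IsResolventAt

theorem isResolventAt_resolvent {z : ℂ} (hz : z ∉ spectrum A) :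
    IsResolventAt A z (resolvent A z) := by
  have h : ∃ R : X →L[ℂ] X, IsResolventAt A z R := not_not.1 hz
  rw [resolvent, dif_pos h]
  exact h.choose_spec

/-- This reduces spectral questions about an unbounded operator to invertibility in a family of
bounded operators that is affine in `z`. -/
theorem notMem_spectrum_iff (h₀ : IsResolventAt A z₀ R₀) {z : ℂ} :
    z ∉ spectrum A ↔ IsUnit (pencil z₀ R₀ z) := by
  constructor
  · intro h
    exact h₀.isUnit_pencil (isResolventAt_resolvent h)
  · intro h
    exact not_not.2 ⟨_, h₀.mul_inverse (Ring.mul_inverse_cancel _ h) (Ring.inverse_mul_cancel _ h)⟩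

theorem resolvent_eq (h₀ : IsResolventAt A z₀ R₀) {z : ℂ} (hz : z ∉ spectrum A) :
    resolvent A z = R₀ * Ring.inverse (pencil z₀ R₀ z) := by
  have h := (notMem_spectrum_iff h₀).1 hz
  exact (isResolventAt_resolvent hz).unique
    (h₀.mul_inverse (Ring.mul_inverse_cancel _ h) (Ring.inverse_mul_cancel _ h))

/-- The pencil is the identity up to an operator with values in the domain. Hence vectors
annihilated by one of its powers automatically lie in the domain of `A`. -/
theorem sub_pow_mem_domain (h₀ : IsResolventAt A z₀ R₀) (z : ℂ) (k : ℕ) (x : X) :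
    (pencil z₀ R₀ z ^ k) x - x ∈ A.domain := by
  induction k with
  | zero => simp
  | succ k ih =>
    have : (pencil z₀ R₀ z ^ (k + 1)) x - x =
        ((pencil z₀ R₀ z ^ k) x - x) - (z - z₀) • R₀ ((pencil z₀ R₀ z ^ k) x) := by
      rw [pow_succ', mul_apply_eq_comp, pencil_apply]
      abel
    rw [this]
    exact A.domain.sub_mem ih (A.domain.smul_mem _ (h₀.mem_domain _))

/-- On the range of `R₀`, applying `A - z` amounts to removing `R₀` and applying the pencil. As `R₀`
is injective and commutes with the pencil, it can be inserted or cancelled at each stage of the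
induction. -/
theorem mem_powKer_iff (h₀ : IsResolventAt A z₀ R₀) {z : ℂ} {k : ℕ} {x : X} :
    x ∈ powKer A z k ↔ (pencil z₀ R₀ z ^ k) x = 0 := by
  induction k generalizing x with
  | zero => simp [powKer]
  | succ k ih =>
    rw [mem_powKer_succ]
    have hR : ∀ q, R₀ ((pencil z₀ R₀ z ^ (k + 1)) q) = (pencil z₀ R₀ z ^ (k + 1)) (R₀ q) :=
      fun q => congrArg (fun f : X →L[ℂ] X => f q) ((commute_pencil z₀ R₀ z).pow_right (k + 1)).eq
    constructor
    · rintro ⟨h, hk⟩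
      rw [ih] at hk
      obtain ⟨q, rfl⟩ := h₀.exists_eq h
      rw [h₀.sub_apply_eq, ← mul_apply_eq_comp, ← pow_succ] at hk
      rw [← hR, hk, map_zero]
    · intro hx
      have hmem := sub_pow_mem_domain h₀ z (k + 1) x
      rw [hx, zero_sub, neg_mem_iff] at hmem
      refine ⟨hmem, ?_⟩
      obtain ⟨q, rfl⟩ := h₀.exists_eq hmem
      rw [ih, h₀.sub_apply_eq, ← mul_apply_eq_comp, ← pow_succ]
      exact h₀.injective ((hR q).trans hx)

theorem powKer_eq_ker (h₀ : IsResolventAt A z₀ R₀) (z : ℂ) (k : ℕ) :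
    powKer A z k = LinearMap.ker ((pencil z₀ R₀ z : Module.End ℂ X) ^ k) := by
  ext x
  have e : ((pencil z₀ R₀ z : Module.End ℂ X) ^ k) =
      ((pencil z₀ R₀ z ^ k : X →L[ℂ] X) : Module.End ℂ X) := by ext y; simp
  rw [mem_powKer_iff h₀, e]
  rfl

theorem eigenspace_eq (h₀ : IsResolventAt A z₀ R₀) (z : ℂ) :
    eigenspace A z = Module.End.eigenspace (R₀ : Module.End ℂ X) (z - z₀)⁻¹ := by
  ext x
  rw [eigenspace, mem_powKer_iff h₀, pow_one, pencil_apply, Module.End.mem_eigenspace_iff]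
  change _ ↔ R₀ x = _
  -- At `z = z₀` the convention `0⁻¹ = 0` gives the kernel of `R₀`, which is trivial, as is the
  -- kernel of the pencil, which is the identity there.
  by_cases hz : z - z₀ = 0
  · rw [hz, zero_smul, sub_zero, inv_zero, zero_smul]
    exact ⟨fun h => by rw [h, map_zero], fun h => h₀.injective h⟩
  · rw [sub_eq_zero, eq_comm, eq_inv_smul_iff₀ hz]

/-- The eigenspaces are linearly independent. -/
theorem iSupIndep_eigenspace (h₀ : IsResolventAt A z₀ R₀) :
    iSupIndep fun z : ℂ => eigenspace A z := by
  have h1 := (Module.End.eigenspaces_iSupIndep (R₀ : Module.End ℂ X)).comp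
    (f := fun z : ℂ => (z - z₀)⁻¹) fun z w h => by simpa using h
  have e : (fun z : ℂ => eigenspace A z) =
      (Module.End.eigenspace (R₀ : Module.End ℂ X)) ∘ fun z : ℂ => (z - z₀)⁻¹ :=
    funext fun z => eigenspace_eq h₀ z
  rw [e]
  exact h1

theorem genEigenspace_eq_bot (h₀ : IsResolventAt A z₀ R₀) {z : ℂ} (hz : z ∉ spectrum A) :
    genEigenspace A z = ⊥ := by
  refine iSup_eq_bot.2 fun k => ?_
  rw [eq_bot_iff]
  intro x hx
  rw [mem_powKer_iff h₀] at hx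
  obtain ⟨u, hu⟩ := ((notMem_spectrum_iff h₀).1 hz).pow k
  rw [← hu] at hx
  have : (((u⁻¹ : (X →L[ℂ] X)ˣ) : X →L[ℂ] X) * (u : X →L[ℂ] X)) x = 0 := by
    rw [mul_apply_eq_comp, hx, map_zero]
  rwa [Units.inv_mul] at this

variable [CompleteSpace X]

theorem isClosed_spectrum (h₀ : IsResolventAt A z₀ R₀) : IsClosed (spectrum A) := by
  rw [← isOpen_compl_iff]
  have : (spectrum A)ᶜ = pencil z₀ R₀ ⁻¹' {f | IsUnit f} := by
    ext z; exact notMem_spectrum_iff h₀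
  rw [this]
  exact Units.isOpen.preimage (continuous_pencil z₀ R₀)

theorem continuousOn_resolvent (h₀ : IsResolventAt A z₀ R₀) :
    ContinuousOn (resolvent A) (spectrum A)ᶜ := by
  have h1 : ContinuousOn (fun z => R₀ * Ring.inverse (pencil z₀ R₀ z)) (spectrum A)ᶜ :=
    continuousOn_const.mul ((differentiable_pencil z₀ R₀).differentiableOn.inverse
      fun z hz => (notMem_spectrum_iff h₀).1 hz).continuousOn
  exact h1.congr fun z hz => resolvent_eq h₀ hz

theorem exists_genEigenspace_eq (h₀ : IsResolventAt A z₀ R₀)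
    (hc : IsCompactOperator (R₀ * R₀)) (z : ℂ) : ∃ k : ℕ, 0 < k ∧
    genEigenspace A z = LinearMap.ker ((pencil z₀ R₀ z : Module.End ℂ X) ^ k) ∧
    FiniteDimensional ℂ (LinearMap.ker ((pencil z₀ R₀ z : Module.End ℂ X) ^ k)) ∧
    IsCompl (LinearMap.ker ((pencil z₀ R₀ z : Module.End ℂ X) ^ k))
      (LinearMap.range ((pencil z₀ R₀ z : Module.End ℂ X) ^ k)) := by
  obtain ⟨k, hk, hfd, hst, hcompl⟩ := hc.hasFittingPow_of_sq (w := z - z₀)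
  refine ⟨k, hk, le_antisymm (iSup_le fun j => ?_) ?_, hfd, hcompl⟩
  · rw [powKer_eq_ker h₀]
    refine (Module.End.ker_pow_mono _ (Nat.le_add_left j k)).trans ?_
    exact (Module.End.ker_pow_eq_of_eq_succ hst j).le
  · rw [← powKer_eq_ker h₀]
    exact le_iSup (powKer A z) k

theorem finiteDimensional_genEigenspace (h₀ : IsResolventAt A z₀ R₀)
    (hc : IsCompactOperator (R₀ * R₀)) (z : ℂ) : FiniteDimensional ℂ (genEigenspace A z) := by
  obtain ⟨k, -, e, hfd, -⟩ := exists_genEigenspace_eq h₀ hc z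
  rw [e]; exact hfd

/-- The Fredholm alternative: if the kernel vanishes, the Fitting complement is everything, so a
positive power of the pencil is onto, and then the pencil itself is. -/
theorem notMem_spectrum_of_injective (h₀ : IsResolventAt A z₀ R₀)
    (hc : IsCompactOperator (R₀ * R₀)) {z : ℂ} (h : ∀ x, pencil z₀ R₀ z x = 0 → x = 0) :
    z ∉ spectrum A := by
  obtain ⟨k, hk, -, -, hcompl⟩ := exists_genEigenspace_eq h₀ hc z
  rw [notMem_spectrum_iff h₀, ContinuousLinearMap.isUnit_iff_bijective]
  have hinj : Function.Injective (pencil z₀ R₀ z) :=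
    (injective_iff_map_eq_zero _).2 h
  refine ⟨hinj, fun y => ?_⟩
  have hker : LinearMap.ker ((pencil z₀ R₀ z : Module.End ℂ X) ^ k) = ⊥ := by
    rw [LinearMap.ker_eq_bot, Module.End.coe_pow]
    exact hinj.iterate k
  have htop : LinearMap.range ((pencil z₀ R₀ z : Module.End ℂ X) ^ k) = ⊤ := by
    have := hcompl.sup_eq_top
    rwa [hker, bot_sup_eq] at this
  obtain ⟨x, hx⟩ := LinearMap.range_eq_top.1 htop y
  obtain ⟨j, rfl⟩ := Nat.exists_eq_succ_of_ne_zero hk.ne'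
  rw [pow_succ'] at hx
  exact ⟨_, hx⟩

theorem eigenspace_ne_bot (h₀ : IsResolventAt A z₀ R₀)
    (hc : IsCompactOperator (R₀ * R₀)) {z : ℂ} (hz : z ∈ spectrum A) : eigenspace A z ≠ ⊥ := by
  intro h
  refine notMem_spectrum_of_injective h₀ hc (fun x hx => ?_) hz
  have : x ∈ eigenspace A z := by
    rw [eigenspace, mem_powKer_iff h₀, pow_one]; exact hx
  rwa [h, Submodule.mem_bot] at this

/-- A spectral decomposition with respect to a finite set `S`: an invariant closed complement
of the generalized eigenspaces on which `A - z` is invertible for all `z` that are in `S` or outside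
the spectrum. -/
structure IsSpectralComplement (A : X →ₗ.[ℂ] X) (z₀ : ℂ) (R₀ : X →L[ℂ] X) (S : Set ℂ)
    (M : Submodule ℂ X) : Prop where
  isCompl : IsCompl (spectralSubspace A S) M
  isClosed : IsClosed (M : Set X)
  invariant : ∀ x ∈ M, R₀ x ∈ M
  injective : ∀ z, z ∈ S ∨ z ∉ spectrum A → ∀ x ∈ M, pencil z₀ R₀ z x = 0 → x = 0
  surjective : ∀ z, z ∈ S ∨ z ∉ spectrum A → ∀ y ∈ M, ∃ x ∈ M, pencil z₀ R₀ z x = y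

/-- Let `Q` be the product over `z ∈ S` of the pencils raised to their Fitting exponents. Its kernel
is the sum of the generalized eigenspaces, and `M` is its range. For `z ∈ S` the pencil divides `Q`,
and `Q` is bijective on its range, so the pencil is bijective there too. -/
theorem exists_isSpectralComplement (h₀ : IsResolventAt A z₀ R₀)
    (hc : IsCompactOperator (R₀ * R₀)) (S : Finset ℂ) :
    FiniteDimensional ℂ (spectralSubspace A S) ∧
      ∃ M, IsSpectralComplement A z₀ R₀ S M := by
  choose k hk hgen hfd hcompl using fun z => exists_genEigenspace_eq h₀ hc z
  have hQ : ∃ Q : X →L[ℂ] X, Commute R₀ Q ∧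
      LinearMap.ker (Q : Module.End ℂ X) = spectralSubspace A S ∧
      FiniteDimensional ℂ (spectralSubspace A S) ∧
      IsCompl (LinearMap.ker (Q : Module.End ℂ X)) (LinearMap.range (Q : Module.End ℂ X)) ∧
      (∀ z ∈ S, ∃ Q', Commute R₀ Q' ∧ Q = pencil z₀ R₀ z * Q') := by
    classical
    induction S using Finset.induction_on with
    | empty =>
      have e0 : spectralSubspace A ((∅ : Finset ℂ) : Set ℂ) = ⊥ := by simp [spectralSubspace]
      have e1 : LinearMap.ker ((1 : X →L[ℂ] X) : Module.End ℂ X) = ⊥ := LinearMap.ker_id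
      refine ⟨1, Commute.one_right _, e1.trans e0.symm, ?_, ?_, by simp⟩
      · rw [e0]
        infer_instance
      · have e2 : LinearMap.range ((1 : X →L[ℂ] X) : Module.End ℂ X) = ⊤ := LinearMap.range_id
        rw [e1, e2]
        exact isCompl_bot_top
    | insert z S hz ih =>
      obtain ⟨Q, hRQ, hker, hfdS, hcQ, hdiv⟩ := ih
      have hpow : (pencil z₀ R₀ z : Module.End ℂ X) ^ k z =
          ((pencil z₀ R₀ z ^ k z : X →L[ℂ] X) : Module.End ℂ X) := by ext y; simp
      have hpQ : Commute (pencil z₀ R₀ z) Q :=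
        (Commute.one_left _).sub_left (hRQ.smul_left _)
      have hcomm : Commute ((pencil z₀ R₀ z : Module.End ℂ X) ^ k z) (Q : Module.End ℂ X) := by
        rw [hpow]
        have := (hpQ.pow_left (k z)).eq
        exact LinearMap.ext fun x => congrArg (fun f : X →L[ℂ] X => f x) this
      have hmul := Module.End.isCompl_ker_range_mul hcomm (hcompl z) hcQ
      have hsub : spectralSubspace A ((insert z S : Finset ℂ) : Set ℂ) =
          genEigenspace A z ⊔ spectralSubspace A S := by
        rw [spectralSubspace, spectralSubspace, Finset.coe_insert, iSup_insert]
      have hcoe : ((pencil z₀ R₀ z ^ k z * Q : X →L[ℂ] X) : Module.End ℂ X) =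
          (pencil z₀ R₀ z : Module.End ℂ X) ^ k z * (Q : Module.End ℂ X) := by
        rw [hpow]; rfl
      refine ⟨pencil z₀ R₀ z ^ k z * Q, ((commute_pencil z₀ R₀ z).pow_right _).mul_right hRQ,
        ?_, ?_, ?_, ?_⟩
      · rw [hcoe, hmul.2, hsub, hgen, hker]
      · rw [hsub]
        have := finiteDimensional_genEigenspace h₀ hc z
        exact Submodule.finiteDimensional_sup _ _
      · rw [hcoe]; exact hmul.1
      · intro w hw
        rcases Finset.mem_insert.1 hw with rfl | hw
        · obtain ⟨j, hj⟩ := Nat.exists_eq_succ_of_ne_zero (hk w).ne'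
          refine ⟨pencil z₀ R₀ w ^ j * Q, ((commute_pencil z₀ R₀ w).pow_right _).mul_right hRQ, ?_⟩
          rw [hj, pow_succ', mul_assoc]
        · obtain ⟨Q', hRQ', e⟩ := hdiv w hw
          refine ⟨pencil z₀ R₀ z ^ k z * Q',
            ((commute_pencil z₀ R₀ z).pow_right _).mul_right hRQ', ?_⟩
          rw [e, ← mul_assoc, ((commute_pencil_pencil z₀ R₀ z w).pow_left _).eq, mul_assoc]
  obtain ⟨Q, hRQ, hker, hfdS, hcQ, hdiv⟩ := hQ
  refine ⟨hfdS, LinearMap.range (Q : Module.End ℂ X), hker ▸ hcQ, ?_, ?_, ?_, ?_⟩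
  -- Restricting `Q` to a closed complement of its finite dimensional kernel makes it injective
  -- without changing the range. An injective bounded operator between Banach spaces whose range has
  -- a closed algebraic complement has closed range.
  · have hfdk : FiniteDimensional ℂ (LinearMap.ker (Q : Module.End ℂ X)) := hker ▸ hfdS
    obtain ⟨N', hN'⟩ := Submodule.ClosedComplemented.of_finiteDimensional
      (LinearMap.ker (Q : Module.End ℂ X)) |>.exists_isClosed_isCompl
    have hN'c : CompleteSpace N' := hN'.1.completeSpace_coe
    have hr : LinearMap.range (Q : Module.End ℂ X) =
        LinearMap.range ((Q ∘L N'.subtypeL : N' →L[ℂ] X) : N' →ₗ[ℂ] X) := by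
      refine le_antisymm ?_ ?_
      · rintro _ ⟨x, rfl⟩
        obtain ⟨a, ha, b, hb, rfl⟩ := Submodule.mem_sup.1
          (hN'.2.codisjoint.eq_top ▸ Submodule.mem_top (x := x))
        refine ⟨⟨b, hb⟩, ?_⟩
        rw [map_add, LinearMap.mem_ker.1 ha, zero_add]
        rfl
      · rintro _ ⟨x, rfl⟩
        exact ⟨x, rfl⟩
    rw [hr] at hcQ ⊢
    refine ContinuousLinearMap.closed_complemented_range_of_isCompl_of_ker_eq_bot _ _ hcQ.symm
      Q.isClosed_ker ?_
    rw [LinearMap.ker_eq_bot']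
    intro x hx
    exact Subtype.ext ((Submodule.disjoint_def.1 hN'.2.disjoint) _ hx x.2)
  · rintro _ ⟨x, rfl⟩
    exact ⟨R₀ x, congrArg (fun f : X →L[ℂ] X => f x) hRQ.eq.symm⟩
  · rintro z (hz | hz) x hx h
    · obtain ⟨Q', hRQ', e⟩ := hdiv z hz
      refine (Submodule.disjoint_def.1 hcQ.disjoint) x ?_ hx
      have hc' : Commute (pencil z₀ R₀ z) Q' := (Commute.one_left _).sub_left (hRQ'.smul_left _)
      change Q x = 0
      rw [e, hc'.eq, mul_apply_eq_comp, h, map_zero]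
    · rw [notMem_spectrum_iff h₀, ContinuousLinearMap.isUnit_iff_bijective] at hz
      exact (injective_iff_map_eq_zero _).1 hz.1 x h
  · rintro z (hz | hz) _ ⟨y, rfl⟩
    · obtain ⟨Q', hRQ', e⟩ := hdiv z hz
      obtain ⟨a, ha, _, ⟨b, rfl⟩, rfl⟩ := Submodule.mem_sup.1
        (hcQ.codisjoint.eq_top ▸ Submodule.mem_top (x := y))
      have hQQ' : Commute Q Q' := by
        rw [e]
        exact Commute.mul_left ((Commute.one_left _).sub_left (hRQ'.smul_left _))
          (Commute.refl _)
      -- With `y = a + Q b` and `Q a = 0`, one has `Q y = Q (Q b)`; one factor `Q` is written as the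
      -- pencil times `Q'`.
      refine ⟨Q (Q' b), ⟨_, rfl⟩, ?_⟩
      rw [map_add, LinearMap.mem_ker.1 ha, zero_add]
      change pencil z₀ R₀ z ((Q * Q') b) = Q (Q b)
      rw [hQQ'.eq]
      exact congrArg (fun f : X →L[ℂ] X => f (Q b)) e.symm
    · obtain ⟨u, hu⟩ := (notMem_spectrum_iff h₀).1 hz
      have hpQ : Commute (u : X →L[ℂ] X) Q := by
        rw [hu]; exact (Commute.one_left _).sub_left (hRQ.smul_left _)
      refine ⟨Q (((u⁻¹ : (X →L[ℂ] X)ˣ) : X →L[ℂ] X) y), ⟨_, rfl⟩, ?_⟩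
      rw [← hu]
      change ((u : X →L[ℂ] X) * Q) _ = Q y
      rw [hpQ.eq]
      change Q (((u : X →L[ℂ] X) * ((u⁻¹ : (X →L[ℂ] X)ˣ) : X →L[ℂ] X)) y) = Q y
      rw [Units.mul_inv]
      rfl

end UnboundedOperator

/-! ### Spectral projections along circles and isolation of the spectrum -/

namespace UnboundedOperator

variable {X : Type*} [NormedAddCommGroup X] [NormedSpace ℂ X]

/-- Reversal moves the parameter interval to `[-2π, 0]`, and periodicity moves it back; only the
sign from the derivative remains. -/
theorem integral_reversed_circle (f : ℂ → X) (c : ℂ) (r : ℝ) :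
    ∫ t in (0 : ℝ)..2 * Real.pi, deriv (fun t => circleMap c r (-t)) t • f (circleMap c r (-t)) =
      -∮ z in C(c, r), f z := by
  have hd : ∀ t, deriv (fun t => circleMap c r (-t)) t = -deriv (circleMap c r) (-t) := fun t =>
    deriv_comp_neg (circleMap c r) t
  set g : ℝ → X := fun t => deriv (circleMap c r) t • f (circleMap c r t) with hg
  have hper : Function.Periodic g (2 * Real.pi) := by
    intro t
    simp only [hg, deriv_circleMap, periodic_circleMap c r t, periodic_circleMap 0 r t]
  have h1 := hper.intervalIntegral_add_eq (-(2 * Real.pi)) 0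
  rw [neg_add_cancel, zero_add] at h1
  simp only [hd, neg_smul, intervalIntegral.integral_neg]
  rw [circleIntegral, ← h1, intervalIntegral.integral_comp_neg (fun t => g t), neg_zero]

/-- Projections at distance less than one have the same rank. -/
theorem finrank_range_le_of_norm_sub_lt_one {P Q : X →L[ℂ] X} (hQ : IsIdempotentElem Q)
    [FiniteDimensional ℂ P.range] (h : ‖Q - P‖ < 1) :
    Module.finrank ℂ Q.range ≤ Module.finrank ℂ P.range := by
  let f : Q.range →ₗ[ℂ] P.range :=
    (P : X →ₗ[ℂ] X).rangeRestrict ∘ₗ Q.range.subtype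
  refine LinearMap.finrank_le_finrank_of_injective (f := f) ?_
  refine (injective_iff_map_eq_zero f).2 fun x hx => ?_
  have hPx : P (x : X) = 0 := congrArg Subtype.val hx
  have hQx : Q (x : X) = x := by
    obtain ⟨y, hy⟩ := x.2
    have hy' : Q y = x := hy
    rw [← hy', ← mul_apply_eq_comp, hQ.eq]
  by_contra hne
  have hpos : 0 < ‖(x : X)‖ := norm_pos_iff.2 fun h0 => hne (Subtype.ext h0)
  -- If `P x = 0` and `Q x = x`, then `x = (Q - P) x`, which is shorter than `x` unless `x = 0`. So
  -- `P` is injective on the range of `Q`.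
  have h1 : ‖(x : X)‖ ≤ ‖Q - P‖ * ‖(x : X)‖ := by
    have := (Q - P).le_opNorm (x : X)
    rwa [sub_apply, hQx, hPx, sub_zero] at this
  nlinarith

variable [CompleteSpace X]
variable {A : X →ₗ.[ℂ] X} {z₀ : ℂ} {R₀ : X →L[ℂ] X} {S : Set ℂ} {M : Submodule ℂ X}

theorem IsSpectralComplement.isUnit_pencil_restrict (hM : IsSpectralComplement A z₀ R₀ S M) {z : ℂ}
    (hz : z ∈ S ∨ z ∉ spectrum A) : IsUnit (pencil z₀ (R₀.restrict hM.invariant) z) := by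
  have : CompleteSpace M := hM.isClosed.completeSpace_coe
  have e : ∀ x : M, ((pencil z₀ (R₀.restrict hM.invariant) z x : M) : X) =
      pencil z₀ R₀ z (x : X) := by
    intro x
    rw [pencil_apply, pencil_apply]
    rfl
  rw [ContinuousLinearMap.isUnit_iff_bijective]
  refine ⟨(injective_iff_map_eq_zero _).2 fun x hx => ?_, fun y => ?_⟩
  · refine Subtype.ext (hM.injective z hz x x.2 ?_)
    rw [← e, hx]; rfl
  · obtain ⟨x, hx, h⟩ := hM.surjective z hz y y.2
    exact ⟨⟨x, hx⟩, Subtype.ext ((e _).trans h)⟩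

/-- Split the space at `S = {w}`. On the complement the pencil is invertible at `w`, hence at all
nearby points. On the generalized eigenspace of `w` no other `z` can be an eigenvalue. Both summands
are invariant, so the pencil at `z` is injective. -/
theorem eventually_notMem_spectrum (h₀ : IsResolventAt A z₀ R₀)
    (hc : IsCompactOperator (R₀ * R₀)) (w : ℂ) : ∀ᶠ z in 𝓝[≠] w, z ∉ spectrum A := by
  obtain ⟨-, M, hM⟩ := exists_isSpectralComplement h₀ hc {w}
  have : CompleteSpace M := hM.isClosed.completeSpace_coe
  have h1 : ∀ᶠ z in 𝓝 w, IsUnit (pencil z₀ (R₀.restrict hM.invariant) z) :=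
    (continuous_pencil _ _).continuousAt.eventually
      (Units.isOpen.mem_nhds (hM.isUnit_pencil_restrict (Or.inl (by simp))))
  filter_upwards [eventually_nhdsWithin_of_eventually_nhds h1, self_mem_nhdsWithin] with z hz hzw
  refine notMem_spectrum_of_injective h₀ hc fun x hx => ?_
  obtain ⟨k, -, hgen, -, -⟩ := exists_genEigenspace_eq h₀ hc w
  have hN : spectralSubspace A ((({w} : Finset ℂ)) : Set ℂ) = genEigenspace A w := by
    simp [spectralSubspace]
  obtain ⟨a, ha, b, hb, rfl⟩ := Submodule.mem_sup.1
    (hM.isCompl.codisjoint.eq_top ▸ Submodule.mem_top (x := x))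
  have hRa : ∀ a ∈ genEigenspace A w, R₀ a ∈ genEigenspace A w := by
    intro a ha
    rw [hgen] at ha ⊢
    have hpow : (pencil z₀ R₀ w : Module.End ℂ X) ^ k =
      ((pencil z₀ R₀ w ^ k : X →L[ℂ] X) : Module.End ℂ X) := by ext y; simp
    rw [hpow] at ha ⊢
    have e := congrArg (fun f : X →L[ℂ] X => f a) ((commute_pencil z₀ R₀ w).pow_right k).eq
    change R₀ ((pencil z₀ R₀ w ^ k) a) = (pencil z₀ R₀ w ^ k) (R₀ a) at e
    change (pencil z₀ R₀ w ^ k) (R₀ a) = 0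
    rw [← e, show (pencil z₀ R₀ w ^ k) a = 0 from ha, map_zero]
  rw [hN] at ha
  rw [map_add] at hx
  have hpa : pencil z₀ R₀ z a ∈ genEigenspace A w := by
    rw [pencil_apply]
    exact Submodule.sub_mem _ ha (Submodule.smul_mem _ _ (hRa a ha))
  have hpb : pencil z₀ R₀ z b ∈ M := by
    rw [pencil_apply]
    exact Submodule.sub_mem _ hb (Submodule.smul_mem _ _ (hM.invariant b hb))
  have hpb0 : pencil z₀ R₀ z b = 0 := by
    refine (Submodule.disjoint_def.1 hM.isCompl.disjoint) _ ?_ hpb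
    rw [hN, eq_neg_of_add_eq_zero_right hx]
    exact Submodule.neg_mem _ hpa
  have hb0 : b = 0 := by
    obtain ⟨u, hu⟩ := hz
    have h2 : (u : M →L[ℂ] M) ⟨b, hb⟩ = 0 := by
      rw [hu]
      apply Subtype.ext
      rw [pencil_apply] at hpb0 ⊢
      exact hpb0
    have h3 : ((((u⁻¹ : (M →L[ℂ] M)ˣ) : M →L[ℂ] M)) * (u : M →L[ℂ] M)) ⟨b, hb⟩ = 0 := by
      rw [mul_apply_eq_comp, h2, map_zero]
    rw [Units.inv_mul] at h3
    exact congrArg Subtype.val h3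
  have hpa0 : pencil z₀ R₀ z a = 0 := by rwa [hpb0, add_zero] at hx
  have ha0 : a = 0 := by
    have hzz : z - z₀ ≠ 0 ∨ a = 0 := by
      by_contra! h
      rw [pencil_apply, h.1, zero_smul, sub_zero] at hpa0
      exact h.2 hpa0
    rcases hzz with hzz | h
    swap
    · exact h
    have hR : R₀ a = (z - z₀)⁻¹ • a := by
      rw [pencil_apply, sub_eq_zero] at hpa0
      rw [eq_inv_smul_iff₀ hzz, ← hpa0]
    -- If the pencil at `z` annihilates `a`, then `a` is an eigenvector of `R₀`, and the pencil at
    -- `w` multiplies it by `(z - w) / (z - z₀)`. This scalar is nonzero, although some power of the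
    -- pencil at `w` annihilates `a`.
    have hpw : (pencil z₀ R₀ w : Module.End ℂ X) a = ((z - w) / (z - z₀)) • a := by
      change pencil z₀ R₀ w a = _
      rw [pencil_apply, hR, smul_smul]
      nth_rw 1 [← one_smul ℂ a]
      rw [← sub_smul]
      congr 1
      field_simp
      ring
    have hpk : ∀ j, ((pencil z₀ R₀ w : Module.End ℂ X) ^ j) a =
        ((z - w) / (z - z₀)) ^ j • a := by
      intro j
      induction j with
      | zero => simp
      | succ j ih => rw [pow_succ, Module.End.mul_apply, hpw, map_smul, ih, smul_smul, pow_succ']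
    rw [hgen, LinearMap.mem_ker, hpk] at ha
    refine (smul_eq_zero.1 ha).resolve_left (pow_ne_zero _ (div_ne_zero ?_ hzz))
    exact sub_ne_zero.2 hzw
  rw [ha0, hb0, add_zero]

theorem finite_spectrum_inter (h₀ : IsResolventAt A z₀ R₀) (hc : IsCompactOperator (R₀ * R₀))
    {K : Set ℂ} (hK : IsCompact K) : (spectrum A ∩ K).Finite := by
  have hcp : IsCompact (spectrum A ∩ K) := hK.inter_left (isClosed_spectrum h₀)
  by_contra hinf
  obtain ⟨w, -, hw⟩ := Set.Infinite.exists_accPt_of_subset_isCompact hinf hcp subset_rfl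
  rw [accPt_iff_frequently_nhdsNE] at hw
  exact hw ((eventually_notMem_spectrum h₀ hc w).mono fun z hz h => hz h.1)

/-- On `M` the resolvent continues holomorphically across the enclosed spectrum, through the inverse
of the pencil restricted to `M`; Cauchy's theorem applies. -/
theorem circleIntegral_resolvent_eq_zero (h₀ : IsResolventAt A z₀ R₀)
    (hM : IsSpectralComplement A z₀ R₀ S M) {c : ℂ} {r : ℝ} (hr : 0 ≤ r)
    (hS : ∀ z ∈ Metric.closedBall c r, z ∈ S ∨ z ∉ spectrum A)
    (hsph : ∀ z ∈ Metric.sphere c r, z ∉ spectrum A) {x : X} (hx : x ∈ M) :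
    (∮ z in C(c, r), resolvent A z x) = 0 := by
  have : CompleteSpace M := hM.isClosed.completeSpace_coe
  set RM := R₀.restrict hM.invariant
  set g : ℂ → X := fun z => ((RM * Ring.inverse (pencil z₀ RM z)) ⟨x, hx⟩ : M) with hg
  have hd : ∀ z ∈ Metric.closedBall c r, DifferentiableAt ℂ g z := by
    intro z hz
    have hu := hM.isUnit_pencil_restrict (hS z hz)
    have h1 : DifferentiableAt ℂ (fun z => RM * Ring.inverse (pencil z₀ RM z)) z :=
      (differentiableAt_const _).mul ((differentiable_pencil z₀ RM z).inverse hu)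
    exact M.subtypeL.differentiableAt.comp z (h1.clm_apply (differentiableAt_const _))
  have h1 : (∮ z in C(c, r), g z) = 0 :=
    Complex.circleIntegral_eq_zero_of_differentiable_on_off_countable hr Set.countable_empty
      (fun z hz => (hd z hz).continuousAt.continuousWithinAt)
      fun z hz => hd z (Metric.ball_subset_closedBall hz.1)
  rw [← h1]
  refine circleIntegral.integral_congr hr fun z hz => ?_
  have hu := hM.isUnit_pencil_restrict (hS z (Metric.sphere_subset_closedBall hz))
  set y : M := Ring.inverse (pencil z₀ RM z) ⟨x, hx⟩ with hy
  have hxy : pencil z₀ R₀ z (y : X) = x := by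
    have e : pencil z₀ RM z y = ⟨x, hx⟩ := by
      rw [hy, ← mul_apply_eq_comp, Ring.mul_inverse_cancel _ hu]; rfl
    have e' := congrArg Subtype.val e
    rw [pencil_apply] at e' ⊢
    exact e'
  change resolvent A z x = R₀ (y : X)
  rw [← hxy, ← mul_apply_eq_comp, h₀.mul_pencil (isResolventAt_resolvent (hsph z hz))]

/-- With `y = (A - w) x`, one power lower, `(A - z)⁻¹ x = (z - w)⁻¹ ((A - z)⁻¹ y - x)`. The last
term contributes `-2πi x`. The other carries an additional factor `(z - w)⁻¹`, which is why the
induction needs the integrals weighted with negative powers as well. -/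
theorem circleIntegral_resolvent_powKer (h₀ : IsResolventAt A z₀ R₀) {c w : ℂ} {r : ℝ}
    (hw : w ∈ Metric.ball c r) (hsph : ∀ z ∈ Metric.sphere c r, z ∉ spectrum A) (k : ℕ) {x : X}
    (hx : x ∈ powKer A w k) :
    (∮ z in C(c, r), resolvent A z x) = -((2 * (Real.pi : ℂ) * Complex.I) • x) ∧
      ∀ j : ℕ, (∮ z in C(c, r), (z - w) ^ (-(j : ℤ) - 1) • resolvent A z x) = 0 := by
  have hr : 0 ≤ r := (dist_nonneg.trans_lt (Metric.mem_ball.1 hw)).le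
  have hne : ∀ z ∈ Metric.sphere c r, z - w ≠ 0 := by
    intro z hz h
    rw [sub_eq_zero] at h
    rw [← h, Metric.mem_ball, Metric.mem_sphere.1 hz] at hw
    exact lt_irrefl _ hw
  have hcont : ∀ y, ContinuousOn (fun z => resolvent A z y) (Metric.sphere c r) := fun y =>
    ((continuousOn_resolvent h₀).mono hsph).clm_apply continuousOn_const
  have hzc : ∀ n : ℤ, ContinuousOn (fun z : ℂ => (z - w) ^ n) (Metric.sphere c r) := fun n =>
    (continuousOn_id.sub continuousOn_const).zpow₀ n fun z hz => Or.inl (hne z hz)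
  induction k generalizing x with
  | zero =>
    have : x = 0 := hx
    subst this
    simp [circleIntegral]
  | succ k ih =>
    obtain ⟨hd, hy⟩ := mem_powKer_succ.1 hx
    set y := A ⟨x, hd⟩ - w • x with hydef
    have hres : ∀ z ∈ Metric.sphere c r, resolvent A z x =
        (z - w) ^ (-1 : ℤ) • resolvent A z y - (z - w) ^ (-1 : ℤ) • x := by
      intro z hz
      have h1 := (isResolventAt_resolvent (hsph z hz)).2 ⟨x, hd⟩
      have h2 : A ⟨x, hd⟩ - z • x = y - (z - w) • x := by rw [hydef, sub_smul]; abel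
      rw [h2, map_sub, map_smul, sub_eq_iff_eq_add] at h1
      have h3 : (z - w) • resolvent A z x = resolvent A z y - x := by
        rw [h1]
        abel
      rw [zpow_neg_one, ← smul_sub, eq_inv_smul_iff₀ (hne z hz), h3]
    obtain ⟨-, ih2⟩ := ih hy
    have hstep : ∀ n : ℤ, (∮ z in C(c, r), (z - w) ^ n • resolvent A z x) =
        (∮ z in C(c, r), (z - w) ^ (n - 1) • resolvent A z y) -
          (∮ z in C(c, r), (z - w) ^ (n - 1)) • x := by
      intro n
      rw [← circleIntegral.integral_smul_const, ← circleIntegral.integral_sub]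
      · refine circleIntegral.integral_congr hr fun z hz => ?_
        rw [hres z hz, smul_sub, smul_smul, smul_smul, ← zpow_add₀ (hne z hz)]
        rfl
      · exact ((hzc _).smul (hcont y)).circleIntegrable hr
      · exact ((hzc _).smul continuousOn_const).circleIntegrable hr
    constructor
    · have h0 := hstep 0
      have h1 := ih2 0
      simp only [zpow_zero, one_smul, zero_sub] at h0
      simp only [Nat.cast_zero, neg_zero, zero_sub] at h1
      rw [h0, h1, zero_sub]
      simp only [zpow_neg_one]
      rw [circleIntegral.integral_sub_inv_of_mem_ball hw]
    · intro j
      rw [hstep, circleIntegral.integral_sub_zpow_of_ne (by omega), zero_smul, sub_zero]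
      have := ih2 (j + 1)
      push_cast at this
      rw [← this]
      congr 1
      ext z
      congr 2
      ring

theorem spectralProjection_circle_apply (h₀ : IsResolventAt A z₀ R₀) {c : ℂ} {r : ℝ} (hr : 0 ≤ r)
    (hsph : ∀ z ∈ Metric.sphere c r, z ∉ spectrum A) (x : X) :
    spectralProjection A (fun t => circleMap c r (-t)) 0 (2 * Real.pi) x =
      -((2 * (Real.pi : ℂ) * Complex.I)⁻¹ • ∮ z in C(c, r), resolvent A z x) := by
  have hint : CircleIntegrable (resolvent A) c r :=
    ((continuousOn_resolvent h₀).mono hsph).circleIntegrable hr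
  have h2 : (∮ z in C(c, r), resolvent A z) x = ∮ z in C(c, r), resolvent A z x := by
    rw [circleIntegral, circleIntegral, ContinuousLinearMap.intervalIntegral_apply hint.out]
    simp
  rw [spectralProjection, integral_reversed_circle, smul_apply, neg_apply, h2, smul_neg]

/-- The closed disc contains finitely many spectral points, all in its interior. The operator is the
identity on their generalized eigenspaces and zero on the complement. Points of the disc outside the
spectrum contribute trivial spaces. -/
theorem spectralProjection_circle (h₀ : IsResolventAt A z₀ R₀) (hc : IsCompactOperator (R₀ * R₀))
    {c : ℂ} {r : ℝ} (hr : 0 < r) (hsph : Disjoint (Metric.sphere c r) (spectrum A)) :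
    IsIdempotentElem (spectralProjection A (fun t => circleMap c r (-t)) 0 (2 * Real.pi)) ∧
      (spectralProjection A (fun t => circleMap c r (-t)) 0 (2 * Real.pi)).range =
        spectralSubspace A (Metric.ball c r) ∧
      FiniteDimensional ℂ (spectralSubspace A (Metric.ball c r)) := by
  have hs : ∀ z ∈ Metric.sphere c r, z ∉ spectrum A := fun z hz => Set.disjoint_left.1 hsph hz
  have hfin := finite_spectrum_inter h₀ hc (isCompact_closedBall c r)
  obtain ⟨hfd, M, hM⟩ := exists_isSpectralComplement h₀ hc hfin.toFinset
  rw [hfin.coe_toFinset] at hfd hM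
  set S := spectrum A ∩ Metric.closedBall c r with hS
  have hSball : ∀ z ∈ S, z ∈ Metric.ball c r := fun z hz =>
    lt_of_le_of_ne hz.2 fun h => hs z h hz.1
  have hN : spectralSubspace A (Metric.ball c r) = spectralSubspace A S := by
    refine le_antisymm (iSup₂_le fun z hz => ?_) (biSup_mono hSball)
    by_cases h : z ∈ spectrum A
    · exact le_iSup₂ (f := fun z (_ : z ∈ S) => genEigenspace A z) z
        ⟨h, Metric.ball_subset_closedBall hz⟩
    · rw [genEigenspace_eq_bot h₀ h]; exact bot_le
  set P := spectralProjection A (fun t => circleMap c r (-t)) 0 (2 * Real.pi) with hP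
  have hpi : (2 * (Real.pi : ℂ) * Complex.I) ≠ 0 := Complex.two_pi_I_ne_zero
  have hPM : ∀ x ∈ M, P x = 0 := by
    intro x hx
    rw [hP, spectralProjection_circle_apply h₀ hr.le hs, circleIntegral_resolvent_eq_zero h₀ hM
      hr.le (fun z hz => ?_) hs hx, smul_zero, neg_zero]
    by_cases h : z ∈ spectrum A
    · exact Or.inl ⟨h, hz⟩
    · exact Or.inr h
  have hPN : ∀ x ∈ spectralSubspace A S, P x = x := by
    have : spectralSubspace A S ≤ LinearMap.eqLocus (P : X →ₗ[ℂ] X) LinearMap.id := by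
      refine iSup₂_le fun z hz => iSup_le fun k x hx => ?_
      change P x = x
      rw [hP, spectralProjection_circle_apply h₀ hr.le hs,
        (circleIntegral_resolvent_powKer h₀ (hSball z hz) hs k hx).1, smul_neg, neg_neg,
        inv_smul_smul₀ hpi]
    exact fun x hx => this hx
  have hdec : ∀ x, ∃ a ∈ spectralSubspace A S, ∃ b ∈ M, x = a + b ∧ P x = a := by
    intro x
    obtain ⟨a, ha, b, hb, rfl⟩ := Submodule.mem_sup.1
      (hM.isCompl.codisjoint.eq_top ▸ Submodule.mem_top (x := x))
    exact ⟨a, ha, b, hb, rfl, by rw [map_add, hPN a ha, hPM b hb, add_zero]⟩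
  rw [hN]
  refine ⟨?_, le_antisymm ?_ ?_, hfd⟩
  · ext x
    obtain ⟨a, ha, b, hb, rfl, e⟩ := hdec x
    rw [mul_apply_eq_comp, e, hPN a ha]
  · rintro _ ⟨x, rfl⟩
    obtain ⟨a, ha, b, hb, rfl, e⟩ := hdec x
    change P _ ∈ _
    rw [e]; exact ha
  · exact fun x hx => ⟨x, hPN x hx⟩

end UnboundedOperator

namespace UnboundedOperator

variable {X : Type*} [NormedAddCommGroup X] [NormedSpace ℂ X]

/-! ### Bounded perturbations -/

/-- The graph form dispenses with dependent domain proofs and fits operators described by a system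
of equations. -/
theorem isResolventAt_iff_graph {A : X →ₗ.[ℂ] X} {z : ℂ} {R : X →L[ℂ] X} :
    IsResolventAt A z R ↔ (∀ y, (R y, y + z • R y) ∈ A.graph) ∧
      ∀ x w, (x, w) ∈ A.graph → R (w - z • x) = x := by
  constructor
  · intro h
    refine ⟨fun y => ?_, fun x w hxw => ?_⟩
    · rw [LinearPMap.mem_graph_iff]
      exact ⟨⟨R y, h.mem_domain y⟩, rfl, h.apply_eq y _⟩
    · rw [LinearPMap.mem_graph_iff] at hxw
      obtain ⟨x, rfl, rfl⟩ := hxw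
      exact h.2 x
  · rintro ⟨h1, h2⟩
    refine ⟨fun y => ?_, fun x => h2 _ _ (A.mem_graph x)⟩
    obtain ⟨x, hx, hAx⟩ := (LinearPMap.mem_graph_iff A).1 (h1 y)
    simp only at hx hAx
    refine ⟨hx ▸ x.2, ?_⟩
    have e : (⟨R y, hx ▸ x.2⟩ : A.domain) = x := Subtype.ext hx.symm
    rw [e, hAx, add_sub_cancel_right]

/-- `A'` is the sum of `A` and the bounded operator `E`. -/
def IsBoundedPerturbation (A A' : X →ₗ.[ℂ] X) (E : X →L[ℂ] X) : Prop :=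
  ∀ x y, (x, y) ∈ A'.graph ↔ (x, y - E x) ∈ A.graph

namespace IsBoundedPerturbation

variable {A A' : X →ₗ.[ℂ] X} {E R R' : X →L[ℂ] X} {z : ℂ}

/-- `(A + E - z) R = 1 + E R`, so inverting this bounded operator inverts `A' - z`. -/
theorem mul_inverse (h : IsBoundedPerturbation A A' E) (hR : IsResolventAt A z R)
    {G : X →L[ℂ] X} (h1 : (1 + E * R) * G = 1) (h2 : G * (1 + E * R) = 1) :
    IsResolventAt A' z (R * G) := by
  rw [isResolventAt_iff_graph] at hR ⊢
  refine ⟨fun y => ?_, fun x w hxw => ?_⟩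
  · rw [h]
    have h3 := hR.1 (G y)
    have h4 : y = G y + E (R (G y)) := (congrArg (fun f : X →L[ℂ] X => f y) h1).symm
    rw [mul_apply_eq_comp]
    convert h3 using 2
    nth_rw 1 [h4]
    abel
  · rw [h] at hxw
    have h3 := hR.2 _ _ hxw
    set q := w - E x - z • x with hq
    have h4 : w - z • x = (1 + E * R) q := by
      change _ = q + E (R q)
      rw [h3, hq]; abel
    rw [h4, mul_apply_eq_comp, ← mul_apply_eq_comp G, h2]
    exact h3

theorem resolvent_sub (h : IsBoundedPerturbation A A' E) (hR : IsResolventAt A z R)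
    (hR' : IsResolventAt A' z R') : R' - R = -(R' * E * R) := by
  rw [isResolventAt_iff_graph] at hR hR'
  ext y
  have h1 : (R y, y + z • R y + E (R y)) ∈ A'.graph := by
    rw [h, add_sub_cancel_right]; exact hR.1 y
  have h2 := hR'.2 _ _ h1
  have e : y + z • R y + E (R y) - z • R y = y + E (R y) := by abel
  rw [e, map_add] at h2
  change R' y - R y = -(R' (E (R y)))
  rw [sub_eq_iff_eq_add, ← sub_eq_neg_add, eq_sub_iff_add_eq, h2]

/-- The resolvent of `A'` at `z` in terms of the one of `A` at `z₀`. -/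
theorem resolvent_eq_mul (h : IsBoundedPerturbation A A' E) {z₀ : ℂ} (hR : IsResolventAt A z₀ R)
    (hR' : IsResolventAt A' z R') : R * (1 - (E - (z - z₀) • 1) * R') = R' := by
  rw [isResolventAt_iff_graph] at hR hR'
  ext y
  have h1 := hR.2 _ _ ((h _ _).1 (hR'.1 y))
  have e : ((1 - (E - (z - z₀) • 1) * R' : X →L[ℂ] X)) y =
      y + z • R' y - E (R' y) - z₀ • R' y := by
    change y - (E (R' y) - (z - z₀) • R' y) = _
    rw [sub_smul]; abel
  rw [mul_apply_eq_comp, e, h1]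

variable [CompleteSpace X]

theorem exists_isResolventAt (h : IsBoundedPerturbation A A' E) (hR : IsResolventAt A z R)
    (hE : ‖E * R‖ < 1) : ∃ R', IsResolventAt A' z R' := by
  have h1 : ‖-(E * R)‖ < 1 := by rwa [norm_neg]
  have hu := (Units.oneSub (-(E * R)) h1)
  have e : ((Units.oneSub (-(E * R)) h1 : (X →L[ℂ] X)ˣ) : X →L[ℂ] X) = 1 + E * R := by
    rw [Units.val_oneSub, sub_neg_eq_add]
  refine ⟨_, h.mul_inverse hR (G := ((Units.oneSub (-(E * R)) h1)⁻¹ : (X →L[ℂ] X)ˣ)) ?_ ?_⟩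
  · rw [← e, Units.mul_inv]
  · rw [← e, Units.inv_mul]

end IsBoundedPerturbation

section Continuity

variable [CompleteSpace X] {Y : Type*} [NormedAddCommGroup Y] [NormedSpace ℂ Y] [CompleteSpace Y]
  {Q : Type*} [NormedAddCommGroup Q]

/-- The spectral projection along a curve depends continuously on bounded perturbations, with
values in any space in which one resolvent takes its values. -/
theorem exists_spectralProjection_continuousAt {A : Q → X →ₗ.[ℂ] X} {m : Q} {E : Q → X →L[ℂ] X}
    (hA : ∀ p, IsBoundedPerturbation (A m) (A p) (E p)) (hE : ∀ p, ‖E p‖ ≤ ‖p - m‖)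
    {z₀ : ℂ} {R₀ : X →L[ℂ] X} (h₀ : IsResolventAt (A m) z₀ R₀)
    {ι : Y →L[ℂ] X} {T₀ : X →L[ℂ] Y} (hT : ι ∘L T₀ = R₀)
    {γ : ℝ → ℂ} {a b : ℝ} {K : NNReal} (hab : a ≤ b) (hγ : LipschitzOnWith K γ (Set.Icc a b))
    (hsp : ∀ t ∈ Set.Icc a b, γ t ∉ spectrum (A m)) :
    ∃ P : Q → (X →L[ℂ] Y),
      (∀ᶠ p in 𝓝 m, (∀ t ∈ Set.Icc a b, γ t ∉ spectrum (A p)) ∧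
        ι ∘L P p = spectralProjection (A p) γ a b) ∧ ContinuousAt P m := by
  have hγc : ContinuousOn γ (Set.Icc a b) := hγ.continuousOn
  obtain ⟨B₁, hB₁⟩ := isCompact_Icc.exists_bound_of_continuousOn
    ((continuousOn_resolvent h₀).comp hγc hsp)
  obtain ⟨L₁, hL₁⟩ := isCompact_Icc.exists_bound_of_continuousOn
    (hγc.sub (continuousOn_const (c := z₀)))
  set B := |B₁| + 1 with hBdef
  set L := |L₁| with hLdef
  have hBpos : 0 < B := by positivity
  have hB : ∀ t ∈ Set.Icc a b, ‖resolvent (A m) (γ t)‖ ≤ B := fun t ht =>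
    (hB₁ t ht).trans ((le_abs_self _).trans (by linarith))
  have hL : ∀ t ∈ Set.Icc a b, ‖γ t - z₀‖ ≤ L := fun t ht => (hL₁ t ht).trans (le_abs_self _)
  -- By `resolvent_eq_mul` each resolvent of `A p` along the curve factors through `R₀` on the left.
  -- Replacing `R₀` by its lift `T₀` gives the integrand with values in `Y`, and continuity in the
  -- stronger norm follows from that in the norm of `X`.
  set F : Q → ℝ → (X →L[ℂ] Y) := fun p t =>
    T₀ ∘L (1 - (E p - (γ t - z₀) • 1) * resolvent (A p) (γ t)) with hF
  -- With `B` a bound for the resolvent of `A m` on the curve, this makes the Neumann series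
  -- converge, and the constant `1 / 2` yields the uniform bound `2 * B` for the resolvents of `A
  -- p`.
  have hnear : ∀ᶠ p in 𝓝 m, ‖p - m‖ * B ≤ 1 / 2 := by
    have : Tendsto (fun p => ‖p - m‖ * B) (𝓝 m) (𝓝 (‖m - m‖ * B)) := by
      apply Continuous.tendsto; fun_prop
    rw [sub_self, norm_zero, zero_mul] at this
    exact this.eventually (ge_mem_nhds (by norm_num))
  have hspp : ∀ p, ‖p - m‖ * B ≤ 1 / 2 → ∀ t ∈ Set.Icc a b, γ t ∉ spectrum (A p) := by
    intro p hp t ht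
    refine not_not.2 ((hA p).exists_isResolventAt (isResolventAt_resolvent (hsp t ht)) ?_)
    calc ‖E p * resolvent (A m) (γ t)‖ ≤ ‖E p‖ * ‖resolvent (A m) (γ t)‖ := norm_mul_le _ _
      _ ≤ ‖p - m‖ * B := by gcongr; exacts [hE p, hB t ht]
      _ < 1 := by linarith
  have hRp : ∀ p, ‖p - m‖ * B ≤ 1 / 2 → ∀ t ∈ Set.Icc a b,
      ‖resolvent (A p) (γ t)‖ ≤ 2 * B ∧
        ‖resolvent (A p) (γ t) - resolvent (A m) (γ t)‖ ≤ 2 * B * ‖p - m‖ * B := by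
    intro p hp t ht
    have e := (hA p).resolvent_sub (isResolventAt_resolvent (hsp t ht))
      (isResolventAt_resolvent (hspp p hp t ht))
    have h1 : ‖resolvent (A p) (γ t) - resolvent (A m) (γ t)‖ ≤
        ‖resolvent (A p) (γ t)‖ * ‖p - m‖ * B := by
      rw [e, norm_neg]
      refine (norm_mul_le _ _).trans ?_
      gcongr
      · refine (norm_mul_le _ _).trans ?_
        gcongr
        exact hE p
      · exact hB t ht
    -- The resolvent identity bounds the unknown norm by `B` plus half of itself, and the half is
    -- absorbed.
    have h2 : ‖resolvent (A p) (γ t)‖ ≤ B + ‖resolvent (A p) (γ t)‖ * (1 / 2) := by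
      have h3 := norm_le_norm_add_norm_sub (resolvent (A m) (γ t)) (resolvent (A p) (γ t))
      rw [norm_sub_rev] at h3
      have h4 := hB t ht
      have h5 := mul_le_mul_of_nonneg_left hp (norm_nonneg (resolvent (A p) (γ t)))
      linarith
    have h3 : ‖resolvent (A p) (γ t)‖ ≤ 2 * B := by linarith
    refine ⟨h3, h1.trans ?_⟩
    gcongr
  have hιF : ∀ p, ‖p - m‖ * B ≤ 1 / 2 → ∀ t ∈ Set.Icc a b,
      ι ∘L F p t = resolvent (A p) (γ t) := by
    intro p hp t ht
    rw [hF, ← ContinuousLinearMap.comp_assoc, hT]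
    exact (hA p).resolvent_eq_mul h₀ (isResolventAt_resolvent (hspp p hp t ht))
  have hFc : ∀ p, ‖p - m‖ * B ≤ 1 / 2 → ContinuousOn (F p) (Set.Icc a b) := by
    intro p hp
    have h1 : ContinuousOn (fun t => resolvent (A p) (γ t)) (Set.Icc a b) :=
      (continuousOn_resolvent (isResolventAt_resolvent (hspp p hp a ⟨le_rfl, hab⟩))).comp hγc
        (hspp p hp)
    have h2 : ContinuousOn (fun t => (γ t - z₀) • (1 : X →L[ℂ] X)) (Set.Icc a b) :=
      (hγc.sub continuousOn_const).smul continuousOn_const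
    exact continuousOn_const.clm_comp
      (continuousOn_const.sub ((continuousOn_const.sub h2).mul h1))
  have hFd : ∀ p, ‖p - m‖ * B ≤ 1 / 2 → ∀ t ∈ Set.Icc a b,
      ‖F p t - F m t‖ ≤ ‖T₀‖ * (2 * B + L * (2 * B * B)) * ‖p - m‖ := by
    intro p hp t ht
    have hEm : E m = 0 := norm_le_zero_iff.1 (by simpa using hE m)
    have e : F p t - F m t = T₀ ∘L ((γ t - z₀) • (resolvent (A p) (γ t) - resolvent (A m) (γ t)) -
        E p * resolvent (A p) (γ t)) := by
      rw [hF]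
      simp only [hEm]
      rw [← ContinuousLinearMap.comp_sub]
      congr 1
      ext x
      simp [sub_smul, smul_sub]
      abel
    rw [e]
    obtain ⟨h1, h2⟩ := hRp p hp t ht
    calc _ ≤ ‖T₀‖ * ‖_‖ := ContinuousLinearMap.opNorm_comp_le _ _
      _ ≤ ‖T₀‖ * (L * (2 * B * ‖p - m‖ * B) + ‖p - m‖ * (2 * B)) := by
        gcongr
        refine (norm_sub_le _ _).trans (add_le_add ?_ ?_)
        · rw [norm_smul]
          gcongr
          exact hL t ht
        · refine (norm_mul_le _ _).trans ?_
          gcongr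
          exact hE p
      _ = _ := by ring
  -- Where `γ` is not differentiable, `deriv` has the value zero, so the Lipschitz bound holds at
  -- every interior point; the endpoints are a null set.
  have hdγ : ∀ᵐ t ∂(volume.restrict (Set.Ioc a b)), ‖deriv γ t‖ ≤ K := by
    rw [← Measure.restrict_congr_set Ioo_ae_eq_Ioc]
    filter_upwards [ae_restrict_mem measurableSet_Ioo] with t ht
    exact norm_deriv_le_of_lipschitzOn (Icc_mem_nhds ht.1 ht.2) hγ
  have hdint : IntervalIntegrable (deriv γ) volume a b := by
    rw [intervalIntegrable_iff_integrableOn_Ioc_of_le hab]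
    exact Measure.integrableOn_of_bounded (by simp) (measurable_deriv γ).aestronglyMeasurable hdγ
  have hint : ∀ p, ‖p - m‖ * B ≤ 1 / 2 →
      IntervalIntegrable (fun t => deriv γ t • F p t) volume a b := fun p hp =>
    hdint.smul_continuousOn (by rw [Set.uIcc_of_le hab]; exact hFc p hp)
  refine ⟨fun p => (2 * (Real.pi : ℂ) * Complex.I)⁻¹ • ∫ t in a..b, deriv γ t • F p t, ?_, ?_⟩
  · filter_upwards [hnear] with p hp
    refine ⟨hspp p hp, ?_⟩
    have h1 := (ContinuousLinearMap.compL ℂ X Y X ι).intervalIntegral_comp_comm (hint p hp)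
    rw [spectralProjection, ContinuousLinearMap.comp_smul]
    congr 1
    refine h1.symm.trans (intervalIntegral.integral_congr fun t ht => ?_)
    rw [Set.uIcc_of_le hab] at ht
    change ι ∘L (deriv γ t • F p t) = _
    rw [ContinuousLinearMap.comp_smul, hιF p hp t ht]
  · refine (tendsto_iff_norm_sub_tendsto_zero).2 ?_
    set C := ‖(2 * (Real.pi : ℂ) * Complex.I)⁻¹‖ *
      (K * (‖T₀‖ * (2 * B + L * (2 * B * B))) * |b - a|) with hC
    have hlim : Tendsto (fun p => C * ‖p - m‖) (𝓝 m) (𝓝 (C * ‖m - m‖)) := by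
      apply Continuous.tendsto; fun_prop
    rw [sub_self, norm_zero, mul_zero] at hlim
    refine squeeze_zero' (Eventually.of_forall fun p => norm_nonneg (_ : X →L[ℂ] Y)) ?_ hlim
    filter_upwards [hnear] with p hp
    have hm : ‖m - m‖ * B ≤ 1 / 2 := by simp
    rw [← smul_sub, norm_smul, ← intervalIntegral.integral_sub (hint p hp) (hint m hm), hC,
      mul_assoc ‖(2 * (Real.pi : ℂ) * Complex.I)⁻¹‖]
    refine mul_le_mul_of_nonneg_left ?_ (norm_nonneg _)
    refine (intervalIntegral.norm_integral_le_of_norm_le_const_ae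
      (C := K * (‖T₀‖ * (2 * B + L * (2 * B * B)) * ‖p - m‖)) ?_).trans (le_of_eq (by ring))
    rw [Set.uIoc_of_le hab]
    filter_upwards [(ae_restrict_iff' measurableSet_Ioc).1 hdγ] with t ht htab
    rw [← smul_sub, norm_smul]
    exact mul_le_mul (ht htab) (hFd p hp t (Set.Ioc_subset_Icc_self htab)) (norm_nonneg _)
      (NNReal.coe_nonneg K)

end Continuity

end UnboundedOperator

/-! ### Criteria for compactness and for bounded invertibility -/

/-- An operator that is, up to arbitrarily small errors, dominated by compact operators is
compact. -/
theorem isCompactOperator_of_norm_le_add {X Y : Type*} [NormedAddCommGroup X] [NormedSpace ℂ X]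
    [NormedAddCommGroup Y] [NormedSpace ℂ Y] [CompleteSpace Y] {T : X →L[ℂ] Y}
    (h : ∀ ε : ℝ, 0 < ε → ∃ (F : Type) (_ : NormedAddCommGroup F) (_ : NormedSpace ℂ F)
      (Φ : X →L[ℂ] F), IsCompactOperator Φ ∧ ∀ x, ‖T x‖ ≤ ε * ‖x‖ + ‖Φ x‖) :
    IsCompactOperator T := by
  refine (isCompactOperator_iff_isCompact_closure_image_closedBall (T : X →ₗ[ℂ] Y)
    one_pos).2 ?_
  refine (TotallyBounded.closure ?_).isCompact_of_isClosed isClosed_closure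
  rw [Metric.totallyBounded_iff]
  intro ε hε
  -- Points of the unit ball differ by at most `2`, so an `ε / 4`-net for `Φ` gives `‖T (x - y)‖ <
  -- (ε / 4) * 2 + ε / 4 < ε`.
  obtain ⟨F, _, _, Φ, hΦ, hle⟩ := h (ε / 4) (by positivity)
  have htb : TotallyBounded (Φ '' Metric.closedBall 0 1) :=
    (hΦ.isCompact_closure_image_closedBall (f := (Φ : X →ₗ[ℂ] F)) 1).totallyBounded.subset
      subset_closure
  obtain ⟨t, hts, htf, hcov⟩ := Metric.finite_approx_of_totallyBounded htb (ε / 4) (by positivity)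
  obtain ⟨s, hs, hsf, rfl⟩ := Set.exists_subset_image_finite_and.1
    ⟨t, hts, htf, (rfl : t = t)⟩
  refine ⟨T '' s, hsf.image T, ?_⟩
  rintro _ ⟨x, hx, rfl⟩
  have h1 := hcov ⟨x, hx, rfl⟩
  simp only [Set.mem_image, Set.mem_iUnion] at h1
  obtain ⟨_, ⟨y, hy, rfl⟩, hxy⟩ := h1
  simp only [Set.mem_iUnion]
  refine ⟨T y, ⟨y, hy, rfl⟩, ?_⟩
  rw [Metric.mem_ball, dist_eq_norm, ← map_sub] at hxy
  rw [Metric.mem_ball, dist_eq_norm]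
  change ‖T x - T y‖ < ε
  rw [← map_sub]
  have hy1 := hs hy
  rw [mem_closedBall_zero_iff] at hx hy1
  have h2 : ‖x - y‖ ≤ 2 := (norm_sub_le _ _).trans (by linarith)
  have h3 := hle (x - y)
  nlinarith

/-- An operator is compact if it has a formal adjoint that is compact. -/
theorem IsCompactOperator.of_formal_adjoint {H₁ H₂ : Type} [NormedAddCommGroup H₁]
    [InnerProductSpace ℂ H₁] [NormedAddCommGroup H₂] [InnerProductSpace ℂ H₂] [CompleteSpace H₂]
    {T : H₁ →L[ℂ] H₂} {S : H₂ →L[ℂ] H₁} (hS : IsCompactOperator S)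
    (h : ∀ x y, ⟪T x, y⟫_ℂ = ⟪x, S y⟫_ℂ) : IsCompactOperator T := by
  -- From `‖T x‖² = ⟪x, S T x⟫ ≤ (ε ‖x‖) (ε⁻¹ ‖S T x‖)`, the norm of `T x` is at most the sum of the
  -- two factors, and `ε⁻¹ • S T` is compact.
  refine isCompactOperator_of_norm_le_add fun ε hε => ⟨H₁, inferInstance, inferInstance,
    ((ε⁻¹ : ℝ) : ℂ) • (S ∘L T), (hS.comp_clm T).smul _, fun x => ?_⟩
  rw [smul_apply, norm_smul, Complex.norm_real, Real.norm_eq_abs, abs_of_pos (inv_pos.2 hε)]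
  change ‖T x‖ ≤ ε * ‖x‖ + ε⁻¹ * ‖S (T x)‖
  have h1 : ‖T x‖ ^ 2 ≤ ‖x‖ * ‖S (T x)‖ := by
    have h2 := norm_inner_le_norm (𝕜 := ℂ) x (S (T x))
    rw [← h x, inner_self_eq_norm_sq_to_K] at h2
    simpa using h2
  have h3 : 0 ≤ ε * ‖x‖ := by positivity
  have h4 : 0 ≤ ε⁻¹ * ‖S (T x)‖ := by positivity
  have h5 : ‖T x‖ ^ 2 ≤ (ε * ‖x‖) * (ε⁻¹ * ‖S (T x)‖) := by
    have : (ε * ‖x‖) * (ε⁻¹ * ‖S (T x)‖) = ‖x‖ * ‖S (T x)‖ := by field_simp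
    rwa [this]
  nlinarith [norm_nonneg (T x)]

namespace UnboundedOperator

/-- A closed operator on a Hilbert space that is bounded below and has dense range has a bounded
inverse. -/
theorem exists_isResolventAt_of_norm_le {X : Type*} [NormedAddCommGroup X] [InnerProductSpace ℂ X]
    [CompleteSpace X] {A : X →ₗ.[ℂ] X} {z : ℂ} {C : ℝ} (hcl : IsClosed (A.graph : Set (X × X)))
    (hbd : ∀ x y, (x, y) ∈ A.graph → ‖x‖ ≤ C * ‖y - z • x‖)
    (hdense : ∀ w, (∀ x y, (x, y) ∈ A.graph → ⟪w, y - z • x⟫_ℂ = 0) → w = 0) :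
    ∃ R, IsResolventAt A z R := by
  set f : A.domain →ₗ[ℂ] X := A.toFun - z • A.domain.subtype with hf
  have hfx : ∀ x : A.domain, f x = A x - z • (x : X) := fun x => rfl
  have hbf : ∀ x : A.domain, ‖(x : X)‖ ≤ C * ‖f x‖ := fun x => hbd _ _ (A.mem_graph x)
  have hinj : Function.Injective f := by
    refine (injective_iff_map_eq_zero f).2 fun x hx => ?_
    have := hbf x
    rw [hx, norm_zero, mul_zero] at this
    exact Subtype.ext (norm_le_zero_iff.1 this)
  -- The lower bound makes preimages of a convergent sequence Cauchy, and the closed graph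
  -- identifies their limit as a preimage. The sign of `C` is not known, hence `|C| + 1` below.
  have hclosed : IsClosed (LinearMap.range f : Set X) := by
    refine isClosed_of_closure_subset fun y hy => ?_
    obtain ⟨u, hu, hlim⟩ := mem_closure_iff_seq_limit.1 hy
    choose x hx using hu
    have hcau : CauchySeq fun k => (x k : X) := by
      have hc := hlim.cauchySeq
      rw [Metric.cauchySeq_iff] at hc ⊢
      intro ε hε
      obtain ⟨N, hN⟩ := hc (ε / (|C| + 1)) (by positivity)
      refine ⟨N, fun a ha b hb => ?_⟩
      have h1 := hN a ha b hb
      have h2 := hbf (x a - x b)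
      rw [dist_eq_norm] at h1 ⊢
      rw [map_sub, hx, hx] at h2
      rw [lt_div_iff₀ (by positivity)] at h1
      have h3 : C * ‖u a - u b‖ ≤ |C| * ‖u a - u b‖ :=
        mul_le_mul_of_nonneg_right (le_abs_self C) (norm_nonneg _)
      have h4 : ‖(x a : X) - x b‖ ≤ C * ‖u a - u b‖ := h2
      nlinarith [norm_nonneg (u a - u b)]
    obtain ⟨x₀, hx₀⟩ := cauchySeq_tendsto_of_complete hcau
    have h1 : Tendsto (fun k => ((x k : X), u k + z • (x k : X))) atTop
        (𝓝 (x₀, y + z • x₀)) := hx₀.prodMk_nhds (hlim.add (hx₀.const_smul z))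
    have h2 : (x₀, y + z • x₀) ∈ A.graph := hcl.mem_of_tendsto h1 (Eventually.of_forall fun k => by
      have : u k + z • (x k : X) = A (x k) := by rw [← hx k, hfx, sub_add_cancel]
      rw [this]
      exact A.mem_graph (x k))
    obtain ⟨x', hx', hAx'⟩ := (LinearPMap.mem_graph_iff A).1 h2
    refine ⟨x', ?_⟩
    simp only at hx' hAx'
    rw [hfx, hAx', hx', add_sub_cancel_right]
  have htop : LinearMap.range f = ⊤ := by
    have : CompleteSpace (LinearMap.range f) := hclosed.completeSpace_coe
    rw [← Submodule.orthogonal_eq_bot_iff, eq_bot_iff]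
    intro w hw
    refine hdense w fun x y hxy => ?_
    obtain ⟨x, rfl, rfl⟩ := (LinearPMap.mem_graph_iff A).1 hxy
    exact (Submodule.mem_orthogonal' _ _).1 hw _ ⟨x, rfl⟩
  set e := LinearEquiv.ofBijective f ⟨hinj, LinearMap.range_eq_top.1 htop⟩ with he
  have hfe : ∀ y, f (e.symm y) = y := fun y => e.apply_symm_apply y
  refine ⟨(A.domain.subtype ∘ₗ (e.symm : X →ₗ[ℂ] A.domain)).mkContinuous C fun y => ?_, ?_, ?_⟩
  · have := hbf (e.symm y)
    rwa [hfe] at this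
  · exact fun y => ⟨(e.symm y).2, hfe y⟩
  · intro x
    exact congrArg Subtype.val (e.symm_apply_apply x)

end UnboundedOperator

namespace SchwartzMap

open scoped LineDeriv SchwartzMap

variable {E : Type*} [NormedAddCommGroup E] [InnerProductSpace ℝ E] [FiniteDimensional ℝ E]
  [MeasurableSpace E] [BorelSpace E]

/-! ### Energy estimates for Schwartz functions -/

theorem inner_lineDerivOp_right (f g : 𝓢(E, ℂ)) (v : E) :
    ⟪f.toLp 2, (∂_{v} g).toLp 2⟫_ℂ = -⟪(∂_{v} f).toLp 2, g.toLp 2⟫_ℂ := by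
  have h := integral_bilinear_lineDerivOp_right_eq_neg_left (μ := volume) f g
    ((ContinuousLinearMap.mul ℝ ℂ).comp (Complex.conjCLE : ℂ →L[ℝ] ℂ)) v
  rw [inner_toL2_toL2_eq f _ volume, inner_toL2_toL2_eq _ g volume]
  simpa [RCLike.inner_apply, mul_comm] using h

theorem inner_laplacian_right (f : 𝓢(E, ℂ)) :
    ⟪f.toLp 2, (Δ f).toLp 2⟫_ℂ =
      -((∑ i, ‖(∂_{stdOrthonormalBasis ℝ E i} f).toLp 2‖ ^ 2 : ℝ) : ℂ) := by
  have h1 : (Δ f).toLp 2 = ∑ i, (∂_{stdOrthonormalBasis ℝ E i}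
      (∂_{stdOrthonormalBasis ℝ E i} f)).toLp 2 (volume : Measure E) := by
    rw [laplacian_eq_sum (stdOrthonormalBasis ℝ E)]
    exact map_sum (toLpCLM ℂ ℂ 2 (volume : Measure E)) _ _
  rw [h1, inner_sum, Complex.ofReal_sum, ← Finset.sum_neg_distrib]
  refine Finset.sum_congr rfl fun i _ => ?_
  rw [inner_lineDerivOp_right, inner_self_eq_norm_sq_to_K]
  simp

/-- This is the equation paired with `f`, real parts taken: the Laplacian contributes the Dirichlet
energy with a favourable sign. -/
theorem norm_sq_add_le {l : ℝ} {f h : 𝓢(E, ℂ)} (hfh : (l : ℂ) • f - Δ f = h) :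
    l * ‖f.toLp 2‖ ^ 2 + ∑ i, ‖(∂_{stdOrthonormalBasis ℝ E i} f).toLp 2‖ ^ 2 ≤
      ‖f.toLp 2‖ * ‖h.toLp 2‖ := by
  have h1 : h.toLp 2 (volume : Measure E) = (l : ℂ) • f.toLp 2 volume - (Δ f).toLp 2 volume := by
    rw [← hfh]
    exact (map_sub (toLpCLM ℂ ℂ 2 (volume : Measure E)) _ _).trans
      (by rw [map_smul]; rfl)
  have h2 : (⟪f.toLp 2, h.toLp 2⟫_ℂ).re =
      l * ‖f.toLp 2‖ ^ 2 + ∑ i, ‖(∂_{stdOrthonormalBasis ℝ E i} f).toLp 2‖ ^ 2 := by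
    rw [h1, inner_sub_right, inner_smul_right, inner_laplacian_right, inner_self_eq_norm_sq_to_K,
      sub_neg_eq_add, Complex.add_re, Complex.ofReal_re, Complex.re_ofReal_mul]
    congr 2
    norm_cast
  rw [← h2]
  exact (Complex.re_le_norm _).trans (norm_inner_le_norm _ _)

theorem norm_le_of_sub_laplacian {l : ℝ} (hl : 0 < l) {f h : 𝓢(E, ℂ)}
    (hfh : (l : ℂ) • f - Δ f = h) : ‖f.toLp 2‖ ≤ ‖h.toLp 2‖ / l := by
  have h1 := norm_sq_add_le hfh
  have h2 : 0 ≤ ∑ i, ‖(∂_{stdOrthonormalBasis ℝ E i} f).toLp 2‖ ^ 2 :=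
    Finset.sum_nonneg fun i _ => sq_nonneg _
  rw [le_div_iff₀ hl]
  by_contra! hlt
  have h3 : 0 ≤ ‖h.toLp 2‖ := norm_nonneg _
  have h4 : 0 ≤ ‖f.toLp 2‖ := norm_nonneg _
  have h5 : 0 < ‖f.toLp 2‖ := by
    rcases h4.eq_or_lt with h | h
    · rw [← h, zero_mul] at hlt; linarith
    · exact h
  nlinarith

/-- The energy is at most `‖f‖ ‖h‖ ≤ ‖h‖² / l`. The gain `l^{-1/2}` for first derivatives is what
makes the commutator with a cutoff small in the interior estimate. -/
theorem norm_lineDerivOp_le_of_sub_laplacian {l : ℝ} (hl : 0 < l) {f h : 𝓢(E, ℂ)}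
    (hfh : (l : ℂ) • f - Δ f = h) (i : Fin (Module.finrank ℝ E)) :
    ‖(∂_{stdOrthonormalBasis ℝ E i} f).toLp 2‖ ≤ ‖h.toLp 2‖ / √l := by
  have h1 := norm_sq_add_le hfh
  have h2 := norm_le_of_sub_laplacian hl hfh
  have h3 := Finset.single_le_sum (f := fun i => ‖(∂_{stdOrthonormalBasis ℝ E i} f).toLp 2‖ ^ 2)
    (fun i _ => sq_nonneg _) (Finset.mem_univ i)
  have h4 : 0 ≤ ‖h.toLp 2‖ := norm_nonneg _
  refine le_of_sq_le_sq ?_ (by positivity)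
  rw [div_pow, Real.sq_sqrt hl.le]
  calc _ ≤ _ := h3
    _ ≤ ‖f.toLp 2‖ * ‖h.toLp 2‖ := by nlinarith [sq_nonneg ‖f.toLp 2‖]
    _ ≤ ‖h.toLp 2‖ / l * ‖h.toLp 2‖ := by gcongr
    _ = _ := by ring

/-- The solution is the Fourier multiplier with symbol `1 / (l + 4π² ‖ξ‖²)`, which is smooth of
temperate growth because `l > 0`. Schwartz functions are used since compact support would be lost.
-/
theorem exists_sub_laplacian_eq {l : ℝ} (hl : 0 < l) (h : 𝓢(E, ℂ)) :
    ∃ f : 𝓢(E, ℂ), (l : ℂ) • f - Δ f = h := by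
  -- With `s = 2π / √l` the symbol becomes `l⁻¹ (1 + ‖s ξ‖²)⁻¹`, a dilation of a standard function
  -- of temperate growth.
  set s : ℝ := 2 * Real.pi / √l with hs
  set g : E → ℂ := fun x => ((l⁻¹ * (1 + ‖s • x‖ ^ 2) ^ (-1 : ℝ) : ℝ) : ℂ) with hg
  have hgT : g.HasTemperateGrowth := by
    have h1 : (fun x : E => (1 + ‖x‖ ^ 2) ^ (-1 : ℝ)).HasTemperateGrowth := by fun_prop
    have h2 : (fun x : E => (1 + ‖s • x‖ ^ 2) ^ (-1 : ℝ)).HasTemperateGrowth :=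
      h1.comp (g := fun x : E => (1 + ‖x‖ ^ 2) ^ (-1 : ℝ))
        (s • ContinuousLinearMap.id ℝ E).hasTemperateGrowth
    rw [hg]
    fun_prop
  have hnT : (fun x : E => ((‖x‖ ^ 2 : ℝ) : ℂ)).HasTemperateGrowth := by fun_prop
  refine ⟨fourierMultiplierCLM ℂ g h, ?_⟩
  rw [laplacian_eq_fourierMultiplierCLM]
  have e1 : fourierMultiplierCLM ℂ (fun x : E => ‖x‖ ^ 2) (fourierMultiplierCLM ℂ g h) =
      fourierMultiplierCLM ℂ ((fun x : E => ((‖x‖ ^ 2 : ℝ) : ℂ)) * g) h := by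
    rw [← fourierMultiplierCLM_fourierMultiplierCLM_apply hnT hgT]
    exact (fourierMultiplierCLM_ofReal ℂ (g := fun x : E => ‖x‖ ^ 2) (by fun_prop) _).symm
  have e2 : fourierMultiplierCLM ℂ (fun _ : E => (1 : ℂ)) h = h := by simp
  change (l : ℂ) • _ - -(2 * Real.pi) ^ 2 • fourierMultiplierCLM ℂ (fun x : E => ‖x‖ ^ 2) _ = h
  rw [e1]
  conv_rhs => rw [← e2]
  have e3 : (fun _ : E => (1 : ℂ)) = ((l : ℂ) • g) +
      ((((2 * Real.pi) ^ 2 : ℝ) : ℂ) • ((fun x : E => ((‖x‖ ^ 2 : ℝ) : ℂ)) * g)) := by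
    funext x
    simp only [hg, Pi.add_apply, Pi.smul_apply, Pi.mul_apply, smul_eq_mul]
    rw [← Complex.ofReal_mul, ← Complex.ofReal_mul, ← Complex.ofReal_mul, ← Complex.ofReal_add,
      norm_smul, hs, Real.rpow_neg_one, mul_pow, Real.norm_eq_abs, sq_abs, div_pow,
      Real.sq_sqrt hl.le]
    have hpos : 0 < 1 + (2 * Real.pi) ^ 2 / l * ‖x‖ ^ 2 := by positivity
    rw [← Complex.ofReal_one]
    congr 1
    field_simp
  have hadd : ∀ {a b : E → ℂ}, a.HasTemperateGrowth → b.HasTemperateGrowth →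
      fourierMultiplierCLM ℂ (a + b) h =
        fourierMultiplierCLM ℂ a h + fourierMultiplierCLM ℂ b h := by
    intro a b ha hb
    simp [fourierMultiplierCLM_apply, smulLeftCLM_add ha hb, FourierTransform.fourierInv_add]
  have hT1 : ((l : ℂ) • g).HasTemperateGrowth := (Function.HasTemperateGrowth.const (l : ℂ)).mul hgT
  have hT2 : ((fun x : E => ((‖x‖ ^ 2 : ℝ) : ℂ)) * g).HasTemperateGrowth := hnT.mul hgT
  have hT3 : ((((2 * Real.pi) ^ 2 : ℝ) : ℂ) •
      ((fun x : E => ((‖x‖ ^ 2 : ℝ) : ℂ)) * g)).HasTemperateGrowth :=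
    (Function.HasTemperateGrowth.const (((2 * Real.pi) ^ 2 : ℝ) : ℂ)).mul hT2
  rw [e3, hadd hT1 hT3, fourierMultiplierCLM_smul hgT, fourierMultiplierCLM_smul hT2]
  ext x
  simp

end SchwartzMap

namespace Transmission

open scoped SchwartzMap LineDeriv ComplexConjugate

variable {n : ℕ} {D : Opens (EuclideanSpace ℝ (Fin n))}

/-! ### Test functions -/

/-- The complex conjugate of a test function. -/
def conjTest (φ : 𝓓(D, ℂ)) : 𝓓(D, ℂ) :=
  ⟨fun x => conj (φ x), Complex.conjCLE.contDiff.comp φ.contDiff,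
    φ.hasCompactSupport.comp_left (g := fun z : ℂ => conj z) (by simp),
    (tsupport_comp_subset (g := fun z : ℂ => conj z) (by simp) φ).trans φ.tsupport_subset⟩

theorem conjTest_apply (φ : 𝓓(D, ℂ)) (x : EuclideanSpace ℝ (Fin n)) :
    conjTest φ x = conj (φ x) := rfl

theorem conjTest_conjTest (φ : 𝓓(D, ℂ)) : conjTest (conjTest φ) = φ := by
  ext x; simp [conjTest_apply]

theorem laplacian_conjTest (φ : 𝓓(D, ℂ)) (x : EuclideanSpace ℝ (Fin n)) :
    Δ (⇑(conjTest φ)) x = conj (Δ (⇑φ) x) :=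
  (contDiff_infty.1 φ.contDiff 2).contDiffAt.laplacian_CLM_comp_left (x := x)
    (l := (Complex.conjCLE : ℂ →L[ℝ] ℂ))

/-- A test function as a Schwartz function. -/
def testSchwartz (φ : 𝓓(D, ℂ)) : 𝓢(EuclideanSpace ℝ (Fin n), ℂ) :=
  φ.hasCompactSupport.toSchwartzMap φ.contDiff

theorem testSchwartz_apply (φ : 𝓓(D, ℂ)) (x : EuclideanSpace ℝ (Fin n)) :
    testSchwartz φ x = φ x := rfl

theorem laplacian_testSchwartz_apply (φ : 𝓓(D, ℂ)) (x : EuclideanSpace ℝ (Fin n)) :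
    Δ (testSchwartz φ) x = Δ (⇑φ) x :=
  SchwartzMap.laplacian_apply _ x

theorem laplacian_eq_zero_of_notMem (φ : 𝓓(D, ℂ)) {x : EuclideanSpace ℝ (Fin n)} (hx : x ∉ D) :
    Δ (⇑φ) x = 0 := by
  have h0 : (φ : EuclideanSpace ℝ (Fin n) → ℂ) =ᶠ[𝓝 x] fun _ => (0 : ℂ) :=
    notMem_tsupport_iff_eventuallyEq.mp fun h => hx (φ.tsupport_subset h)
  rw [InnerProductSpace.laplacian_congr_nhds h0 |>.eq_of_nhds]
  simp

theorem eq_zero_of_notMem (φ : 𝓓(D, ℂ)) {x : EuclideanSpace ℝ (Fin n)} (hx : x ∉ D) :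
    φ x = 0 :=
  image_eq_zero_of_notMem_tsupport fun h => hx (φ.tsupport_subset h)

/-- The pair `(φ, Δ φ)`. -/
def testPair (φ : 𝓓(D, ℂ)) : L2Sum D :=
  WithLp.toLp 2 ((memLp_test φ).toLp, (memLp_laplacian_test φ).toLp)

theorem testPair_mem (φ : 𝓓(D, ℂ)) : testPair φ ∈ H20 D :=
  (testGraph D).le_topologicalClosure
    ⟨φ, (memLp_test φ).coeFn_toLp, (memLp_laplacian_test φ).coeFn_toLp⟩

/-- A closed condition that holds for test functions holds on `H²₀(D)`. -/
theorem H20_induction {p : L2Sum D → Prop} (hcl : IsClosed {x | p x})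
    (h : ∀ φ : 𝓓(D, ℂ), p (testPair φ)) {x : L2Sum D} (hx : x ∈ H20 D) : p x := by
  refine closure_minimal (s := (testGraph D : Set (L2Sum D))) ?_ hcl hx
  rintro y ⟨φ, h1, h2⟩
  have : y = testPair φ := by
    have e1 : y.fst = (testPair φ).fst := Lp.ext (h1.trans (memLp_test φ).coeFn_toLp.symm)
    have e2 : y.snd = (testPair φ).snd :=
      Lp.ext (h2.trans (memLp_laplacian_test φ).coeFn_toLp.symm)
    exact WithLp.ofLp_injective 2 (Prod.ext e1 e2)
  rw [this]
  exact h φ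

theorem inner_eq_integral (f g : L2 D) : ⟪f, g⟫_ℂ = ∫ x, g x * conj (f x) ∂(volOn D) := by
  rw [L2.inner_def]
  rfl

theorem inner_testPair_fst (φ : 𝓓(D, ℂ)) (w : L2 D) :
    ⟪(testPair φ).fst, w⟫_ℂ = ∫ x, w x * conjTest φ x ∂(volOn D) := by
  rw [inner_eq_integral]
  refine integral_congr_ae ?_
  filter_upwards [(memLp_test φ).coeFn_toLp] with x hx
  rw [show (testPair φ).fst x = φ x from hx, conjTest_apply]

theorem inner_testPair_snd (φ : 𝓓(D, ℂ)) (v : L2 D) :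
    ⟪(testPair φ).snd, v⟫_ℂ = ∫ x, v x * Δ (⇑(conjTest φ)) x ∂(volOn D) := by
  rw [inner_eq_integral]
  refine integral_congr_ae ?_
  filter_upwards [(memLp_laplacian_test φ).coeFn_toLp] with x hx
  rw [show (testPair φ).snd x = Δ (⇑φ) x from hx, laplacian_conjTest]

theorem continuous_fst : Continuous fun x : L2Sum D => x.fst :=
  (WithLp.fstL 2 ℂ (L2 D) (L2 D)).continuous

theorem continuous_snd : Continuous fun x : L2Sum D => x.snd :=
  (WithLp.sndL 2 ℂ (L2 D) (L2 D)).continuous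

/-- The distributional Laplacian is the adjoint of `Δ₀₀`. -/
theorem isWeakLaplacian_iff_inner {v w : L2 D} :
    IsWeakLaplacian v w ↔ ∀ x ∈ H20 D, ⟪x.snd, v⟫_ℂ = ⟪x.fst, w⟫_ℂ := by
  constructor
  · intro h x hx
    refine H20_induction (p := fun x => ⟪x.snd, v⟫_ℂ = ⟪x.fst, w⟫_ℂ) ?_ (fun φ => ?_) hx
    · exact isClosed_eq (continuous_snd.inner continuous_const)
        (continuous_fst.inner continuous_const)
    · rw [inner_testPair_fst, inner_testPair_snd, h]
  · intro h φ
    have := h _ (testPair_mem (conjTest φ))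
    rwa [inner_testPair_fst, inner_testPair_snd, conjTest_conjTest] at this

/-- `Δ₀₀` is the adjoint of the distributional Laplacian. -/
theorem mem_H20_iff_inner {x : L2Sum D} :
    x ∈ H20 D ↔ ∀ v w, IsWeakLaplacian v w → ⟪x.snd, v⟫_ℂ = ⟪x.fst, w⟫_ℂ := by
  refine ⟨fun hx v w h => isWeakLaplacian_iff_inner.1 h x hx, fun h => ?_⟩
  have hcl : IsClosed (H20 D : Set (L2Sum D)) := (testGraph D).isClosed_topologicalClosure
  have : CompleteSpace (H20 D) := hcl.completeSpace_coe
  rw [← Submodule.orthogonal_orthogonal (H20 D), Submodule.mem_orthogonal']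
  intro y hy
  rw [Submodule.mem_orthogonal] at hy
  -- Orthogonality of `y` to the graph of `Δ₀₀` says exactly that `Δ y₂ = -y₁` in the sense of
  -- distributions, so the hypothesis applies to this pair and shows that `x` is in the double
  -- orthogonal complement.
  have hw : IsWeakLaplacian y.snd (-y.fst) := by
    refine isWeakLaplacian_iff_inner.2 fun u hu => ?_
    have h1 := hy u hu
    rw [WithLp.prod_inner_apply] at h1
    rw [inner_neg_right]
    exact eq_neg_of_add_eq_zero_right h1
  have h2 := h _ _ hw
  rw [WithLp.prod_inner_apply]
  change ⟪x.fst, y.fst⟫_ℂ + ⟪x.snd, y.snd⟫_ℂ = 0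
  rw [h2, inner_neg_right, add_neg_cancel]

theorem setIntegral_eq_integral_test {f : EuclideanSpace ℝ (Fin n) → ℂ}
    (hf : ∀ x, x ∉ D → f x = 0) : ∫ x, f x ∂(volOn D) = ∫ x, f x :=
  setIntegral_eq_integral_of_forall_compl_eq_zero fun x hx => hf x hx

/-- On test functions the pairing is minus the Dirichlet energy; the sign survives closure. -/
theorem re_inner_H20_nonpos {x : L2Sum D} (hx : x ∈ H20 D) : (⟪x.fst, x.snd⟫_ℂ).re ≤ 0 := by
  refine H20_induction (p := fun x => (⟪x.fst, x.snd⟫_ℂ).re ≤ 0) ?_ (fun φ => ?_) hx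
  · exact isClosed_le (Complex.continuous_re.comp (continuous_fst.inner continuous_snd))
      continuous_const
  · have h1 : ⟪(testPair φ).fst, (testPair φ).snd⟫_ℂ =
        ⟪(testSchwartz φ).toLp 2 volume, (Δ (testSchwartz φ)).toLp 2 volume⟫_ℂ := by
      rw [SchwartzMap.inner_toL2_toL2_eq _ _ volume, inner_testPair_fst]
      have h2 : ∫ x, (testPair φ).snd x * conjTest φ x ∂(volOn D) =
          ∫ x, Δ (⇑φ) x * conjTest φ x ∂(volOn D) := by
        refine integral_congr_ae ?_
        filter_upwards [(memLp_laplacian_test φ).coeFn_toLp] with x hx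
        rw [show (testPair φ).snd x = Δ (⇑φ) x from hx]
      rw [h2, setIntegral_eq_integral_test fun x hx => by
        rw [laplacian_eq_zero_of_notMem φ hx, zero_mul]]
      refine integral_congr_ae (Eventually.of_forall fun x => ?_)
      simp only [RCLike.inner_apply, laplacian_testSchwartz_apply]
      rfl
    rw [h1, SchwartzMap.inner_laplacian_right, Complex.neg_re, Complex.ofReal_re, neg_nonpos]
    exact Finset.sum_nonneg fun i _ => sq_nonneg _

theorem norm_fst_le_of_mem_H20 {x : L2Sum D} (hx : x ∈ H20 D) (l : ℝ) :
    l * ‖x.fst‖ ≤ ‖x.snd - (l : ℂ) • x.fst‖ := by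
  have h1 : l * ‖x.fst‖ ^ 2 ≤ (⟪x.fst, (l : ℂ) • x.fst - x.snd⟫_ℂ).re := by
    rw [inner_sub_right, inner_smul_right, inner_self_eq_norm_sq_to_K, Complex.sub_re,
      Complex.re_ofReal_mul]
    have h2 := re_inner_H20_nonpos hx
    have h3 : (((‖x.fst‖ : ℝ) : ℂ) ^ 2).re = ‖x.fst‖ ^ 2 := by norm_cast
    have h4 : l * (((‖x.fst‖ : ℝ) : ℂ) ^ 2).re = l * ‖x.fst‖ ^ 2 := by rw [h3]
    exact h4.symm.le.trans (le_sub_self_iff _ |>.2 h2)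
  have h2 := (Complex.re_le_norm _).trans (norm_inner_le_norm (𝕜 := ℂ) x.fst
    ((l : ℂ) • x.fst - x.snd))
  rw [norm_sub_rev] at h2
  have h3 := h1.trans h2
  rcases (norm_nonneg x.fst).eq_or_lt with h0 | h0
  · rw [← h0, mul_zero]; positivity
  · rw [sq, ← mul_assoc, mul_comm ‖x.fst‖ ‖_‖] at h3
    exact le_of_mul_le_mul_right h3 h0

/-! ### The multiplication operator -/

/-- Multiplication by `m ∈ L^∞(D)` on `L²(D)`. -/
def mulOp (m : LInf D) : L2 D →L[ℂ] L2 D :=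
  LinearMap.mkContinuous
    { toFun := fun v => (m • v : L2 D)
      map_add' := fun v w => Lp.add_smul m v w
      map_smul' := fun c v => (Lp.smul_comm c m v).symm } ‖m‖ fun v => Lp.norm_smul_le m v

theorem mulOp_apply (m : LInf D) (v : L2 D) : mulOp m v = (m • v : L2 D) := rfl

theorem mulOp_sub (m p : LInf D) : mulOp (p - m) = mulOp p - mulOp m := by
  ext1 v
  change ((p - m) • v : L2 D) = (p • v : L2 D) - (m • v : L2 D)
  rw [sub_eq_add_neg, Lp.smul_add, Lp.neg_smul, sub_eq_add_neg]

theorem inner_mulOp_star (m : LInf D) (v w : L2 D) :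
    ⟪v, mulOp m w⟫_ℂ = ⟪mulOp (star m) v, w⟫_ℂ := by
  rw [inner_eq_integral, inner_eq_integral]
  refine integral_congr_ae ?_
  filter_upwards [Lp.coeFn_lpSMul (r := 2) m w, Lp.coeFn_lpSMul (r := 2) (star m) v,
    Lp.coeFn_star m] with x h1 h2 h3
  rw [mulOp_apply, mulOp_apply, h1, h2]
  simp only [Pi.smul_apply', smul_eq_mul, h3, Pi.star_apply, map_mul]
  simp
  ring

end Transmission

namespace Transmission

open scoped SchwartzMap LineDeriv ComplexConjugate

variable {n : ℕ} {D : Opens (EuclideanSpace ℝ (Fin n))}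

/-! ### Interior estimate for the distributional Laplacian -/

theorem laplacian_mul {f g : EuclideanSpace ℝ (Fin n) → ℂ} (hf : ContDiff ℝ ∞ f)
    (hg : ContDiff ℝ ∞ g) (x : EuclideanSpace ℝ (Fin n)) :
    Δ (fun y => f y * g y) x = f x * Δ g x +
      2 * ∑ i, fderiv ℝ f x (stdOrthonormalBasis ℝ (EuclideanSpace ℝ (Fin n)) i) *
        fderiv ℝ g x (stdOrthonormalBasis ℝ (EuclideanSpace ℝ (Fin n)) i) + Δ f x * g x := by
  have d {k : EuclideanSpace ℝ (Fin n) → ℂ} (hk : ContDiff ℝ ∞ k) (y) :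
      DifferentiableAt ℝ k y := hk.differentiable (by simp) y
  have h1 (e y : EuclideanSpace ℝ (Fin n)) : fderiv ℝ (fun y => f y * g y) y e =
      f y * fderiv ℝ g y e + fderiv ℝ f y e * g y := by
    rw [fderiv_fun_mul (d hf y) (d hg y)]
    simp [mul_comm]
  have h2 (e : EuclideanSpace ℝ (Fin n)) :
      fderiv ℝ (fun y => f y * fderiv ℝ g y e + fderiv ℝ f y e * g y) x e =
        f x * fderiv ℝ (fun y => fderiv ℝ g y e) x e + 2 * (fderiv ℝ f x e * fderiv ℝ g x e) +
          fderiv ℝ (fun y => fderiv ℝ f y e) x e * g x := by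
    have sf := fderiv_fderiv_smooth hf e
    have sg := fderiv_fderiv_smooth hg e
    rw [fderiv_fun_add ((d hf x).fun_mul (d sg x)) ((d sf x).fun_mul (d hg x)),
      fderiv_fun_mul (d hf x) (d sg x), fderiv_fun_mul (d sf x) (d hg x)]
    simp
    ring
  rw [laplacian_eq_sum_fderiv (hf.mul hg), laplacian_eq_sum_fderiv hf, laplacian_eq_sum_fderiv hg]
  simp only [h1, h2, Finset.sum_add_distrib, Finset.mul_sum, Finset.sum_mul]

/-- The product of a test function and a Schwartz function. -/
def testMul (χ : 𝓓(D, ℂ)) (ψ : 𝓢(EuclideanSpace ℝ (Fin n), ℂ)) : 𝓓(D, ℂ) :=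
  ⟨fun x => χ x * ψ x, χ.contDiff.mul (ψ.smooth ⊤),
    χ.hasCompactSupport.mul_right, (tsupport_mul_subset_left).trans χ.tsupport_subset⟩

theorem testMul_apply (χ : 𝓓(D, ℂ)) (ψ : 𝓢(EuclideanSpace ℝ (Fin n), ℂ))
    (x : EuclideanSpace ℝ (Fin n)) : testMul χ ψ x = χ x * ψ x := rfl

theorem laplacian_testMul (χ : 𝓓(D, ℂ)) (ψ : 𝓢(EuclideanSpace ℝ (Fin n), ℂ))
    (x : EuclideanSpace ℝ (Fin n)) :
    Δ (⇑(testMul χ ψ)) x = χ x * (Δ ψ) x +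
      2 * ∑ i, fderiv ℝ χ x (stdOrthonormalBasis ℝ (EuclideanSpace ℝ (Fin n)) i) *
        (∂_{stdOrthonormalBasis ℝ (EuclideanSpace ℝ (Fin n)) i} ψ) x + Δ (⇑χ) x * ψ x := by
  have h := laplacian_mul χ.contDiff (ψ.smooth ⊤) x
  rw [SchwartzMap.laplacian_apply]
  exact h

theorem memLp_schwartz (k : 𝓢(EuclideanSpace ℝ (Fin n), ℂ)) : MemLp k 2 (volOn D) :=
  (k.memLp 2 volume).restrict _

theorem memLp_mul_schwartz {a : EuclideanSpace ℝ (Fin n) → ℂ} (ha : Continuous a) {M : ℝ}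
    (hM : ∀ x, ‖a x‖ ≤ M) (k : 𝓢(EuclideanSpace ℝ (Fin n), ℂ)) :
    MemLp (fun x => a x * k x) 2 (volOn D) :=
  (memLp_schwartz k).of_le_mul (c := M) (ha.mul k.continuous).aestronglyMeasurable
    (Eventually.of_forall fun x => by
      rw [norm_mul]; exact mul_le_mul_of_nonneg_right (hM x) (norm_nonneg _))

theorem norm_star_L2 (v : L2 D) : ‖star v‖ = ‖v‖ := by
  have h (w : L2 D) : ‖star w‖ ≤ ‖w‖ := by
    refine Lp.norm_le_norm_of_ae_le ?_
    filter_upwards [Lp.coeFn_star w] with x hx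
    rw [hx, Pi.star_apply, norm_star]
  exact (h v).antisymm (by simpa using h (star v))

theorem norm_integral_mul_schwartz_le (v : L2 D) {a : EuclideanSpace ℝ (Fin n) → ℂ}
    (ha : Continuous a) {M : ℝ} (hM : ∀ x, ‖a x‖ ≤ M) (k : 𝓢(EuclideanSpace ℝ (Fin n), ℂ)) :
    ‖∫ x, v x * (a x * k x) ∂(volOn D)‖ ≤ M * ‖v‖ * ‖k.toLp 2 volume‖ := by
  have hM0 : 0 ≤ M := (norm_nonneg _).trans (hM 0)
  have h1 : ∫ x, v x * (a x * k x) ∂(volOn D) =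
      ⟪star ((memLp_mul_schwartz (D := D) ha hM k).toLp), v⟫_ℂ := by
    rw [inner_eq_integral]
    refine integral_congr_ae ?_
    filter_upwards [(memLp_mul_schwartz (D := D) ha hM k).coeFn_toLp,
      Lp.coeFn_star ((memLp_mul_schwartz (D := D) ha hM k).toLp)] with x h2 h3
    rw [h3, Pi.star_apply, h2]
    simp
  have h2 : ‖(memLp_schwartz (D := D) k).toLp‖ ≤ ‖k.toLp 2 volume‖ := by
    rw [Lp.norm_toLp, SchwartzMap.toLp, Lp.norm_toLp]
    exact ENNReal.toReal_mono (k.memLp 2 volume).eLpNorm_ne_top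
      (eLpNorm_mono_measure _ Measure.restrict_le_self)
  have h3 : ‖(memLp_mul_schwartz (D := D) ha hM k).toLp‖ ≤
      M * ‖(memLp_schwartz (D := D) k).toLp‖ := by
    refine Lp.norm_le_mul_norm_of_ae_le_mul ?_
    filter_upwards [(memLp_mul_schwartz (D := D) ha hM k).coeFn_toLp,
      (memLp_schwartz (D := D) k).coeFn_toLp] with x h4 h5
    rw [h4, h5, norm_mul]
    exact mul_le_mul_of_nonneg_right (hM x) (norm_nonneg _)
  rw [h1]
  refine (norm_inner_le_norm _ _).trans ?_
  rw [norm_star_L2]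
  calc _ ≤ (M * ‖k.toLp 2 volume‖) * ‖v‖ := by gcongr; exact h3.trans (by gcongr)
    _ = _ := by ring

/-- A test function as an element of `L^∞(D)`. -/
def testLInf (χ : 𝓓(D, ℂ)) : LInf D := (χ.memLp_top (μ := volOn D)).toLp

theorem coeFn_mulOp_testLInf (χ : 𝓓(D, ℂ)) (v : L2 D) :
    mulOp (testLInf χ) v =ᵐ[volOn D] fun x => χ x * v x := by
  filter_upwards [Lp.coeFn_lpSMul (r := 2) (testLInf χ) v,
    (χ.memLp_top (μ := volOn D)).coeFn_toLp] with x h1 h2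
  rw [mulOp_apply, h1, Pi.smul_apply', testLInf, h2, smul_eq_mul]

theorem memLp_indicator (v : L2 D) :
    MemLp ((D : Set (EuclideanSpace ℝ (Fin n))).indicator v) 2 volume :=
  (memLp_indicator_iff_restrict D.isOpen.measurableSet).2 (Lp.memLp v)

/-- Extension by zero from `L²(D)` to `L²(ℝⁿ)`. -/
def extendZero (v : L2 D) : Lp ℂ 2 (volume : Measure (EuclideanSpace ℝ (Fin n))) :=
  (memLp_indicator v).toLp

theorem norm_extendZero (v : L2 D) : ‖extendZero v‖ = ‖v‖ := by
  rw [extendZero, Lp.norm_toLp, eLpNorm_indicator_eq_eLpNorm_restrict D.isOpen.measurableSet,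
    Lp.norm_def]

theorem inner_extendZero (v : L2 D) (w : Lp ℂ 2 (volume : Measure (EuclideanSpace ℝ (Fin n)))) :
    ⟪extendZero v, w⟫_ℂ = ∫ x, w x * conj (v x) ∂(volOn D) := by
  rw [L2.inner_def, ← integral_indicator D.isOpen.measurableSet]
  refine integral_congr_ae ?_
  filter_upwards [(memLp_indicator v).coeFn_toLp] with x hx
  rw [extendZero, hx, RCLike.inner_apply]
  by_cases h : x ∈ (D : Set (EuclideanSpace ℝ (Fin n)))
  · simp [h]
  · simp [h]

/-- Interior estimate: if `(Δ - l) v = g` in `D` and `χ` is a test function, then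
`‖χ v‖ = O(l^{-1/2}) (‖v‖ + ‖g‖)`. -/
theorem exists_norm_mulOp_testLInf_le (χ : 𝓓(D, ℂ)) : ∃ C : ℝ, 0 ≤ C ∧ ∀ l : ℝ, 1 ≤ l →
    ∀ v g : L2 D, IsWeakLaplacian v (g + (l : ℂ) • v) →
      ‖mulOp (testLInf χ) v‖ ≤ C * (‖v‖ + ‖g‖) / √l := by
  set b := stdOrthonormalBasis ℝ (EuclideanSpace ℝ (Fin n)) with hb
  have bdd {a : EuclideanSpace ℝ (Fin n) → ℂ} (ha : Continuous a) (hc : HasCompactSupport a) :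
      ∃ M, ∀ x, ‖a x‖ ≤ M := hc.exists_bound_of_continuous ha
  have cd (i) : Continuous fun x => fderiv ℝ χ x (b i) :=
    (fderiv_fderiv_smooth χ.contDiff (b i)).continuous
  have cl : Continuous (Δ (⇑χ)) := (contDiff_laplacian χ.contDiff).continuous
  obtain ⟨M₀, hM₀⟩ := bdd χ.continuous χ.hasCompactSupport
  obtain ⟨M₂, hM₂⟩ := bdd cl (hasCompactSupport_laplacian χ.hasCompactSupport)
  choose M₁ hM₁ using fun i => bdd (cd i) (χ.hasCompactSupport.fderiv_apply (𝕜 := ℝ) (b i))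
  have hM₀0 : 0 ≤ M₀ := (norm_nonneg _).trans (hM₀ 0)
  have hM₂0 : 0 ≤ M₂ := (norm_nonneg _).trans (hM₂ 0)
  have hM₁0 (i) : 0 ≤ M₁ i := (norm_nonneg _).trans (hM₁ i 0)
  have hS : 0 ≤ ∑ i, M₁ i := Finset.sum_nonneg fun i _ => hM₁0 i
  refine ⟨M₀ + 2 * ∑ i, M₁ i + M₂, by positivity, fun l hl v g hvg => ?_⟩
  have hl0 : 0 < l := by linarith
  set c := (M₀ + 2 * ∑ i, M₁ i + M₂) * (‖v‖ + ‖g‖) / √l with hc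
  -- Duality: write `h = (l - Δ) ψ` and use `χ ψ` as a test function in the equation for `v`. The
  -- terms with second derivatives of `ψ` cancel. What remains is the commutator of `Δ` with `χ`, of
  -- first order in `ψ`, and the term with `g`.
  have key (h : 𝓢(EuclideanSpace ℝ (Fin n), ℂ)) :
      ‖∫ x, v x * (χ x * h x) ∂(volOn D)‖ ≤ c * ‖h.toLp 2 volume‖ := by
    obtain ⟨ψ, hψ⟩ := SchwartzMap.exists_sub_laplacian_eq hl0 h
    have int {w : L2 D} {a : EuclideanSpace ℝ (Fin n) → ℂ} (ha : Continuous a) {M : ℝ}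
        (hM : ∀ x, ‖a x‖ ≤ M) (k : 𝓢(EuclideanSpace ℝ (Fin n), ℂ)) :
        Integrable (fun x => w x * (a x * k x)) (volOn D) :=
      (Lp.memLp w).integrable_mul (memLp_mul_schwartz ha hM k)
    have e0 := hvg (testMul χ ψ)
    rw [integral_add_mul _ _ (memLp_test _), integral_smul_mul] at e0
    have e1 : ∫ x, v x * Δ (⇑(testMul χ ψ)) x ∂(volOn D) =
        ∫ x, v x * (χ x * (Δ ψ) x) ∂(volOn D) +
          2 * ∑ i, ∫ x, v x * (fderiv ℝ χ x (b i) * (∂_{b i} ψ) x) ∂(volOn D) +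
          ∫ x, v x * (Δ (⇑χ) x * ψ x) ∂(volOn D) := by
      rw [← integral_finsetSum _ fun i _ => int (cd i) (hM₁ i) _, ← integral_const_mul,
        ← integral_add (int χ.continuous hM₀ _)
          ((integrable_finsetSum _ fun i _ => int (cd i) (hM₁ i) _).const_mul _),
        ← integral_add (Integrable.fun_add (int χ.continuous hM₀ _)
          ((integrable_finsetSum _ fun i _ => int (cd i) (hM₁ i) _).const_mul _))
          (int cl hM₂ _)]
      refine integral_congr_ae (Eventually.of_forall fun x => ?_)
      simp only [laplacian_testMul, ← Finset.mul_sum]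
      ring
    have e2 : ∫ x, v x * (χ x * h x) ∂(volOn D) =
        l * ∫ x, v x * (χ x * ψ x) ∂(volOn D) - ∫ x, v x * (χ x * (Δ ψ) x) ∂(volOn D) := by
      rw [← integral_const_mul, ← integral_sub ((int χ.continuous hM₀ _).const_mul _)
        (int χ.continuous hM₀ _)]
      refine integral_congr_ae (Eventually.of_forall fun x => ?_)
      simp only [← hψ, sub_apply, smul_apply, smul_eq_mul]
      ring
    have e3 : ∫ x, v x * (χ x * h x) ∂(volOn D) =
        2 * ∑ i, ∫ x, v x * (fderiv ℝ χ x (b i) * (∂_{b i} ψ) x) ∂(volOn D) +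
          ∫ x, v x * (Δ (⇑χ) x * ψ x) ∂(volOn D) - ∫ x, g x * (χ x * ψ x) ∂(volOn D) := by
      rw [e1] at e0
      rw [e2]
      simp only [testMul_apply] at e0
      linear_combination -e0
    have hs : 1 ≤ √l := Real.one_le_sqrt.2 hl
    -- The available gain `1 / l` is weakened to `1 / √l`, using `l ≥ 1`, so that all terms have the
    -- same form.
    have hψ0 : ‖ψ.toLp 2 volume‖ ≤ ‖h.toLp 2 volume‖ / √l :=
      (SchwartzMap.norm_le_of_sub_laplacian hl0 hψ).trans
        (div_le_div_of_nonneg_left (norm_nonneg _) (by positivity)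
          (by nlinarith [Real.sq_sqrt hl0.le]))
    set H := ‖h.toLp 2 volume‖ / √l with hH
    have hH0 : 0 ≤ H := by positivity
    have b1 : ‖2 * ∑ i, ∫ x, v x * (fderiv ℝ χ x (b i) * (∂_{b i} ψ) x) ∂(volOn D)‖ ≤
        2 * ((∑ i, M₁ i) * (‖v‖ * H)) := by
      rw [norm_mul, Finset.sum_mul]
      simp only [RCLike.norm_ofNat]
      gcongr
      refine norm_sum_le_of_le _ fun i _ => ?_
      refine (norm_integral_mul_schwartz_le v (cd i) (hM₁ i) _).trans ?_
      rw [mul_assoc]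
      have := SchwartzMap.norm_lineDerivOp_le_of_sub_laplacian hl0 hψ i
      have := hM₁0 i
      gcongr
    have b2 : ‖∫ x, v x * (Δ (⇑χ) x * ψ x) ∂(volOn D)‖ ≤ M₂ * (‖v‖ * H) := by
      refine (norm_integral_mul_schwartz_le v cl hM₂ _).trans ?_
      rw [mul_assoc]
      gcongr
    have b3 : ‖∫ x, g x * (χ x * ψ x) ∂(volOn D)‖ ≤ M₀ * (‖g‖ * H) := by
      refine (norm_integral_mul_schwartz_le g χ.continuous hM₀ _).trans ?_
      rw [mul_assoc]
      gcongr
    rw [e3]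
    refine (norm_sub_le _ _).trans ((add_le_add ((norm_add_le _ _).trans
      (add_le_add b1 b2)) b3).trans ?_)
    have e4 : c * ‖h.toLp 2 volume‖ = (M₀ + 2 * ∑ i, M₁ i + M₂) * (‖v‖ + ‖g‖) * H := by
      rw [hc, hH]; ring
    rw [e4]
    have p1 : 0 ≤ M₀ * (‖v‖ * H) := by positivity
    have p2 : 0 ≤ (∑ i, M₁ i) * (‖g‖ * H) := by positivity
    have p3 : 0 ≤ M₂ * (‖g‖ * H) := by positivity
    linarith
  -- The conjugate makes `⟪a, h⟫` the bilinear pairing estimated in `key`. Density of Schwartz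
  -- functions extends the estimate to `w = a`, which gives the norm.
  set a := extendZero (star (mulOp (testLInf χ) v)) with ha
  have ha1 : ‖a‖ = ‖mulOp (testLInf χ) v‖ := by rw [ha, norm_extendZero, norm_star_L2]
  have hdense (w : Lp ℂ 2 (volume : Measure (EuclideanSpace ℝ (Fin n)))) :
      ‖⟪a, w⟫_ℂ‖ ≤ c * ‖w‖ := by
    refine (SchwartzMap.denseRange_toLpCLM (F := ℂ) (E := EuclideanSpace ℝ (Fin n))
      (μ := volume) (p := 2) ENNReal.ofNat_ne_top).induction_on
      (p := fun w => ‖⟪a, w⟫_ℂ‖ ≤ c * ‖w‖) w ?_ fun h => ?_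
    · exact isClosed_le (continuous_const.inner continuous_id).norm
        (continuous_const.mul continuous_norm)
    · have e : ⟪a, h.toLp 2 volume⟫_ℂ = ∫ x, v x * (χ x * h x) ∂(volOn D) := by
        rw [ha, inner_extendZero]
        refine integral_congr_ae ?_
        filter_upwards [ae_restrict_of_ae (h.coeFn_toLp 2 volume), coeFn_mulOp_testLInf χ v,
          Lp.coeFn_star (mulOp (testLInf χ) v)] with x h1 h2 h3
        rw [h1, h3, Pi.star_apply, h2]
        simp
        ring
      have := key h
      rw [← e] at this
      exact this
  have h1 := hdense a
  rw [inner_self_eq_norm_sq_to_K] at h1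
  rw [← ha1]
  rcases (norm_nonneg a).eq_or_lt with h0 | h0
  · rw [← h0]; positivity
  · have h2 : ‖a‖ * ‖a‖ ≤ c * ‖a‖ := by simpa [sq] using h1
    exact le_of_mul_le_mul_right h2 h0

end Transmission

namespace Transmission

open scoped SchwartzMap LineDeriv ComplexConjugate Manifold

variable {n : ℕ} {D : Opens (EuclideanSpace ℝ (Fin n))}

/-! ### The a priori estimate and the existence of a resolvent point -/

/-- The part of `closure D` outside `N` is compact and misses the frontier, so it lies in `D`. The
cutoff covers the whole region of `D` where the sign of `m` is unknown. -/
theorem exists_test_eq_one (hD : Bornology.IsBounded (D : Set (EuclideanSpace ℝ (Fin n))))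
    {N : Set (EuclideanSpace ℝ (Fin n))} (hN : IsOpen N)
    (hDN : frontier (D : Set (EuclideanSpace ℝ (Fin n))) ⊆ N) :
    ∃ χ : 𝓓(D, ℂ), ∀ x ∈ D, x ∉ N → χ x = 1 := by
  have hK : IsCompact (closure (D : Set (EuclideanSpace ℝ (Fin n))) \ N) :=
    hD.isCompact_closure.diff hN
  have hKD : closure (D : Set (EuclideanSpace ℝ (Fin n))) \ N ⊆ D := fun x hx => by
    by_contra h
    exact hx.2 (hDN (by rw [D.isOpen.frontier_eq]; exact ⟨hx.1, h⟩))
  obtain ⟨L, hL, hKL, hLD⟩ := exists_compact_between hK D.isOpen hKD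
  obtain ⟨f, hf1, hf0, -⟩ := exists_contMDiffMap_one_nhds_of_subset_interior (n := (⊤ : ℕ∞))
    (𝓘(ℝ, EuclideanSpace ℝ (Fin n))) hK.isClosed hKL
  have hs : Function.support (fun x => (f x : ℂ)) ⊆ L := fun x hx => by
    by_contra h
    exact hx (by simp [hf0 x h])
  have ht : tsupport (fun x => (f x : ℂ)) ⊆ L := closure_minimal hs hL.isClosed
  refine ⟨⟨fun x => (f x : ℂ), Complex.ofRealCLM.contDiff.comp f.contMDiff.contDiff,
    hL.of_isClosed_subset (isClosed_tsupport _) ht, ht.trans hLD⟩, fun x hx hxN => ?_⟩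
  have h1 : f x = 1 := hf1.self_of_nhdsSet x ⟨subset_closure hx, hxN⟩
  change ((f x : ℝ) : ℂ) = 1
  rw [h1, Complex.ofReal_one]

/-- The sign condition `Re (e^{iθ} m) ≥ mLow` on `N` together with the bound `|m| ≤ mUp`. -/
def IsSignDefiniteOn (N : Set (EuclideanSpace ℝ (Fin n))) (mLow mUp θ : ℝ) (m : LInf D) : Prop :=
  ∀ᵐ x ∂(volOn D), (x ∈ N → mLow ≤ (Complex.exp (θ * Complex.I) * m x).re) ∧ ‖m x‖ ≤ mUp

theorem IsSignDefiniteOn.star {N : Set (EuclideanSpace ℝ (Fin n))} {mLow mUp θ : ℝ} {m : LInf D}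
    (h : IsSignDefiniteOn N mLow mUp θ m) : IsSignDefiniteOn N mLow mUp (-θ) (star m) := by
  filter_upwards [h, Lp.coeFn_star m] with x hx hs
  have e : Complex.exp ((-θ : ℝ) * Complex.I) * Star.star (m x) =
      conj (Complex.exp (θ * Complex.I) * m x) := by
    rw [map_mul, ← Complex.exp_conj]
    simp
  rw [hs, Pi.star_apply, e, Complex.conj_re, norm_star]
  exact hx

theorem IsSignDefiniteOn.of_norm_sub_le {N : Set (EuclideanSpace ℝ (Fin n))} {mLow mUp θ δ : ℝ}
    {m p : LInf D} (h : IsSignDefiniteOn N mLow mUp θ m) (hp : ‖p - m‖ ≤ δ) :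
    IsSignDefiniteOn N (mLow - δ) (mUp + δ) θ p := by
  have h1 : ∀ᵐ x ∂(volOn D), ‖(p - m) x‖ ≤ δ := by
    have := ae_le_eLpNormEssSup (f := (p - m : LInf D)) (μ := volOn D)
    filter_upwards [this] with x hx
    refine le_trans ?_ hp
    rw [Lp.norm_def, eLpNorm_exponent_top, ← toReal_enorm]
    exact ENNReal.toReal_mono (by
      rw [← eLpNorm_exponent_top]; exact Lp.eLpNorm_ne_top _) hx
  filter_upwards [h, h1, Lp.coeFn_sub p m] with x hx h2 h3
  rw [h3, Pi.sub_apply] at h2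
  constructor
  · intro hxN
    have h4 := hx.1 hxN
    have h5 : (Complex.exp (θ * Complex.I) * p x).re = (Complex.exp (θ * Complex.I) * m x).re +
        (Complex.exp (θ * Complex.I) * (p x - m x)).re := by
      rw [← Complex.add_re]; ring_nf
    have h6 := Complex.abs_re_le_norm (Complex.exp (θ * Complex.I) * (p x - m x))
    rw [norm_mul, Complex.norm_exp_ofReal_mul_I, one_mul] at h6
    have := (abs_le.1 (h6.trans h2)).1
    linarith
  · have := norm_sub_norm_le (p x) (m x)
    linarith [hx.2]

theorem norm_sq_eq_integral (w : L2 D) : ‖w‖ ^ 2 = ∫ x, ‖w x‖ ^ 2 ∂(volOn D) := by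
  have h : ⟪w, w⟫_ℂ = ((∫ x, ‖w x‖ ^ 2 ∂(volOn D) : ℝ) : ℂ) := by
    rw [inner_eq_integral, ← integral_complex_ofReal]
    refine integral_congr_ae (Eventually.of_forall fun x => ?_)
    simp [Complex.mul_conj, Complex.normSq_eq_norm_sq]
  rw [inner_self_eq_norm_sq_to_K] at h
  exact Complex.ofReal_injective (by simpa using h)

theorem integrable_norm_sq (w : L2 D) : Integrable (fun x => ‖w x‖ ^ 2) (volOn D) :=
  (memLp_two_iff_integrable_sq_norm (Lp.memLp w).1).1 (Lp.memLp w)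

/-- The inequality is pointwise under the integral. On `N` it is the sign condition. Off `N`, where
`χ = 1`, the real part is at least `-mUp`, and the term with `mLow + mUp` compensates for it. -/
theorem IsSignDefiniteOn.mul_norm_sq_le {N : Set (EuclideanSpace ℝ (Fin n))} {mLow mUp θ : ℝ}
    {m : LInf D} (h : IsSignDefiniteOn N mLow mUp θ m) (hLow : 0 < mLow) {χ : 𝓓(D, ℂ)}
    (hχ : ∀ x ∈ D, x ∉ N → χ x = 1) (v : L2 D) (hUp : 0 ≤ mUp) :
    mLow * ‖v‖ ^ 2 ≤ ‖⟪v, mulOp m v⟫_ℂ‖ + (mLow + mUp) * ‖mulOp (testLInf χ) v‖ ^ 2 := by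
  have i1 : Integrable (fun x => mulOp m v x * conj (v x)) (volOn D) :=
    (Lp.memLp (mulOp m v)).integrable_mul (Lp.memLp v).star
  have i2 : Integrable (fun x => (Complex.exp (θ * Complex.I) * (mulOp m v x * conj (v x))).re)
      (volOn D) := Complex.reCLM.integrable_comp (i1.const_mul _)
  have e1 : (Complex.exp (θ * Complex.I) * ⟪v, mulOp m v⟫_ℂ).re =
      ∫ x, (Complex.exp (θ * Complex.I) * (mulOp m v x * conj (v x))).re ∂(volOn D) := by
    rw [inner_eq_integral, ← integral_const_mul]
    exact (Complex.reCLM.integral_comp_comm (i1.const_mul _)).symm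
  have e2 : mLow * ‖v‖ ^ 2 ≤ (Complex.exp (θ * Complex.I) * ⟪v, mulOp m v⟫_ℂ).re +
      (mLow + mUp) * ‖mulOp (testLInf χ) v‖ ^ 2 := by
    rw [e1, norm_sq_eq_integral, norm_sq_eq_integral, ← integral_const_mul, ← integral_const_mul,
      ← integral_add i2 ((integrable_norm_sq _).const_mul _)]
    refine integral_mono_ae ((integrable_norm_sq _).const_mul _)
      (i2.add ((integrable_norm_sq _).const_mul _)) ?_
    filter_upwards [h, Lp.coeFn_lpSMul (r := 2) m v, coeFn_mulOp_testLInf χ v,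
      ae_restrict_mem D.isOpen.measurableSet] with x h1 h2 h3 h4
    have e3 : (Complex.exp (θ * Complex.I) * (mulOp m v x * conj (v x))).re =
        (Complex.exp (θ * Complex.I) * m x).re * ‖v x‖ ^ 2 := by
      rw [mulOp_apply, h2, Pi.smul_apply', smul_eq_mul, mul_assoc (m x), Complex.mul_conj,
        Complex.normSq_eq_norm_sq, ← mul_assoc, Complex.re_mul_ofReal]
    change mLow * ‖v x‖ ^ 2 ≤ (Complex.exp (θ * Complex.I) * (mulOp m v x * conj (v x))).re +
      (mLow + mUp) * ‖mulOp (testLInf χ) v x‖ ^ 2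
    rw [e3, h3, norm_mul, mul_pow]
    by_cases hx : x ∈ N
    · have := h1.1 hx
      have h5 : 0 ≤ (mLow + mUp) * (‖χ x‖ ^ 2 * ‖v x‖ ^ 2) := by positivity
      have h6 := mul_le_mul_of_nonneg_right this (sq_nonneg ‖v x‖)
      linarith
    · rw [hχ x h4 hx, norm_one, one_pow, one_mul]
      have h5 := Complex.abs_re_le_norm (Complex.exp (θ * Complex.I) * m x)
      rw [norm_mul, Complex.norm_exp_ofReal_mul_I, one_mul] at h5
      have h6 := (abs_le.1 (h5.trans h1.2)).1
      have h7 := mul_le_mul_of_nonneg_right h6 (sq_nonneg ‖v x‖)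
      linarith
  refine e2.trans (add_le_add_left ((Complex.re_le_norm _).trans ?_) _)
  rw [norm_mul, Complex.norm_exp_ofReal_mul_I, one_mul]

theorem IsSignDefiniteOn.norm_mulOp_apply_le {N : Set (EuclideanSpace ℝ (Fin n))} {mLow mUp θ : ℝ}
    {m : LInf D} (h : IsSignDefiniteOn N mLow mUp θ m) (v : L2 D) :
    ‖mulOp m v‖ ≤ mUp * ‖v‖ := by
  refine Lp.norm_le_mul_norm_of_ae_le_mul ?_
  filter_upwards [h, Lp.coeFn_lpSMul (r := 2) m v] with x h1 h2
  rw [mulOp_apply, h2, Pi.smul_apply', norm_smul]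
  exact mul_le_mul_of_nonneg_right h1.2 (norm_nonneg _)

/-- The absorption argument for norms. If `v ≤ f + g` nothing is to be shown. Otherwise `g ≤ v`, so
after absorbing half of `a v²` every remaining term is at most a constant times `(f + g) v`, and `v`
cancels. -/
theorem le_mul_of_quadratic_le {a b f g u v : ℝ} (ha : 0 < a) (hb : 0 ≤ b) (hf : 0 ≤ f) (hg : 0 ≤ g)
    (hv : 0 ≤ v) (hu : u ≤ f + b * v)
    (h : a * v ^ 2 ≤ f * v + u * g + a / 4 * (v + g) ^ 2) :
    v ≤ (1 + (2 / a) * (2 + b + a / 2)) * (f + g) := by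
  have h0 : 0 ≤ (2 / a) * (2 + b + a / 2) * (f + g) := by positivity
  rcases le_total v (f + g) with hvF | hvF
  · linarith
  have h1 : a / 4 * (v + g) ^ 2 ≤ a / 2 * v ^ 2 + a / 2 * g ^ 2 := by
    nlinarith [mul_nonneg ha.le (sq_nonneg (v - g))]
  have h2 : u * g ≤ (f + b * v) * g := mul_le_mul_of_nonneg_right hu hg
  have hgv : g ≤ v := by linarith
  have h3 : f * g ≤ f * v := mul_le_mul_of_nonneg_left hgv hf
  have h4 : 0 ≤ b * v * f := by positivity
  have h5 : a / 2 * g ^ 2 ≤ a / 2 * (g * v) := by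
    rw [sq]; gcongr
  have h6 : 0 ≤ a / 2 * (f * v) := by positivity
  have h7 : 0 ≤ g * v := by positivity
  have h8 : a / 2 * v * v ≤ (2 + b + a / 2) * (f + g) * v := by linarith
  rcases hv.eq_or_lt with hv0 | hv0
  · rw [← hv0]; positivity
  have h9 := le_of_mul_le_mul_right h8 hv0
  have h10 : v ≤ (2 / a) * ((2 + b + a / 2) * (f + g)) := by
    rw [div_mul_eq_mul_div, le_div_iff₀ ha]
    linarith
  linarith

/-- The central estimate. Its point `l` is independent of `m` and `θ`, so that one choice serves the
operator and its adjoint simultaneously. -/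
theorem exists_norm_le_of_mem_graph {N : Set (EuclideanSpace ℝ (Fin n))} {mLow mUp : ℝ}
    (hLow : 0 < mLow) (hUp : 0 ≤ mUp) {χ : 𝓓(D, ℂ)} (hχ : ∀ x ∈ D, x ∉ N → χ x = 1) :
    ∃ l C : ℝ, ∀ (m : LInf D) (θ : ℝ), IsSignDefiniteOn N mLow mUp θ m →
      ∀ x y, (x, y) ∈ (transmissionOp m).graph → ‖x‖ ≤ C * ‖y - (l : ℂ) • x‖ := by
  obtain ⟨C, hC0, hC⟩ := exists_norm_mulOp_testLInf_le χ
  -- This size of `l` makes the interior term `(mLow + mUp) ‖χ v‖²` at most `mLow / 4 * (‖v‖ +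
  -- ‖g‖)²`, small enough to be absorbed; `l ≥ 1` is required by the interior estimate.
  set l : ℝ := max 1 (4 * (mLow + mUp) * C ^ 2 / mLow) with hl
  set c : ℝ := 1 + (2 / mLow) * (2 + mUp + mLow / 2) with hc
  refine ⟨l, (1 + (1 + mUp) * c) * 2, fun m θ hm x y hxy => ?_⟩
  have hl1 : 1 ≤ l := le_max_left _ _
  have hl0 : 0 < l := by linarith
  have hc1 : 1 ≤ c := by
    have : 0 ≤ 2 / mLow * (2 + mUp + mLow / 2) := by positivity
    linarith
  obtain ⟨hu, hv⟩ := mem_graph_transmissionOp.1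
    (show (WithLp.toLp 2 (x.fst, x.snd), WithLp.toLp 2 (y.fst, y.snd)) ∈
      (transmissionOp m).graph from hxy)
  set u := x.fst
  set v := x.snd
  set f := y.fst - (l : ℂ) • u with hf
  set g := y.snd - (l : ℂ) • v with hg
  have hf' : (y - (l : ℂ) • x).fst = f := rfl
  have hg' : (y - (l : ℂ) • x).snd = g := rfl
  have n1 : ‖f‖ + ‖g‖ ≤ 2 * ‖y - (l : ℂ) • x‖ := by
    have h1 := WithLp.norm_fst_le (L2 D) (y - (l : ℂ) • x)
    have h2 := WithLp.norm_snd_le (L2 D) (y - (l : ℂ) • x)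
    rw [hf'] at h1
    rw [hg'] at h2
    linarith
  have n2 : ‖x‖ ≤ ‖u‖ + ‖v‖ := by
    have := WithLp.prod_norm_sq_eq_of_L2 x
    refine abs_le_of_sq_le_sq' ?_ (by positivity) |>.2
    rw [this]
    nlinarith [norm_nonneg u, norm_nonneg v]
  have hu' : ‖u‖ ≤ ‖f‖ + mUp * ‖v‖ := by
    have h1 := norm_fst_le_of_mem_H20 hu l
    change l * ‖u‖ ≤ ‖y.fst - mulOp m v - (l : ℂ) • u‖ at h1
    have h2 : y.fst - mulOp m v - (l : ℂ) • u = f - mulOp m v := by rw [hf]; abel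
    rw [h2] at h1
    have h3 := h1.trans (norm_sub_le _ _)
    have h4 := hm.norm_mulOp_apply_le v
    nlinarith [norm_nonneg u]
  -- Green's formula between `u ∈ H²₀(D)` and `v`. It has no boundary terms, and the contributions
  -- of the real number `l` cancel.
  have e1 : ⟪f, v⟫_ℂ - ⟪mulOp m v, v⟫_ℂ = ⟪u, g⟫_ℂ := by
    have h1 := isWeakLaplacian_iff_inner.1 hv _ hu
    change ⟪y.fst - mulOp m v, v⟫_ℂ = ⟪u, y.snd⟫_ℂ at h1
    rw [hf, hg, inner_sub_left, inner_smul_left, inner_sub_right, inner_smul_right,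
      Complex.conj_ofReal, ← h1, inner_sub_left]
    ring
  have e2 : ‖⟪v, mulOp m v⟫_ℂ‖ ≤ ‖f‖ * ‖v‖ + ‖u‖ * ‖g‖ := by
    rw [norm_inner_symm, show ⟪mulOp m v, v⟫_ℂ = ⟪f, v⟫_ℂ - ⟪u, g⟫_ℂ by rw [← e1]; ring]
    exact (norm_sub_le _ _).trans (add_le_add (norm_inner_le_norm _ _) (norm_inner_le_norm _ _))
  have e3 := hm.mul_norm_sq_le hLow hχ v hUp
  have e4 : (mLow + mUp) * ‖mulOp (testLInf χ) v‖ ^ 2 ≤ mLow / 4 * (‖v‖ + ‖g‖) ^ 2 := by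
    have h1 := hC l hl1 v g (by rw [hg, sub_add_cancel]; exact hv)
    have h2 : ‖mulOp (testLInf χ) v‖ ^ 2 ≤ C ^ 2 * (‖v‖ + ‖g‖) ^ 2 / l := by
      refine (pow_le_pow_left₀ (norm_nonneg _) h1 2).trans (le_of_eq ?_)
      rw [div_pow, mul_pow, Real.sq_sqrt hl0.le]
    have h3 : 4 * (mLow + mUp) * C ^ 2 ≤ l * mLow := (div_le_iff₀ hLow).1 (le_max_right _ _)
    have h4 : (mLow + mUp) * (C ^ 2 * (‖v‖ + ‖g‖) ^ 2 / l) ≤ mLow / 4 * (‖v‖ + ‖g‖) ^ 2 := by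
      rw [← mul_div_assoc, div_le_iff₀ hl0]
      nlinarith [sq_nonneg (‖v‖ + ‖g‖)]
    exact (mul_le_mul_of_nonneg_left h2 (by positivity)).trans h4
  set F := ‖f‖ + ‖g‖ with hF
  have hf0 := norm_nonneg f
  have hg0 := norm_nonneg g
  have hv0 := norm_nonneg v
  have e5 : ‖v‖ ≤ c * F := le_mul_of_quadratic_le hLow hUp (norm_nonneg _) (norm_nonneg _)
    (norm_nonneg _) hu' (by linarith)
  calc ‖x‖ ≤ F + (1 + mUp) * ‖v‖ := by linarith
    _ ≤ F + (1 + mUp) * (c * F) := by gcongr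
    _ = (1 + (1 + mUp) * c) * F := by ring
    _ ≤ (1 + (1 + mUp) * c) * (2 * ‖y - (l : ℂ) • x‖) := by gcongr
    _ = _ := by ring

theorem isClosed_graph_transmissionOp (m : LInf D) :
    IsClosed ((transmissionOp m).graph : Set (L2Sum D × L2Sum D)) := by
  have e : ((transmissionOp m).graph : Set (L2Sum D × L2Sum D)) =
      {p | WithLp.toLp 2 (p.1.fst, p.2.fst - mulOp m p.1.snd) ∈ (H20 D : Set (L2Sum D))} ∩
      {p | WithLp.toLp 2 (p.1.snd, p.2.snd) ∈ {x : L2Sum D | IsWeakLaplacian x.fst x.snd}} := by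
    ext ⟨x, y⟩
    exact mem_graph_transmissionOp (u := x.fst) (v := x.snd) (f := y.fst) (g := y.snd)
  have c1 : Continuous fun p : L2Sum D × L2Sum D => p.1.fst :=
    continuous_fst.comp _root_.continuous_fst
  have c2 : Continuous fun p : L2Sum D × L2Sum D => p.1.snd :=
    continuous_snd.comp _root_.continuous_fst
  have c3 : Continuous fun p : L2Sum D × L2Sum D => p.2.fst :=
    continuous_fst.comp _root_.continuous_snd
  have c4 : Continuous fun p : L2Sum D × L2Sum D => p.2.snd :=
    continuous_snd.comp _root_.continuous_snd
  rw [e]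
  refine IsClosed.inter ?_ ?_
  · exact (testGraph D).isClosed_topologicalClosure.preimage
      ((WithLp.prod_continuous_toLp 2 (L2 D) (L2 D)).comp
        (c1.prodMk (c3.sub ((mulOp m).continuous.comp c2))))
  · exact isClosed_isWeakLaplacian.preimage
      ((WithLp.prod_continuous_toLp 2 (L2 D) (L2 D)).comp (c2.prodMk c4))

theorem H20_zero_mem : WithLp.toLp 2 ((0 : L2 D), (0 : L2 D)) ∈ H20 D := (H20 D).zero_mem

theorem isWeakLaplacian_zero : IsWeakLaplacian (0 : L2 D) 0 :=
  isWeakLaplacian_of_mem_H20 H20_zero_mem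

/-- A vector orthogonal to the range of `B_m - l` gives, after swapping its components, a solution
of `(B_{m̄} - l) x = 0`. -/
theorem mem_graph_transmissionOp_star_of_orthogonal {m : LInf D} {l : ℝ} {w : L2Sum D}
    (hw : ∀ x y, (x, y) ∈ (transmissionOp m).graph → ⟪w, y - (l : ℂ) • x⟫_ℂ = 0) :
    (WithLp.toLp 2 (w.snd, w.fst), (l : ℂ) • WithLp.toLp 2 (w.snd, w.fst)) ∈
      (transmissionOp (star m)).graph := by
  refine mem_graph_transmissionOp (u := w.snd) (v := w.fst) (f := (l : ℂ) • w.snd)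
    (g := (l : ℂ) • w.fst) |>.2 ⟨?_, ?_⟩
  -- Testing with domain elements `(0, v)` shows that the second component of `w` satisfies the
  -- adjoint condition defining `H²₀(D)`; this is where boundary regularity is gained.
  · refine mem_H20_iff_inner.2 fun v g' hv => ?_
    have h1 := hw _ _ (mem_graph_transmissionOp (m := m) (u := 0) (v := v) (f := mulOp m v) (g := g')
      |>.2 ⟨by rw [← mulOp_apply, sub_self]; exact H20_zero_mem, hv⟩)
    rw [WithLp.prod_inner_apply] at h1
    change ⟪w.fst, mulOp m v - (l : ℂ) • (0 : L2 D)⟫_ℂ + ⟪w.snd, g' - (l : ℂ) • v⟫_ℂ = 0 at h1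
    rw [smul_zero, sub_zero, inner_mulOp_star, inner_sub_right, inner_smul_right] at h1
    change ⟪(l : ℂ) • w.snd - mulOp (star m) w.fst, v⟫_ℂ = ⟪w.snd, g'⟫_ℂ
    rw [inner_sub_left, inner_smul_left, Complex.conj_ofReal]
    linear_combination -h1
  -- Testing with domain elements `(u, 0)` gives the equation for the first component of `w`.
  · refine isWeakLaplacian_iff_inner.2 fun x hx => ?_
    have h1 := hw _ _ (mem_graph_transmissionOp (m := m) (u := x.fst) (v := 0) (f := x.snd) (g := 0)
      |>.2 ⟨by rw [← mulOp_apply, map_zero, sub_zero]; exact hx, isWeakLaplacian_zero⟩)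
    rw [WithLp.prod_inner_apply] at h1
    change ⟪w.fst, x.snd - (l : ℂ) • x.fst⟫_ℂ + ⟪w.snd, (0 : L2 D) - (l : ℂ) • (0 : L2 D)⟫_ℂ = 0 at h1
    rw [smul_zero, sub_zero, inner_zero_right, add_zero, inner_sub_right, inner_smul_right,
      sub_eq_zero] at h1
    rw [← inner_conj_symm x.snd, h1, map_mul, Complex.conj_ofReal, inner_conj_symm,
      inner_smul_right]

/-- A vector orthogonal to the range solves, after the swap, the homogeneous problem for the
conjugate contrast. That problem satisfies the same estimate at the same `l`, so the vector is zero.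
-/
theorem exists_isResolventAt {N : Set (EuclideanSpace ℝ (Fin n))} {mLow mUp : ℝ}
    (hLow : 0 < mLow) (hUp : 0 ≤ mUp) {χ : 𝓓(D, ℂ)} (hχ : ∀ x ∈ D, x ∉ N → χ x = 1) :
    ∃ l : ℝ, ∀ (m : LInf D) (θ : ℝ), IsSignDefiniteOn N mLow mUp θ m →
      ∃ R, UnboundedOperator.IsResolventAt (transmissionOp m) l R := by
  obtain ⟨l, C, h⟩ := exists_norm_le_of_mem_graph hLow hUp hχ
  refine ⟨l, fun m θ hm => UnboundedOperator.exists_isResolventAt_of_norm_le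
    (isClosed_graph_transmissionOp m) (h m θ hm) fun w hw => ?_⟩
  have h1 := h _ _ hm.star _ _ (mem_graph_transmissionOp_star_of_orthogonal hw)
  rw [sub_self, norm_zero, mul_zero, norm_le_zero_iff] at h1
  have h2 : w.snd = 0 := congrArg WithLp.fst h1
  have h3 : w.fst = 0 := congrArg WithLp.snd h1
  exact WithLp.ofLp_injective 2 (Prod.ext h3 h2)

end Transmission

/-! ### Splitting into low and high frequencies -/

namespace SchwartzMap

open scoped LineDeriv SchwartzMap FourierTransform

variable {E : Type*} [NormedAddCommGroup E] [InnerProductSpace ℝ E] [FiniteDimensional ℝ E]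
  [MeasurableSpace E] [BorelSpace E]

theorem fourier_laplacian_apply (f : 𝓢(E, ℂ)) (ξ : E) :
    𝓕 (Δ f) ξ = -(((2 * Real.pi * ‖ξ‖) ^ 2 : ℝ) : ℂ) * 𝓕 f ξ := by
  have hT : (fun x : E => ‖x‖ ^ 2).HasTemperateGrowth := by fun_prop
  rw [laplacian_eq_fourierMultiplierCLM, fourierMultiplierCLM_apply,
    ← FourierTransform.fourierInv_smul, FourierTransform.fourier_fourierInv_eq, smul_apply]
  erw [smulLeftCLM_apply_apply hT]
  simp only [Complex.real_smul]
  push_cast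
  ring

theorem norm_sq_toLp (f : 𝓢(E, ℂ)) : ‖f.toLp 2 (volume : Measure E)‖ ^ 2 = ∫ x, ‖f x‖ ^ 2 := by
  have h := inner_toL2_toL2_eq f f (volume : Measure E)
  rw [inner_self_eq_norm_sq_to_K] at h
  have h2 : ∫ x, ⟪f x, f x⟫_ℂ = ((∫ x, ‖f x‖ ^ 2 : ℝ) : ℂ) := by
    rw [← integral_complex_ofReal]
    refine integral_congr_ae (Eventually.of_forall fun x => ?_)
    simp
  rw [h2] at h
  exact Complex.ofReal_injective (by simpa using h)

/-- Low frequencies bounded by `S`, high frequencies by the Laplacian. -/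
theorem norm_toLp_le_of_fourier_le (f : 𝓢(E, ℂ)) {R S : ℝ} (hR : 0 < R) (hS : 0 ≤ S)
    (h : ∀ ξ ∈ Metric.closedBall (0 : E) R, ‖𝓕 f ξ‖ ≤ S) :
    ‖f.toLp 2 (volume : Measure E)‖ ≤ √(volume.real (Metric.closedBall (0 : E) R)) * S +
      ((2 * Real.pi * R) ^ 2)⁻¹ * ‖(Δ f).toLp 2 (volume : Measure E)‖ := by
  set V := volume.real (Metric.closedBall (0 : E) R) with hV
  set c := ((2 * Real.pi * R) ^ 2)⁻¹ with hc
  have hc0 : 0 ≤ c := by positivity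
  have hi (g : 𝓢(E, ℂ)) : Integrable (fun ξ => ‖g ξ‖ ^ 2) :=
    (memLp_two_iff_integrable_sq_norm (g.memLp 2 volume).1).1 (g.memLp 2 volume)
  have hb : Integrable ((Metric.closedBall (0 : E) R).indicator fun _ => S ^ 2) :=
    (integrable_indicator_iff Metric.isClosed_closedBall.measurableSet).2
      (integrableOn_const (isCompact_closedBall (0 : E) R).measure_lt_top.ne)
  -- Outside the ball of radius `R` the transform of `f` is at most `(2πR)⁻²` times that of its
  -- Laplacian; inside, the bound `S` is used. Plancherel translates the result back.
  have h1 : ∫ ξ, ‖𝓕 f ξ‖ ^ 2 ≤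
      ∫ ξ, ((Metric.closedBall (0 : E) R).indicator (fun _ => S ^ 2) ξ + c ^ 2 * ‖𝓕 (Δ f) ξ‖ ^ 2) := by
    refine integral_mono (hi _) (hb.add ((hi _).const_mul _)) fun ξ => ?_
    by_cases hξ : ξ ∈ Metric.closedBall (0 : E) R
    · simp only [Set.indicator_of_mem hξ]
      have := pow_le_pow_left₀ (norm_nonneg _) (h ξ hξ) 2
      have : 0 ≤ c ^ 2 * ‖𝓕 (Δ f) ξ‖ ^ 2 := by positivity
      linarith
    · simp only [Set.indicator_of_notMem hξ, zero_add]
      rw [← mul_pow]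
      refine pow_le_pow_left₀ (norm_nonneg _) ?_ 2
      rw [fourier_laplacian_apply, norm_mul, norm_neg, Complex.norm_real, Real.norm_eq_abs,
        abs_of_nonneg (by positivity), ← mul_assoc]
      refine le_mul_of_one_le_left (norm_nonneg _) ?_
      rw [hc, inv_mul_eq_div, one_le_div (by positivity)]
      have : R ≤ ‖ξ‖ := by simpa using (not_le.1 (by simpa using hξ)).le
      gcongr
  rw [integral_add hb ((hi _).const_mul _), integral_const_mul,
    integral_indicator_const _ Metric.isClosed_closedBall.measurableSet,
    integral_norm_sq_fourier, integral_norm_sq_fourier, ← norm_sq_toLp, ← norm_sq_toLp,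
    smul_eq_mul] at h1
  refine abs_le_of_sq_le_sq' ?_ (by positivity) |>.2
  have h2 : (√V) ^ 2 = V := Real.sq_sqrt measureReal_nonneg
  have h3 : 0 ≤ (√V * S) * (c * ‖(Δ f).toLp 2 (volume : Measure E)‖) := by positivity
  calc _ ≤ V * S ^ 2 + c ^ 2 * ‖(Δ f).toLp 2 (volume : Measure E)‖ ^ 2 := h1
    _ = (√V * S) ^ 2 + (c * ‖(Δ f).toLp 2 (volume : Measure E)‖) ^ 2 := by
      rw [mul_pow, mul_pow, h2]
    _ ≤ _ := by nlinarith

end SchwartzMap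

namespace Transmission

open scoped SchwartzMap LineDeriv ComplexConjugate FourierTransform

variable {n : ℕ} {D : Opens (EuclideanSpace ℝ (Fin n))}

/-! ### Rellich's theorem for `H²₀(D)` -/

/-- The plane waves `x ↦ exp (2πi ⟨x, ξ⟩)` as a continuous family in `L²(D)`. -/
theorem exists_planeWave (hD : Bornology.IsBounded (D : Set (EuclideanSpace ℝ (Fin n)))) :
    ∃ e : EuclideanSpace ℝ (Fin n) → L2 D, Continuous e ∧
      ∀ (φ : 𝓓(D, ℂ)) ξ, ⟪e ξ, (testPair φ).fst⟫_ℂ = 𝓕 (testSchwartz φ) ξ := by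
  have : IsFiniteMeasure (volOn D) := ⟨by
    rw [Measure.restrict_apply_univ]; exact hD.measure_lt_top⟩
  obtain ⟨ρ, hρ⟩ := hD.subset_closedBall 0
  have hm (ξ : EuclideanSpace ℝ (Fin n)) :
      MemLp (fun x => Complex.exp (Complex.I * ((2 * Real.pi * ⟪x, ξ⟫_ℝ : ℝ) : ℂ))) 2 (volOn D) :=
    MemLp.of_bound (by fun_prop) 1 (Eventually.of_forall fun x => by
      rw [Complex.norm_exp_I_mul_ofReal])
  refine ⟨fun ξ => (hm ξ).toLp, ?_, fun φ ξ => ?_⟩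
  -- Since `D` lies in a ball of radius `ρ`, two plane waves differ pointwise on `D` by at most `2π
  -- |ρ| ‖ξ - η‖`; `c` comes from the passage from the supremum to the `L²` norm on a set of finite
  -- measure.
  · set c : ℝ := (measureUnivNNReal (volOn D) : ℝ) ^ (2 : ℝ≥0∞).toReal⁻¹ with hc
    refine (LipschitzWith.of_dist_le_mul (K := (c * (2 * Real.pi * |ρ|)).toNNReal)
      fun ξ η => ?_).continuous
    rw [Real.coe_toNNReal _ (by positivity), dist_eq_norm, dist_eq_norm, mul_assoc]
    refine Lp.norm_le_of_ae_bound (by positivity) ?_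
    filter_upwards [(hm ξ).coeFn_toLp, (hm η).coeFn_toLp, Lp.coeFn_sub (hm ξ).toLp (hm η).toLp,
      ae_restrict_mem D.isOpen.measurableSet] with x h1 h2 h3 h4
    rw [h3, Pi.sub_apply, h1, h2]
    have e1 : Complex.exp (Complex.I * ((2 * Real.pi * ⟪x, ξ⟫_ℝ : ℝ) : ℂ)) -
        Complex.exp (Complex.I * ((2 * Real.pi * ⟪x, η⟫_ℝ : ℝ) : ℂ)) =
        Complex.exp (Complex.I * ((2 * Real.pi * ⟪x, η⟫_ℝ : ℝ) : ℂ)) *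
          (Complex.exp (Complex.I * ((2 * Real.pi * ⟪x, ξ - η⟫_ℝ : ℝ) : ℂ)) - 1) := by
      rw [mul_sub, ← Complex.exp_add, mul_one, inner_sub_right]
      congr 2
      push_cast
      ring
    rw [e1, norm_mul, Complex.norm_exp_I_mul_ofReal, one_mul]
    refine Real.norm_exp_I_mul_ofReal_sub_one_le.trans ?_
    rw [norm_mul, Real.norm_of_nonneg (by positivity : 0 ≤ 2 * Real.pi), mul_assoc]
    have h5 : ‖x‖ ≤ |ρ| := (by simpa using hρ h4 : ‖x‖ ≤ ρ).trans (le_abs_self _)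
    have h6 := norm_inner_le_norm (𝕜 := ℝ) x (ξ - η)
    have h7 : ‖⟪x, ξ - η⟫_ℝ‖ ≤ |ρ| * ‖ξ - η‖ := h6.trans (by gcongr)
    have h8 := mul_le_mul_of_nonneg_left h7 (by positivity : 0 ≤ 2 * Real.pi)
    linarith
  · rw [inner_eq_integral, SchwartzMap.fourier_coe, Real.fourier_eq']
    have e1 : ∫ x, (testPair φ).fst x * conj ((hm ξ).toLp _ x) ∂(volOn D) =
        ∫ x, Complex.exp (((-2 * Real.pi * ⟪x, ξ⟫_ℝ : ℝ) : ℂ) * Complex.I) • testSchwartz φ x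
          ∂(volOn D) := by
      refine integral_congr_ae ?_
      filter_upwards [(hm ξ).coeFn_toLp, (memLp_test φ).coeFn_toLp] with x h1 h2
      rw [h1, show (testPair φ).fst x = φ x from h2, testSchwartz_apply, ← Complex.exp_conj,
        smul_eq_mul, mul_comm]
      congr 2
      rw [map_mul, Complex.conj_I, Complex.conj_ofReal]
      push_cast
      ring
    rw [e1, setIntegral_eq_integral_test fun x hx => by
      rw [testSchwartz_apply, eq_zero_of_notMem φ hx, smul_zero]]

theorem norm_testPair_fst (φ : 𝓓(D, ℂ)) :
    ‖(testPair φ).fst‖ = ‖(testSchwartz φ).toLp 2 volume‖ := by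
  refine (sq_eq_sq₀ (norm_nonneg _) (norm_nonneg _)).1 ?_
  rw [norm_sq_eq_integral, SchwartzMap.norm_sq_toLp]
  refine Eq.trans ?_ (setIntegral_eq_integral_of_forall_compl_eq_zero
    (s := (D : Set (EuclideanSpace ℝ (Fin n))))
    fun x hx => by rw [testSchwartz_apply, eq_zero_of_notMem φ hx]; simp)
  refine integral_congr_ae ?_
  filter_upwards [(memLp_test φ).coeFn_toLp] with x hx
  rw [show (testPair φ).fst x = φ x from hx, testSchwartz_apply]

theorem norm_testPair_snd (φ : 𝓓(D, ℂ)) :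
    ‖(testPair φ).snd‖ = ‖(Δ (testSchwartz φ)).toLp 2 volume‖ := by
  refine (sq_eq_sq₀ (norm_nonneg _) (norm_nonneg _)).1 ?_
  rw [norm_sq_eq_integral, SchwartzMap.norm_sq_toLp]
  refine Eq.trans ?_ (setIntegral_eq_integral_of_forall_compl_eq_zero
    (s := (D : Set (EuclideanSpace ℝ (Fin n))))
    fun x hx => by
      rw [laplacian_testSchwartz_apply, laplacian_eq_zero_of_notMem φ hx]; simp)
  refine integral_congr_ae ?_
  filter_upwards [(memLp_laplacian_test φ).coeFn_toLp] with x hx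
  rw [show (testPair φ).snd x = Δ (⇑φ) x from hx, laplacian_testSchwartz_apply]

/-- Fourier coefficients are pairings with plane waves. Finitely many vectors within `δ` of all
plane waves with `‖ξ‖ ≤ R` control all low frequencies up to `δ ‖x.fst‖`. The inequality is closed,
so it extends from test functions to `H²₀(D)`. -/
theorem norm_fst_le_of_planeWave {e : EuclideanSpace ℝ (Fin n) → L2 D}
    (he : ∀ (φ : 𝓓(D, ℂ)) ξ, ⟪e ξ, (testPair φ).fst⟫_ℂ = 𝓕 (testSchwartz φ) ξ)
    {R δ : ℝ} (hR : 0 < R) (hδ : 0 ≤ δ) {t : Finset (L2 D)}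
    (ht : ∀ ξ ∈ Metric.closedBall (0 : EuclideanSpace ℝ (Fin n)) R, ∃ w ∈ t, ‖e ξ - w‖ ≤ δ)
    {x : L2Sum D} (hx : x ∈ H20 D) :
    ‖x.fst‖ ≤ √(volume.real (Metric.closedBall (0 : EuclideanSpace ℝ (Fin n)) R)) *
      (‖fun w : t => ⟪(w : L2 D), x.fst⟫_ℂ‖ + δ * ‖x.fst‖) +
      ((2 * Real.pi * R) ^ 2)⁻¹ * ‖x.snd‖ := by
  refine H20_induction (p := fun x => ‖x.fst‖ ≤
      √(volume.real (Metric.closedBall (0 : EuclideanSpace ℝ (Fin n)) R)) *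
      (‖fun w : t => ⟪(w : L2 D), x.fst⟫_ℂ‖ + δ * ‖x.fst‖) +
      ((2 * Real.pi * R) ^ 2)⁻¹ * ‖x.snd‖) ?_ (fun φ => ?_) hx
  · have c1 : Continuous fun x : L2Sum D => fun w : t => ⟪(w : L2 D), x.fst⟫_ℂ :=
      continuous_pi fun w => continuous_const.inner continuous_fst
    have c2 := continuous_fst (D := D)
    have c3 := continuous_snd (D := D)
    exact isClosed_le c2.norm ((continuous_const.mul (c1.norm.add (continuous_const.mul
      c2.norm))).add (continuous_const.mul c3.norm))
  · have h := SchwartzMap.norm_toLp_le_of_fourier_le (testSchwartz φ) hR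
      (S := ‖fun w : t => ⟪(w : L2 D), (testPair φ).fst⟫_ℂ‖ + δ * ‖(testPair φ).fst‖)
      (by positivity) fun ξ hξ => by
        obtain ⟨w, hw, hwξ⟩ := ht ξ hξ
        rw [← he, show e ξ = w + (e ξ - w) by abel, inner_add_left]
        refine (norm_add_le _ _).trans (add_le_add ?_ ?_)
        · exact norm_le_pi_norm (fun w : t => ⟪(w : L2 D), (testPair φ).fst⟫_ℂ) ⟨w, hw⟩
        · exact (norm_inner_le_norm _ _).trans (by gcongr)
    rwa [← norm_testPair_fst, ← norm_testPair_snd] at h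

variable (D) in
/-- The inclusion `H²₀(D) → L²(D)`. -/
def inclH20 : H20 D →L[ℂ] L2 D := (WithLp.fstL 2 ℂ (L2 D) (L2 D)) ∘L (H20 D).subtypeL

/-- High frequencies are small by the bound on the Laplacian. Low frequencies are, up to a small
error, seen by finitely many functionals, because the plane waves with bounded frequency form a
compact set in `L²(D)`. No regularity of the boundary is used. -/
theorem isCompactOperator_inclH20
    (hD : Bornology.IsBounded (D : Set (EuclideanSpace ℝ (Fin n)))) :
    IsCompactOperator (inclH20 D) := by
  obtain ⟨e, hec, he⟩ := exists_planeWave hD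
  refine isCompactOperator_of_norm_le_add fun ε hε => ?_
  -- `R` makes the high frequency factor at most `ε / 2`, and `δ` below makes `V * δ ≤ ε / 2`.
  set R : ℝ := max 1 (2 / ε) with hR
  have hR1 : 1 ≤ R := le_max_left _ _
  set V := √(volume.real (Metric.closedBall (0 : EuclideanSpace ℝ (Fin n)) R)) with hV
  set δ : ℝ := ε / (2 * (V + 1)) with hδ
  have hV0 : 0 ≤ V := Real.sqrt_nonneg _
  have hδ0 : 0 < δ := by positivity
  have hK := ((isCompact_closedBall (0 : EuclideanSpace ℝ (Fin n)) R).image hec).totallyBounded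
  obtain ⟨s, hs, hcov⟩ := Metric.totallyBounded_iff.1 hK δ hδ0
  set t := hs.toFinset with ht
  have htc : ∀ ξ ∈ Metric.closedBall (0 : EuclideanSpace ℝ (Fin n)) R, ∃ w ∈ t, ‖e ξ - w‖ ≤ δ := by
    intro ξ hξ
    obtain ⟨w, hw, h⟩ := Set.mem_iUnion₂.1 (hcov ⟨ξ, hξ, rfl⟩)
    exact ⟨w, hs.mem_toFinset.2 hw, (mem_ball_iff_norm.1 h).le⟩
  refine ⟨t → ℂ, inferInstance, inferInstance,
    (V : ℂ) • ContinuousLinearMap.pi fun w : t => (innerSL ℂ (w : L2 D)) ∘L inclH20 D,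
    isCompactOperator_of_locallyCompactSpace_dom _, fun x => ?_⟩
  have h := norm_fst_le_of_planeWave he (by linarith) hδ0.le htc x.2
  rw [smul_apply, norm_smul, Complex.norm_real, Real.norm_of_nonneg hV0]
  change ‖(x : L2Sum D).fst‖ ≤ ε * ‖(x : L2Sum D)‖ +
    V * ‖fun w : t => ⟪(w : L2 D), (x : L2Sum D).fst⟫_ℂ‖
  have h1 : ‖(x : L2Sum D).fst‖ ≤ ‖(x : L2Sum D)‖ := WithLp.norm_fst_le (L2 D) _
  have h2 : ‖(x : L2Sum D).snd‖ ≤ ‖(x : L2Sum D)‖ := WithLp.norm_snd_le (L2 D) _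
  have h3 : V * δ ≤ ε / 2 := by
    rw [hδ, ← mul_div_assoc, div_le_div_iff₀ (by positivity) (by positivity)]
    nlinarith
  have h4 : ((2 * Real.pi * R) ^ 2)⁻¹ ≤ ε / 2 := by
    rw [inv_le_comm₀ (by positivity) (by positivity), inv_div]
    refine (le_max_right 1 (2 / ε)).trans ?_
    change R ≤ _
    have h5 : R ≤ 2 * Real.pi * R := le_mul_of_one_le_left (by linarith)
      (by linarith [Real.pi_gt_three])
    exact h5.trans (le_self_pow₀ (hR1.trans h5) two_ne_zero)
  have h5 : V * δ * ‖(x : L2Sum D).fst‖ ≤ ε / 2 * ‖(x : L2Sum D)‖ := by gcongr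
  have h6 : ((2 * Real.pi * R) ^ 2)⁻¹ * ‖(x : L2Sum D).snd‖ ≤ ε / 2 * ‖(x : L2Sum D)‖ := by gcongr
  linarith

end Transmission

namespace Transmission

open UnboundedOperator

variable {n : ℕ} {D : Opens (EuclideanSpace ℝ (Fin n))}

/-! ### The resolvent of the transmission operator -/

variable (D) in
/-- The inclusion of the first summand. -/
def inlL2 : L2 D →L[ℂ] L2Sum D :=
  (WithLp.prodContinuousLinearEquiv 2 ℂ (L2 D) (L2 D)).symm.toContinuousLinearMap ∘L
    ContinuousLinearMap.inl ℂ (L2 D) (L2 D)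

variable (D) in
/-- The inclusion of the second summand. -/
def inrL2 : L2 D →L[ℂ] L2Sum D :=
  (WithLp.prodContinuousLinearEquiv 2 ℂ (L2 D) (L2 D)).symm.toContinuousLinearMap ∘L
    ContinuousLinearMap.inr ℂ (L2 D) (L2 D)

variable (D) in
/-- The first projection. -/
def fstL2 : L2Sum D →L[ℂ] L2 D := WithLp.fstL 2 ℂ (L2 D) (L2 D)

variable (D) in
/-- The second projection. -/
def sndL2 : L2Sum D →L[ℂ] L2 D := WithLp.sndL 2 ℂ (L2 D) (L2 D)

theorem inlL2_apply (u : L2 D) : inlL2 D u = WithLp.toLp 2 (u, 0) := rfl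

theorem inlL2_add_inrL2 (x : L2Sum D) : inlL2 D x.fst + inrL2 D x.snd = x := by
  refine WithLp.ofLp_injective 2 (Prod.ext ?_ ?_)
  · exact add_zero x.fst
  · exact zero_add x.snd

/-- In block form only the lower left entry may fail to be compact. Every product of entries
occurring in `R²` contains a compact factor from the first row or the lower right corner. -/
theorem isCompactOperator_sq_of_components {R : L2Sum D →L[ℂ] L2Sum D}
    (h₁ : IsCompactOperator (fstL2 D ∘L R)) (h₂ : IsCompactOperator (sndL2 D ∘L R ∘L inrL2 D)) :
    IsCompactOperator (R * R) := by
  have e : R * R = inlL2 D ∘L ((fstL2 D ∘L R) ∘L R) +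
      (inrL2 D ∘L (sndL2 D ∘L R ∘L inlL2 D)) ∘L (fstL2 D ∘L R) +
      inrL2 D ∘L ((sndL2 D ∘L R ∘L inrL2 D) ∘L (sndL2 D ∘L R)) := by
    ext1 x
    change R (R x) = inlL2 D (R (R x)).fst + inrL2 D (R (inlL2 D (R x).fst)).snd +
      inrL2 D (R (inrL2 D (R x).snd)).snd
    rw [add_assoc, ← map_add, ← WithLp.add_snd, ← map_add, inlL2_add_inrL2, inlL2_add_inrL2]
  have c₁ : IsCompactOperator (inlL2 D ∘L ((fstL2 D ∘L R) ∘L R)) :=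
    (h₁.comp_clm R).clm_comp (inlL2 D)
  have c₂ : IsCompactOperator ((inrL2 D ∘L (sndL2 D ∘L R ∘L inlL2 D)) ∘L (fstL2 D ∘L R)) :=
    h₁.clm_comp (inrL2 D ∘L (sndL2 D ∘L R ∘L inlL2 D))
  have c₃ : IsCompactOperator (inrL2 D ∘L ((sndL2 D ∘L R ∘L inrL2 D) ∘L (sndL2 D ∘L R))) :=
    (h₂.comp_clm (sndL2 D ∘L R)).clm_comp (inrL2 D)
  rw [e]
  exact (c₁.add c₂).add c₃

theorem resolvent_mem_H20 {m : LInf D} {z : ℂ} {R : L2Sum D →L[ℂ] L2Sum D}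
    (hR : IsResolventAt (transmissionOp m) z R) (y : L2Sum D) :
    WithLp.toLp 2 ((R y).fst, y.fst + z • (R y).fst - mulOp m (R y).snd) ∈ H20 D :=
  (mem_graph_transmissionOp (u := (R y).fst) (v := (R y).snd) (f := (y + z • R y).fst)
    (g := (y + z • R y).snd) |>.1 ((isResolventAt_iff_graph.1 hR).1 y)).1

/-- The first component of the resolvent, as an operator into `H²₀(D)`. -/
theorem exists_lift_fst_resolvent {m : LInf D} {z : ℂ} {R : L2Sum D →L[ℂ] L2Sum D}
    (hR : IsResolventAt (transmissionOp m) z R) :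
    ∃ T : L2Sum D →L[ℂ] H20 D, inclH20 D ∘L T = fstL2 D ∘L R :=
  -- The first component `u` is paired with `Δ u = y₁ + z u - m v`, which depends boundedly on `y`;
  -- so the lift into the graph norm is bounded.
  ⟨((inlL2 D ∘L fstL2 D ∘L R) + inrL2 D ∘L
    (fstL2 D + z • (fstL2 D ∘L R) - mulOp m ∘L sndL2 D ∘L R)).codRestrict (H20 D) fun y => by
      convert resolvent_mem_H20 hR y using 1
      exact inlL2_add_inrL2 (WithLp.toLp 2 ((R y).fst, y.fst + z • (R y).fst - mulOp m (R y).snd)),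
    by
      ext1 y
      change (R y).fst + (0 : L2 D) = (R y).fst
      exact add_zero _⟩

/-- The resolvent as an operator into `H²₀(D) ⊕ L²(D)`. -/
theorem exists_lift_resolvent {m : LInf D} {z : ℂ} {R : L2Sum D →L[ℂ] L2Sum D}
    (hR : IsResolventAt (transmissionOp m) z R) :
    ∃ T : L2Sum D →L[ℂ] H20Sum D, incl D ∘L T = R := by
  obtain ⟨T, hT⟩ := exists_lift_fst_resolvent hR
  refine ⟨(WithLp.prodContinuousLinearEquiv 2 ℂ (H20 D) (L2 D)).symm.toContinuousLinearMap ∘L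
    T.prod (sndL2 D ∘L R), ?_⟩
  ext1 y
  have h1 : (T y : L2Sum D).fst = (R y).fst := congrArg (fun S : L2Sum D →L[ℂ] L2 D => S y) hT
  refine WithLp.ofLp_injective 2 (Prod.ext h1 rfl)

/-- Up to exchanging the components, the resolvents for `m` and `m̄` are adjoint to each other. -/
theorem inner_resolvent_star {m : LInf D} {l : ℝ} {R R' : L2Sum D →L[ℂ] L2Sum D}
    (hR : IsResolventAt (transmissionOp m) l R) (hR' : IsResolventAt (transmissionOp (star m)) l R')
    (y h : L2Sum D) :
    ⟪(R' h).snd, y.fst⟫_ℂ + ⟪(R' h).fst, y.snd⟫_ℂ =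
      ⟪h.snd, (R y).fst⟫_ℂ + ⟪h.fst, (R y).snd⟫_ℂ := by
  set x := R y with hx
  set x' := R' h with hx'
  obtain ⟨a1, a2⟩ := mem_graph_transmissionOp (u := x.fst) (v := x.snd)
    (f := (y + (l : ℂ) • x).fst) (g := (y + (l : ℂ) • x).snd) |>.1
    ((isResolventAt_iff_graph.1 hR).1 y)
  obtain ⟨b1, b2⟩ := mem_graph_transmissionOp (u := x'.fst) (v := x'.snd)
    (f := (h + (l : ℂ) • x').fst) (g := (h + (l : ℂ) • x').snd) |>.1
    ((isResolventAt_iff_graph.1 hR').1 h)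
  -- Green's formula is used twice, each time between the first component of one solution and the
  -- second component of the other.
  have c1 := isWeakLaplacian_iff_inner.1 b2 _ a1
  have c2 := isWeakLaplacian_iff_inner.1 a2 _ b1
  change ⟪y.fst + (l : ℂ) • x.fst - mulOp m x.snd, x'.snd⟫_ℂ =
    ⟪x.fst, h.snd + (l : ℂ) • x'.snd⟫_ℂ at c1
  change ⟪h.fst + (l : ℂ) • x'.fst - mulOp (star m) x'.snd, x.snd⟫_ℂ =
    ⟪x'.fst, y.snd + (l : ℂ) • x.snd⟫_ℂ at c2
  have c3 := congrArg (starRingEnd ℂ) c1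
  rw [inner_conj_symm, inner_conj_symm] at c3
  simp only [inner_add_left, inner_sub_left, inner_add_right, inner_sub_right, inner_smul_left,
    inner_smul_right, Complex.conj_ofReal, inner_mulOp_star] at c2 c3
  linear_combination c3 - c2

/-- The first row factors through the compact inclusion of `H²₀(D)`. The lower right entry for `m`
is adjoint to the upper left entry for the conjugate contrast, and the latter is compact for the
same reason. -/
theorem isCompactOperator_resolvent_sq
    (hD : Bornology.IsBounded (D : Set (EuclideanSpace ℝ (Fin n)))) {m : LInf D} {l : ℝ}
    {R R' : L2Sum D →L[ℂ] L2Sum D} (hR : IsResolventAt (transmissionOp m) l R)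
    (hR' : IsResolventAt (transmissionOp (star m)) l R') : IsCompactOperator (R * R) := by
  have hfst {m : LInf D} {R : L2Sum D →L[ℂ] L2Sum D} (hR : IsResolventAt (transmissionOp m) l R) :
      IsCompactOperator (fstL2 D ∘L R) := by
    obtain ⟨T, hT⟩ := exists_lift_fst_resolvent hR
    rw [← hT]
    exact (isCompactOperator_inclH20 hD).comp_clm T
  refine isCompactOperator_sq_of_components (hfst hR)
    (IsCompactOperator.of_formal_adjoint (S := (fstL2 D ∘L R') ∘L inlL2 D)
      ((hfst hR').comp_clm (inlL2 D)) fun g f => ?_)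
  have h1 := inner_resolvent_star hR hR' (inrL2 D g) (inlL2 D f)
  change ⟪(R' (inlL2 D f)).snd, (0 : L2 D)⟫_ℂ + ⟪(R' (inlL2 D f)).fst, g⟫_ℂ =
    ⟪(0 : L2 D), (R (inrL2 D g)).fst⟫_ℂ + ⟪f, (R (inrL2 D g)).snd⟫_ℂ at h1
  rw [inner_zero_right, inner_zero_left, zero_add, zero_add] at h1
  change ⟪(R (inrL2 D g)).snd, f⟫_ℂ = ⟪g, (R' (inlL2 D f)).fst⟫_ℂ
  rw [← inner_conj_symm, ← h1, inner_conj_symm]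

theorem exists_resolvent_point (hD : Bornology.IsBounded (D : Set (EuclideanSpace ℝ (Fin n))))
    {N : Set (EuclideanSpace ℝ (Fin n))} (hN : IsOpen N)
    (hDN : frontier (D : Set (EuclideanSpace ℝ (Fin n))) ⊆ N) {mLow mUp θ : ℝ}
    (hLow : 0 < mLow) (hUp : 0 ≤ mUp) {m : LInf D} (hm : IsSignDefiniteOn N mLow mUp θ m) :
    ∃ (z : ℂ) (R : L2Sum D →L[ℂ] L2Sum D), IsResolventAt (transmissionOp m) z R ∧
      IsCompactOperator (R * R) := by
  obtain ⟨χ, hχ⟩ := exists_test_eq_one hD hN hDN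
  obtain ⟨l, hl⟩ := exists_isResolventAt hLow hUp hχ
  obtain ⟨R, hR⟩ := hl m θ hm
  obtain ⟨R', hR'⟩ := hl _ _ hm.star
  exact ⟨l, R, hR, isCompactOperator_resolvent_sq hD hR hR'⟩

/-! ### Perturbation of the contrast -/

theorem isBoundedPerturbation_transmissionOp (m p : LInf D) :
    IsBoundedPerturbation (transmissionOp m) (transmissionOp p)
      (inlL2 D ∘L mulOp (p - m) ∘L sndL2 D) := by
  intro x y
  have h1 := mem_graph_transmissionOp (m := p) (u := x.fst) (v := x.snd) (f := y.fst) (g := y.snd)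
  have h2 := mem_graph_transmissionOp (m := m) (u := x.fst) (v := x.snd)
    (f := y.fst - mulOp (p - m) x.snd) (g := y.snd)
  have e1 : y - (inlL2 D ∘L mulOp (p - m) ∘L sndL2 D) x =
      WithLp.toLp 2 (y.fst - mulOp (p - m) x.snd, y.snd) :=
    WithLp.ofLp_injective 2 (Prod.ext rfl (sub_zero y.snd))
  have e2 : y.fst - mulOp (p - m) x.snd - (m • x.snd : L2 D) = y.fst - (p • x.snd : L2 D) := by
    rw [mulOp_sub, ← mulOp_apply, ← mulOp_apply, sub_apply]
    abel
  rw [e2] at h2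
  rw [e1]
  exact h1.trans h2.symm

theorem norm_perturbation_le (m : LInf D) : ‖inlL2 D ∘L mulOp m ∘L sndL2 D‖ ≤ ‖m‖ := by
  refine ContinuousLinearMap.opNorm_le_bound _ (norm_nonneg _) fun x => ?_
  change ‖inlL2 D (mulOp m x.snd)‖ ≤ _
  rw [inlL2_apply, WithLp.norm_toLp_fst]
  calc ‖mulOp m x.snd‖ ≤ ‖m‖ * ‖x.snd‖ := Lp.norm_smul_le m _
    _ ≤ ‖m‖ * ‖x‖ := by gcongr; exact WithLp.norm_snd_le (L2 D) x

end Transmission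

end

/-! ### The main theorem -/

theorem theorem2 {n : ℕ} (D : Opens (EuclideanSpace ℝ (Fin n)))
    (hD : Bornology.IsBounded (D : Set (EuclideanSpace ℝ (Fin n))))
    (m : Transmission.LInf D) (mLow mUp θ : ℝ) (hLow : 0 < mLow) (hLowUp : mLow ≤ mUp)
    -- `Re (e^{iθ} m) > m_*` in a neighborhood `N` of the boundary
    (hBoundary : ∃ N : Set (EuclideanSpace ℝ (Fin n)), IsOpen N ∧
      frontier (D : Set (EuclideanSpace ℝ (Fin n))) ⊆ N ∧
      ∀ᵐ x ∂(Transmission.volOn D), x ∈ N → mLow < (Complex.exp (θ * Complex.I) * m x).re)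
    -- `|m| < m^*` in `D`
    (hBound : ∀ᵐ x ∂(Transmission.volOn D), ‖m x‖ < mUp) :
    -- the spectrum is a discrete set without finite accumulation points
    (∀ r : ℝ, (UnboundedOperator.spectrum (Transmission.transmissionOp m) ∩
      Metric.closedBall 0 r).Finite) ∧
    -- every point of the spectrum is an eigenvalue
    (∀ z ∈ UnboundedOperator.spectrum (Transmission.transmissionOp m),
      UnboundedOperator.eigenspace (Transmission.transmissionOp m) z ≠ ⊥) ∧
    -- the generalized eigenspaces are finite dimensional
    (∀ z : ℂ, FiniteDimensional ℂ
      (UnboundedOperator.genEigenspace (Transmission.transmissionOp m) z)) ∧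
    -- the eigenspaces are linearly independent
    iSupIndep (fun z : ℂ => UnboundedOperator.eigenspace (Transmission.transmissionOp m) z) ∧
    -- continuity at `m` of the spectral projection along every rectifiable curve that avoids the
    -- spectrum, as an operator `L² ⊕ L² → H²₀ ⊕ L²`
    (∀ (γ : ℝ → ℂ) (a b : ℝ) (K : NNReal), a ≤ b → LipschitzOnWith K γ (Set.Icc a b) →
      (∀ t ∈ Set.Icc a b, γ t ∉ UnboundedOperator.spectrum (Transmission.transmissionOp m)) →
      ∃ P : Transmission.LInf D → (Transmission.L2Sum D →L[ℂ] Transmission.H20Sum D),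
        (∀ᶠ p in 𝓝 m,
          (∀ t ∈ Set.Icc a b,
            γ t ∉ UnboundedOperator.spectrum (Transmission.transmissionOp p)) ∧
          Transmission.incl D ∘L P p =
            UnboundedOperator.spectralProjection (Transmission.transmissionOp p) γ a b) ∧
        ContinuousAt P m) ∧
    -- continuity of eigenvalues and generalized eigenspaces: if a circle avoids the spectrum, then
    -- for contrasts `p` near `m` the projection (along the circle, run through clockwise) is a
    -- projection onto the sum of the generalized eigenspaces of the enclosed eigenvalues, and the
    -- total algebraic multiplicity of the enclosed eigenvalues does not change
    (∀ (c : ℂ) (r : ℝ), 0 < r →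
      Disjoint (Metric.sphere c r)
        (UnboundedOperator.spectrum (Transmission.transmissionOp m)) →
      ∀ᶠ p in 𝓝 m,
        IsIdempotentElem (UnboundedOperator.spectralProjection (Transmission.transmissionOp p)
          (fun t => circleMap c r (-t)) 0 (2 * Real.pi)) ∧
        (UnboundedOperator.spectralProjection (Transmission.transmissionOp p)
          (fun t => circleMap c r (-t)) 0 (2 * Real.pi)).range =
            UnboundedOperator.spectralSubspace (Transmission.transmissionOp p)
              (Metric.ball c r) ∧
        FiniteDimensional ℂ (UnboundedOperator.spectralSubspace (Transmission.transmissionOp p)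
          (Metric.ball c r)) ∧
        Module.finrank ℂ (UnboundedOperator.spectralSubspace (Transmission.transmissionOp p)
          (Metric.ball c r)) =
          Module.finrank ℂ (UnboundedOperator.spectralSubspace (Transmission.transmissionOp m)
            (Metric.ball c r))) := by
  obtain ⟨N, hN, hDN, hmN⟩ := hBoundary
  have hsd : Transmission.IsSignDefiniteOn N mLow mUp θ m := by
    filter_upwards [hmN, hBound] with x h1 h2
    exact ⟨fun h => (h1 h).le, h2.le⟩
  obtain ⟨z₀, R₀, h₀, hc⟩ :=
    Transmission.exists_resolvent_point hD hN hDN hLow (hLow.le.trans hLowUp) hsd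
  -- Contrasts within `mLow / 2` of `m` satisfy the sign condition on the same `N` with constants
  -- `mLow / 2` and `mUp + mLow / 2`, so each has its own resolvent point with compact square.
  have hnear : ∀ᶠ p in 𝓝 m, ∃ (z : ℂ) (R : Transmission.L2Sum D →L[ℂ] Transmission.L2Sum D),
      UnboundedOperator.IsResolventAt (Transmission.transmissionOp p) z R ∧
        IsCompactOperator (R * R) := by
    filter_upwards [Metric.closedBall_mem_nhds m (half_pos hLow)] with p hp
    exact Transmission.exists_resolvent_point hD hN hDN (by linarith) (by linarith)
      (hsd.of_norm_sub_le (mem_closedBall_iff_norm.1 hp))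
  obtain ⟨T₀, hT₀⟩ := Transmission.exists_lift_resolvent h₀
  have : CompleteSpace (Transmission.H20 D) :=
    (Transmission.testGraph D).isClosed_topologicalClosure.completeSpace_coe
  have : CompleteSpace (Transmission.H20Sum D) := inferInstance
  have hcurve (γ : ℝ → ℂ) (a b : ℝ) (K : NNReal) (hab : a ≤ b)
      (hγ : LipschitzOnWith K γ (Set.Icc a b))
      (hsp : ∀ t ∈ Set.Icc a b, γ t ∉ UnboundedOperator.spectrum (Transmission.transmissionOp m)) :=
    UnboundedOperator.exists_spectralProjection_continuousAt
      (fun p => Transmission.isBoundedPerturbation_transmissionOp m p)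
      (fun p => Transmission.norm_perturbation_le (p - m)) h₀ hT₀ hab hγ hsp
  refine ⟨fun r => UnboundedOperator.finite_spectrum_inter h₀ hc (isCompact_closedBall 0 r),
    fun z hz => UnboundedOperator.eigenspace_ne_bot h₀ hc hz,
    fun z => UnboundedOperator.finiteDimensional_genEigenspace h₀ hc z,
    UnboundedOperator.iSupIndep_eigenspace h₀, hcurve, fun c r hr hsph => ?_⟩
  have hmem (t : ℝ) : circleMap c r (-t) ∈ Metric.sphere c r := circleMap_mem_sphere c hr.le _
  have hL : LipschitzWith (Real.nnabs r * 1) fun t : ℝ => circleMap c r (-t) :=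
    (lipschitzWith_circleMap c r).comp LipschitzWith.id.neg
  obtain ⟨P, hP, hPc⟩ := hcurve (fun t => circleMap c r (-t)) 0 (2 * Real.pi) _
    Real.two_pi_pos.le hL.lipschitzOnWith fun t _ => Set.disjoint_left.1 hsph (hmem t)
  obtain ⟨idm, rgm, fdm⟩ := UnboundedOperator.spectralProjection_circle h₀ hc hr hsph
  have hcl : ContinuousAt (fun p => Transmission.incl D ∘L P p) m :=
    continuousAt_const.clm_comp hPc
  -- Distance less than one between the projections for `p` and `m`, as operators on `L² ⊕ L²`,
  -- forces equal rank; composing with the inclusion carries the continuity over.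
  filter_upwards [hP, hnear, hcl.eventually_mem (Metric.ball_mem_nhds _ one_pos)] with p hPp hp hlt
  obtain ⟨z, R, hz, hR⟩ := hp
  have hsph' : Disjoint (Metric.sphere c r)
      (UnboundedOperator.spectrum (Transmission.transmissionOp p)) := by
    refine Set.disjoint_left.2 fun w hw => ?_
    rw [← abs_of_pos hr, ← image_circleMap_Ioc] at hw
    obtain ⟨t, ht, rfl⟩ := hw
    -- The circle is run through clockwise, so the point with angle `t ∈ (0, 2π]` is reached at the
    -- parameter `2π - t`.
    have h := hPp.1 (2 * Real.pi - t) ⟨by linarith [ht.2], by linarith [ht.1]⟩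
    rwa [neg_sub, (periodic_circleMap c r).sub_eq] at h
  obtain ⟨idp, rgp, fdp⟩ := UnboundedOperator.spectralProjection_circle hz hR hr hsph'
  refine ⟨idp, rgp, fdp, ?_⟩
  rw [hPp.2, hP.self_of_nhds.2, mem_ball_iff_norm] at hlt
  rw [← rgp] at fdp ⊢
  rw [← rgm] at fdm ⊢
  exact (UnboundedOperator.finrank_range_le_of_norm_sub_lt_one idp hlt).antisymm
    (UnboundedOperator.finrank_range_le_of_norm_sub_lt_one idm (by rwa [norm_sub_rev]))
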